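/- Let $(\mathsf{AES}^{\lambda})_{\lambda}$ be an efficiently computable family of keyed functions $\mathsf{AES}^\lambda_k:\{0,1\}^\lambda\to\{0,1\}^\lambda$, $k\in\{0,1\}^\lambda$, which for $\lambda=128$ is the standard AES-128, and assume that it is a pseudorandom function (against probabilistic polynomial-time distinguishers; distinguishers may get a polynomial-length advice string, the same sequence of strings in assumption and conclusion). Let $H':\{0,1\}^*\to\{0,1\}^\lambda$ be a random oracle, and let $\mathcal F_{\mathsf{GC}}$ be the functionality that takes $x$ from a circuit generator and $y$ from a circuit evaluator and gives $BC(x,y)$ to the evaluator only, for an agreed circuit $BC$. Protocol. $P_A$ samples $k_A,k_A'$ and $P_B$ samples $k_B,k_B'$ uniformly from $\{0,1\}^\lambda$; put $k=k_A\oplus k_B$, $k'=k'_A\oplus k'_B$. Evaluation: the sender, with inputs $x_1,\dots,x_m\in\{0,1\}^*$, computes $a_i=H'(x_i)$; sender (generator, with its share of $k$ and the $a_i$) and receiver (evaluator, with its share of $k$) call $\mathcal F_{\mathsf{GC}}$, and the receiver obtains $\mathsf{AES}_k(a_1),\dots,\mathsf{AES}_k(a_m)$. Update: the updater selects values $z_1,\dots,z_m$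 among those it has received in evaluations; assistant (generator, with its share of $k'$) and updater (evaluator, with its share of $k'$ and the $z_j$) call $\mathcal F_{\mathsf{GC}}$, and the updater obtains $\mathsf{AES}_{k'}(z_1),\dots,\mathsf{AES}_{k'}(z_m)$. Either party may act in either role. Functionality $\mathcal F_{\mathsf{durPRF}}$. Init: on $(\mathsf{sid},k_A)$ from $P_A$ and $(\mathsf{sid},k_B)$ from $P_B$, start an empty table $T_{\mathsf{sid}}$ and record $k_A\oplus k_B$ (later Init messages for $\mathsf{sid}$ are ignored). Evaluation: on $(\mathsf{sid},x_1,\dots,x_m)$ from the sender and $(\mathsf{sid},m)$ from the receiver, fill each empty entry $T_{\mathsf{sid}}[x_i]$ with a uniform element of $\{0,1\}^\lambda$ and give $T_{\mathsf{sid}}[x_1],\dots,T_{\mathsf{sid}}[x_m]$ to the receiver. Update: on $(\mathsf{sid},\mathsf{sid}',z_1,\dots,z_m)$ from the updater and $(\mathsf{sid},\mathsf{sid}',m)$ from the assistant, sample uniform $z_j'$; for each $j$ in turn, if $z_j=T_{\mathsf{sid}}[x_j]$ for some $x_j$, then replace $z_j'$ by $T_{\mathsf{sid}'}[x_j]$ if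 this entry is filled, and otherwise set $T_{\mathsf{sid}'}[x_j]\leftarrow z_j'$; give $z'_1,\dots,z'_m$ to the updater. Theorem 3. (a) In the protocol the receiver obtains $F_k(x_i)=\mathsf{AES}_k(H'(x_i))$, and the update of $F_k(x)$ is $\mathsf{AES}_{k'}(\mathsf{AES}_k(H'(x)))$. (b) In the $\mathcal F_{\mathsf{GC}}$-hybrid model the protocol securely realizes $\mathcal F_{\mathsf{durPRF}}$, used with one session $\mathsf{sid}$ for evaluations and one session $\mathsf{sid}'$ for updates from $\mathsf{sid}$ and with uniformly random keys, against a semi-honest adversary that corrupts either party: for each corrupted party there is a probabilistic polynomial-time simulator which, from that party's inputs to and outputs from $\mathcal F_{\mathsf{durPRF}}$ and with access to $H'$, produces the party's view (its keys, the hash values it obtains, its outputs of $\mathcal F_{\mathsf{GC}}$), such that no probabilistic polynomial-time environment, which adaptively chooses the requests to both parties, sees all outputs and the view and may query $H'$, distinguishes the protocol from the ideal execution with more than negligible advantage in $\lambda$. -/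

import Mathlib

noncomputable section

namespace DurPRF

/-! ## Bit strings, blocks and parties -/

/-- The set `{0,1}^n`. -/
abbrev Block (n : ℕ) : Type := Fin n → Bool

/-- Bitwise exclusive or. -/
def Block.xor {n : ℕ} (a b : Block n) : Block n := fun i => Bool.xor (a i) (b i)

/-- The two parties. -/
inductive Party where
  | A
  | B
  deriving DecidableEq

/-- The other party. -/
def Party.other : Party → Party
  | .A => .B
  | .B => .A

/-! ## AES with 128-bit keys (FIPS 197) -/

namespace AES128

/-- Multiplication by `x` in `GF(2^8) = GF(2)[x] / (x^8 + x^4 + x^3 + x + 1)`. -/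
def xtime (a : BitVec 8) : BitVec 8 :=
  (a <<< 1) ^^^ (if a.msb then (27 : BitVec 8) else 0)

/-- Multiplication in `GF(2^8)`. -/
def gmul (a b : BitVec 8) : BitVec 8 :=
  (List.range 8).foldl (fun acc i => xtime acc ^^^ (if a.getLsbD (7 - i) then b else 0))
    (0 : BitVec 8)

/-- The S-box: inversion in `GF(2^8)` (with `0 ↦ 0`), computed as the power `254`, followed by
the affine map. -/
def sbox (a : BitVec 8) : BitVec 8 :=
  let b := (List.range 254).foldl (fun acc _ => gmul acc a) (1 : BitVec 8)
  b ^^^ b.rotateLeft 1 ^^^ b.rotateLeft 2 ^^^ b.rotateLeft 3 ^^^ b.rotateLeft 4 ^^^ (99 : BitVec 8)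

/-- The AES state: byte `r + 4 * c` is in row `r` and column `c`. -/
abbrev State : Type := Vector (BitVec 8) 16

/-- The position in row `r` and column `c`, both taken modulo 4. -/
def pos (r c : ℕ) : Fin 16 := Fin.ofNat 16 (r % 4 + 4 * (c % 4))

def subBytes (s : State) : State := Vector.ofFn fun i => sbox s[i]

def shiftRows (s : State) : State := Vector.ofFn fun i => s[pos i.val (i.val / 4 + i.val % 4)]

def mixColumns (s : State) : State := Vector.ofFn fun i =>
  let c := i.val / 4
  gmul 2 s[pos i.val c] ^^^ gmul 3 s[pos (i.val + 1) c] ^^^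
    s[pos (i.val + 2) c] ^^^ s[pos (i.val + 3) c]

def addRoundKey (k s : State) : State := Vector.ofFn fun i => s[i] ^^^ k[i]

/-- The round constant of round `j ≥ 1`. -/
def rcon (j : ℕ) : BitVec 8 := (List.range (j - 1)).foldl (fun acc _ => xtime acc) (1 : BitVec 8)

/-- Round key `j` from round key `j - 1`. -/
def nextKey (j : ℕ) (k : State) : State := Vector.ofFn fun i =>
  let r := i.val % 4
  let t := sbox k[pos (r + 1) 3] ^^^ (if r = 0 then rcon j else 0)
  (List.range (i.val / 4 + 1)).foldl (fun acc c => acc ^^^ k[pos r c]) t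

/-- The `j`-th round key. -/
def roundKey (k : State) : ℕ → State
  | 0 => k
  | j + 1 => nextKey (j + 1) (roundKey k j)

/-- The state after the first `j` full rounds. -/
def rounds (k s : State) : ℕ → State
  | 0 => addRoundKey k s
  | j + 1 => addRoundKey (roundKey k (j + 1)) (mixColumns (shiftRows (subBytes (rounds k s j))))

def encryptState (k s : State) : State :=
  addRoundKey (roundKey k 10) (shiftRows (subBytes (rounds k s 9)))

/-- Bits `8 * i, …, 8 * i + 7` of the block are byte `i`, most significant bit first. -/
def toState (b : Block 128) : State := Vector.ofFn fun i =>
  BitVec.ofBoolListBE ((List.finRange 8).map fun j : Fin 8 =>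
    b (Fin.ofNat 128 (8 * i.val + j.val)))

def ofState (s : State) : Block 128 := fun i =>
  s[Fin.ofNat 16 (i.val / 8)].getMsbD (i.val % 8)

/-- The AES-128 encryption of block `m` under key `k`. -/
def encrypt (k m : Block 128) : Block 128 := ofState (encryptState (toState k) (toState m))

end AES128

/-- AES as a family of keyed functions with `n`-bit keys and `n`-bit blocks, one for each security
parameter `n`; for `n = 128` it is the standard cipher. -/
structure AESFamily where
  enc : ∀ n : ℕ, Block n → Block n → Block n
  enc_standard : enc 128 = AES128.encrypt

/-! ## Data: binary trees, as in the WHILE language of Jones -/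

/-- Values on which programs compute. -/
inductive Val where
  | nil
  | cons (a b : Val)
  deriving DecidableEq

namespace Val

def size : Val → ℕ
  | nil => 1
  | cons a b => a.size + b.size + 1

def hd : Val → Val
  | nil => nil
  | cons a _ => a

def tl : Val → Val
  | nil => nil
  | cons _ b => b

/-- A value read as a list. -/
def toList : Val → List Val
  | nil => []
  | cons a b => a :: b.toList

def ofList : List Val → Val
  | [] => nil
  | a :: l => cons a (ofList l)

/-- A value read as a bit: `nil` is `0`, everything else is `1`. -/
def toBool : Val → Bool
  | nil => false
  | cons _ _ => true

def ofBool : Bool → Val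
  | false => nil
  | true => cons nil nil

/-- The natural number `n` in unary, that is, the string `1^n` of the security parameter. -/
def unary (n : ℕ) : Val := ofList (List.replicate n nil)

def toBits (v : Val) : List Bool := v.toList.map toBool

def ofBits (l : List Bool) : Val := ofList (l.map ofBool)

/-- A value read as an `n`-bit block (truncated, or padded with zeros). -/
def toBlock (n : ℕ) (v : Val) : Block n := fun i => v.toBits.getD i.val false

def ofBlock {n : ℕ} (b : Block n) : Val := ofBits (List.ofFn b)

def ofBlocks {n : ℕ} (l : List (Block n)) : Val := ofList (l.map ofBlock)

def toParty : Val → Party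
  | nil => .A
  | cons _ _ => .B

end Val

/-! ## Probabilistic oracle programs and their running time -/

/-- A finite computation that may toss fair coins and call an oracle. -/
inductive Comp (α : Type) where
  | pure (a : α)
  | coin (k : Bool → Comp α)
  | call (q : Val) (k : Val → Comp α)

namespace Comp

def bind {α β : Type} : Comp α → (α → Comp β) → Comp β
  | .pure a, f => f a
  | .coin k, f => .coin fun b => (k b).bind f
  | .call q k, f => .call q fun r => (k r).bind f

/-- `P` holds for the result, whatever the coins show and whatever the oracle replies, as long as
every reply `r` to a query `q` satisfies `ok q r`. -/
def All {α : Type} (ok : Val → Val → Prop) (P : α → Prop) : Comp α → Prop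
  | .pure a => P a
  | .coin k => ∀ b, (k b).All ok P
  | .call q k => ∀ r, ok q r → (k r).All ok P

/-- The distribution of the result (and of the final state of the oracle) when the computation
runs with the stateful probabilistic oracle `O`. -/
def run {α S : Type} (O : S → Val → PMF (Val × S)) : Comp α → S → PMF (α × S)
  | .pure a, s => PMF.pure (a, s)
  | .coin k, s => (PMF.uniformOfFintype Bool).bind fun b => (k b).run O s
  | .call q k, s => (O s q).bind fun r => (k r.1).run O r.2

end Comp

/-- The contents of the registers of a program. -/
abbrev Store : Type := ℕ → Val

/-- Expressions over the registers. -/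
inductive Expr where
  | reg (r : ℕ)
  | nil
  | cons (e f : Expr)
  | hd (e : Expr)
  | tl (e : Expr)
  | eq (e f : Expr)

namespace Expr

def eval (s : Store) : Expr → Val
  | reg r => s r
  | nil => Val.nil
  | cons e f => Val.cons (e.eval s) (f.eval s)
  | hd e => (e.eval s).hd
  | tl e => (e.eval s).tl
  | eq e f => Val.ofBool (decide (e.eval s = f.eval s))

/-- The cost of an evaluation: everything that is read, copied, or compared is paid for by its
full size. -/
def cost (s : Store) : Expr → ℕ
  | reg r => (s r).size
  | nil => 1
  | cons e f => e.cost s + f.cost s + 1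
  | hd e => e.cost s + 1
  | tl e => e.cost s + 1
  | eq e f => e.cost s + f.cost s + 1

end Expr

/-- Programs. The command `loop r c` executes `c` as many times as the list in register `r` had
entries when the loop was entered. (Under a polynomial bound on the cost such loops lose nothing
against unbounded ones: a polynomial clock in unary can be computed and looped over.) -/
inductive Cmd where
  | assign (r : ℕ) (e : Expr)
  | coin (r : ℕ)
  | call (r : ℕ) (e : Expr)
  | seq (c d : Cmd)
  | ite (r : ℕ) (c d : Cmd)
  | loop (r : ℕ) (c : Cmd)

/-- `k`-fold iteration of a computation. -/
def iter {α : Type} (f : α → Comp α) : ℕ → α → Comp α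
  | 0, a => .pure a
  | k + 1, a => (f a).bind (iter f k)

/-- The execution of a program on registers `p.1`, when `p.2` time units have already been used;
it results in the final registers and the total time. -/
def Cmd.exec : Cmd → Store × ℕ → Comp (Store × ℕ)
  | .assign r e, p => .pure (Function.update p.1 r (e.eval p.1), p.2 + e.cost p.1 + 1)
  | .coin r, p => .coin fun b => .pure (Function.update p.1 r (Val.ofBool b), p.2 + 1)
  | .call r e, p => .call (e.eval p.1) fun v =>
      .pure (Function.update p.1 r v, p.2 + e.cost p.1 + v.size + 1)
  | .seq c d, p => (c.exec p).bind d.exec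
  | .ite r c d, p => if p.1 r = Val.nil then d.exec (p.1, p.2 + 1) else c.exec (p.1, p.2 + 1)
  | .loop r c, p =>
      iter (fun q => c.exec (q.1, q.2 + 1)) (p.1 r).toList.length (p.1, p.2 + 1)

/-- Registers `0`, `1`, `2` hold the inputs, all others are `nil`. -/
def inputs (u v w : Val) : Store
  | 0 => u
  | 1 => v
  | 2 => w
  | _ => Val.nil

/-- The program accepts if register `0` finally differs from `nil`. -/
def accepts (p : Store × ℕ) : Bool := (p.1 0).toBool

/-- A keyed function family can be computed in polynomial time: on input `1^n`, a key and a block,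
the program always outputs the value. (The replies to oracle calls are arbitrary values of any
size and are paid for, so a program with bounded running time makes no such calls.) -/
def EfficientlyComputable (E : ∀ n : ℕ, Block n → Block n → Block n) : Prop :=
  ∃ (c : Cmd) (p : Polynomial ℕ), ∀ (n : ℕ) (k m : Block n),
    (c.exec (inputs (Val.unary n) (Val.ofBlock k) (Val.ofBlock m), 0)).All (fun _ _ => True)
      fun o => o.1 0 = Val.ofBlock (E n k m) ∧ o.2 ≤ p.eval n

/-- A function of the security parameter that tends to zero faster than every inverse power. -/
def Negligible (f : ℕ → ℝ) : Prop :=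
  Asymptotics.SuperpolynomialDecay Filter.atTop (fun n : ℕ => (n : ℝ)) f

/-! ## Pseudorandom functions -/

/-- Distinguisher `D` with input `1^n` and advice. -/
def prfStart (n : ℕ) (advice : List Bool) : Store × ℕ :=
  (inputs (Val.unary n) (Val.ofBits advice) Val.nil, 0)

/-- `D` has polynomial running time as an algorithm with oracle access to a function on `n`-bit
blocks. -/
def PRFDistinguisher (a : ℕ → List Bool) (D : Cmd) : Prop :=
  ∃ p : Polynomial ℕ, ∀ n : ℕ,
    (D.exec (prfStart n (a n))).All (fun _ r => ∃ b : Block n, r = Val.ofBlock b)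
      fun o => o.2 ≤ p.eval n

/-- Oracle access to a function on blocks. -/
def functionOracle {n : ℕ} (f : Block n → Block n) : Unit → Val → PMF (Val × Unit) :=
  fun _ q => PMF.pure (Val.ofBlock (f (q.toBlock n)), ())

/-- The output bit of `D` with oracle `f`. -/
def prfRun (a : ℕ → List Bool) (D : Cmd) (n : ℕ) (f : Block n → Block n) : PMF Bool :=
  ((D.exec (prfStart n (a n))).run (functionOracle f) ()).map fun o => accepts o.1

/-- `D` with oracle `E_k` for a uniform key `k`. -/
def prfReal (E : ∀ n : ℕ, Block n → Block n → Block n) (a : ℕ → List Bool) (D : Cmd) (n : ℕ) :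
    PMF Bool :=
  (PMF.uniformOfFintype (Block n)).bind fun k => prfRun a D n (E n k)

/-- `D` with a uniformly random function from `n`-bit blocks to `n`-bit blocks as oracle. -/
def prfIdeal (a : ℕ → List Bool) (D : Cmd) (n : ℕ) : PMF Bool :=
  (PMF.uniformOfFintype (Block n → Block n)).bind fun f => prfRun a D n f

/-- `E` is a pseudorandom function: no probabilistic polynomial-time distinguisher (with advice
`a`) tells `E_k` from a random function with more than negligible advantage. -/
def IsPRF (E : ∀ n : ℕ, Block n → Block n → Block n) (a : ℕ → List Bool) : Prop :=
  ∀ D : Cmd, PRFDistinguisher a D →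
    Negligible fun n => |(prfReal E a D n true).toReal - (prfIdeal a D n true).toReal|

/-! ## Lazily sampled random functions -/

/-- The part of a random function from bit strings to `n`-bit blocks that has been sampled. -/
abbrev Table (n : ℕ) : Type := List (List Bool × Block n)

/-- The value at `x`, chosen uniformly at random if the entry is still empty. -/
def Table.query {n : ℕ} (T : Table n) (x : List Bool) : PMF (Block n × Table n) :=
  match T.lookup x with
  | some b => PMF.pure (b, T)
  | none => (PMF.uniformOfFintype (Block n)).bind fun b => PMF.pure (b, T ++ [(x, b)])

/-- The values at `x_1, …, x_m`, one after the other. -/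
def Table.queryAll {n : ℕ} : List (List Bool) → Table n → PMF (List (Block n) × Table n)
  | [], T => PMF.pure ([], T)
  | x :: xs, T => (T.query x).bind fun o => (Table.queryAll xs o.2).bind fun o' =>
      PMF.pure (o.1 :: o'.1, o'.2)

/-! ## The functionality durPRF -/

/-- State of the functionality: for each session the recorded key and the table. -/
structure FuncState (n : ℕ) where
  key : ℕ → Option (Block n)
  table : ℕ → Table n

namespace FuncState

def empty (n : ℕ) : FuncState n := ⟨fun _ => none, fun _ => []⟩

/-- `Init.(sid, kA)` from one party and `Init.(sid, kB)` from the other. -/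
def init {n : ℕ} (F : FuncState n) (sid : ℕ) (kA kB : Block n) : FuncState n :=
  if (F.key sid).isSome then F
  else ⟨Function.update F.key sid (some (kA.xor kB)), Function.update F.table sid []⟩

/-- `Send.(sid, x_1, …, x_m)` from the sender and `Recv.(sid, m)` from the receiver; the first
component of the result goes to the receiver. -/
def eval {n : ℕ} (F : FuncState n) (sid : ℕ) (xs : List (List Bool)) :
    PMF (List (Block n) × FuncState n) :=
  (Table.queryAll xs (F.table sid)).map fun o =>
    (o.1, { F with table := Function.update F.table sid o.2 })

/-- The treatment of a single `z_j` in an update. -/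
def updateOne {n : ℕ} (F : FuncState n) (sid sid' : ℕ) (z : Block n) :
    PMF (Block n × FuncState n) :=
  (PMF.uniformOfFintype (Block n)).map fun z' =>
    match (F.table sid).find? (fun e => decide (e.2 = z)) with
    | none => (z', F)
    | some (x, _) =>
      match (F.table sid').lookup x with
      | some y => (y, F)
      | none =>
        (z', { F with table := Function.update F.table sid' (F.table sid' ++ [(x, z')]) })

/-- `Update.(sid, sid', z_1, …, z_m)` from the updater and `Update.(sid, sid', m)` from the
assistant; the first component of the result goes to the updater. -/
def update {n : ℕ} (sid sid' : ℕ) : List (Block n) → FuncState n →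
    PMF (List (Block n) × FuncState n)
  | [], F => PMF.pure ([], F)
  | z :: zs, F => (F.updateOne sid sid' z).bind fun o =>
      (update sid sid' zs o.2).bind fun o' => PMF.pure (o.1 :: o'.1, o'.2)

end FuncState

/-! ## The garbled-circuit protocol -/

/-- The ideal functionality for garbled circuits: on input `x` of the generator and `y` of the
evaluator it gives `BC x y` to the evaluator and nothing to the generator. -/
def garbledCircuit {X Y Z : Type} (BC : X → Y → Z) (x : X) (y : Y) : Unit × Z := ((), BC x y)

/-- The keys that a party samples in the initialization. -/
structure Keys (n : ℕ) where
  /-- share of the key `k` -/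
  cur : Block n
  /-- share of the updated key `k'` -/
  upd : Block n

/-- Both parties sample their key shares. -/
def sampleKeys (n : ℕ) : PMF (Party → Keys n) :=
  let U := PMF.uniformOfFintype (Block n)
  U.bind fun kA => U.bind fun kA' => U.bind fun kB => U.bind fun kB' =>
    PMF.pure fun
      | .A => ⟨kA, kA'⟩
      | .B => ⟨kB, kB'⟩

/-- What an execution of the evaluation gives to the parties. -/
structure EvalResult (n : ℕ) where
  /-- the hash values, obtained by the sender from the random oracle -/
  hashes : List (Block n)
  /-- the output of the garbled circuit, obtained by the receiver -/
  outs : List (Block n)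

/-- Evaluation: the sender hashes its inputs with the random oracle (with table `H`); then it is
the circuit generator with input its key share and the hash values, and the receiver is the circuit
evaluator with input its key share. -/
def protocolEval {n : ℕ} (E : Block n → Block n → Block n) (keys : Party → Keys n)
    (sender : Party) (xs : List (List Bool)) (H : Table n) : PMF (EvalResult n × Table n) :=
  (Table.queryAll xs H).map fun o =>
    let BC := fun (g : Block n × List (Block n)) (e : Block n) => g.2.map (E (g.1.xor e))
    (⟨o.1, (garbledCircuit BC ((keys sender).cur, o.1) (keys sender.other).cur).2⟩, o.2)

/-- Update: the assistant is the circuit generator with input its share of the new key, and the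
updater is the circuit evaluator with input its share and the list `zs`. -/
def protocolUpdate {n : ℕ} (E : Block n → Block n → Block n) (keys : Party → Keys n)
    (updater : Party) (zs : List (Block n)) : List (Block n) :=
  let BC := fun (g : Block n) (e : Block n × List (Block n)) => e.2.map (E (g.xor e.1))
  (garbledCircuit BC (keys updater.other).upd ((keys updater).upd, zs)).2

/-- The function `F_k(x) = E_k(H(x))`, where the random oracle has been sampled at `x`. -/
def prfValue {n : ℕ} (E : Block n → Block n → Block n) (H : Table n) (k : Block n)
    (x : List Bool) : Option (Block n) :=
  (H.lookup x).map (E k)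

/-- The receiver obtains `F_k(x_1), …, F_k(x_m)` for `k = kA ⊕ kB`, and an update of any values
among them gives the corresponding `E_{k'}(F_k(x))` for `k' = kA' ⊕ kB'`. -/
def ComputesPRF (E : ∀ n : ℕ, Block n → Block n → Block n) : Prop :=
  ∀ (n : ℕ) (keys : Party → Keys n) (sender : Party) (xs : List (List Bool)) (H : Table n),
    ∀ o ∈ (protocolEval (E n) keys sender xs H).support,
      let k := (keys .A).cur.xor (keys .B).cur
      let k' := (keys .A).upd.xor (keys .B).upd
      o.1.outs.map some = xs.map (prfValue (E n) o.2 k) ∧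
      ∀ xs' : List (List Bool), xs' ⊆ xs → ∀ zs : List (Block n),
        zs.map some = xs'.map (prfValue (E n) o.2 k) →
        (protocolUpdate (E n) keys sender.other zs).map some =
          xs'.map fun x => (prfValue (E n) o.2 k x).map (E n k')

/-! ## Security against a semi-honest party

An environment gives inputs to both parties, adaptively and in any number and order, with the
parties in any of the two roles; it sees all their outputs and the view of the corrupted party `σ`
and has access to the random oracle. -/

/-- A request of the environment. -/
inductive Query (n : ℕ) where
  /-- a query to the random oracle -/
  | hash (x : List Bool)
  /-- an evaluation -/
  | eval (sender : Party) (xs : List (List Bool))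
  /-- an update -/
  | update (updater : Party) (zs : List (Block n))

/-- The first entry tells the kind of a query, the second the active party, the rest is the list
of its inputs. Every value is a query. -/
def Query.decode (n : ℕ) (v : Val) : Query n :=
  match v.hd with
  | .nil => .hash v.tl.toBits
  | .cons .nil _ => .eval v.tl.hd.toParty (v.tl.tl.toList.map Val.toBits)
  | .cons (.cons _ _) _ => .update v.tl.hd.toParty (v.tl.tl.toList.map (Val.toBlock n))

/-- The reply to an evaluation or an update: the outputs of the receiver or updater, and the
messages added to the view of the corrupted party. -/
def reply {n : ℕ} (outs : List (Block n)) (view : Val) : Val := .cons (Val.ofBlocks outs) view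

/-- The form of a reply in an execution of the protocol. -/
def ReplyOk (n : ℕ) (q r : Val) : Prop :=
  match Query.decode n q with
  | .hash _ => ∃ b : Block n, r = Val.ofBlock b
  | .eval _ xs => ∃ Z V : List (Block n), Z.length = xs.length ∧ V.length = xs.length ∧
      r = reply Z (Val.ofBlocks V)
  | .update _ zs => r = .nil ∨ ∃ Z V : List (Block n), Z.length = zs.length ∧
      V.length ≤ zs.length ∧ r = reply Z (Val.ofBlocks V)

/-- The start of an environment: `1^n`, the advice, and the initial view of the corrupted party. -/
def envStart (n : ℕ) (advice : List Bool) (view : Val) : Store × ℕ :=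
  (inputs (Val.unary n) (Val.ofBits advice) view, 0)

/-- The initial view of a party: the keys that it has sampled. -/
def initialView {n : ℕ} (K : Keys n) : Val := Val.ofBlocks [K.cur, K.upd]

/-- Environments with polynomial running time. -/
def PolyEnvironment (a : ℕ → List Bool) (D : Cmd) : Prop :=
  ∃ p : Polynomial ℕ, ∀ (n : ℕ) (K : Keys n),
    (D.exec (envStart n (a n) (initialView K))).All (ReplyOk n) fun o => o.2 ≤ p.eval n

/-- State of an execution of the protocol: the random oracle, and the values that each party has
received in evaluations. -/
structure RealState (n : ℕ) where
  ro : Table n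
  received : Party → List (Block n)

/-- What the receiver of `outs` has received then. -/
def addReceived {n : ℕ} (rec : Party → List (Block n)) (p : Party) (outs : List (Block n)) :
    Party → List (Block n) :=
  Function.update rec p (rec p ++ outs)

/-- The protocol in the hybrid model, with corrupted party `σ`. The view of the sender grows by the
hash values, that of the receiver and of the updater by the output of the garbled circuit. A party
only updates values that it has received. -/
def realStep {n : ℕ} (E : Block n → Block n → Block n) (σ : Party) (keys : Party → Keys n)
    (s : RealState n) (q : Val) : PMF (Val × RealState n) :=
  match Query.decode n q with
  | .hash x => (s.ro.query x).map fun o => (Val.ofBlock o.1, { s with ro := o.2 })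
  | .eval p xs => (protocolEval E keys p xs s.ro).map fun o =>
      (reply o.1.outs (Val.ofBlocks (if σ = p then o.1.hashes else o.1.outs)),
        ⟨o.2, addReceived s.received p.other o.1.outs⟩)
  | .update p zs =>
      if ∀ z ∈ zs, z ∈ s.received p then
        let outs := protocolUpdate E keys p zs
        PMF.pure (reply outs (Val.ofBlocks (if σ = p then outs else [])), s)
      else PMF.pure (.nil, s)

/-- The output of environment `D` in an execution of the protocol. -/
def realRun (E : ∀ n : ℕ, Block n → Block n → Block n) (σ : Party) (a : ℕ → List Bool) (D : Cmd)
    (n : ℕ) : PMF Bool :=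
  (sampleKeys n).bind fun keys =>
    ((D.exec (envStart n (a n) (initialView (keys σ)))).run (realStep (E n) σ keys)
      ⟨[], fun _ => []⟩).map fun o => accepts o.1

/-- What a simulator is told: the inputs of the corrupted party to the functionality and its
outputs from the functionality. -/
inductive Event (n : ℕ) where
  /-- the keys of the corrupted party -/
  | init (K : Keys n)
  /-- it has sent `xs` in an evaluation -/
  | sent (xs : List (List Bool))
  /-- it has received `outs` in an evaluation -/
  | received (outs : List (Block n))
  /-- it has updated `zs` to `outs` -/
  | updated (zs outs : List (Block n))
  /-- it has assisted in an update of `m` values -/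
  | assisted (m : ℕ)

def Event.encode {n : ℕ} : Event n → Val
  | .init K => .cons (Val.unary 0) (initialView K)
  | .sent xs => .cons (Val.unary 1) (Val.ofList (xs.map Val.ofBits))
  | .received outs => .cons (Val.unary 2) (Val.ofBlocks outs)
  | .updated zs outs => .cons (Val.unary 3) (.cons (Val.ofBlocks zs) (Val.ofBlocks outs))
  | .assisted m => .cons (Val.unary 4) (Val.unary m)

/-- One activation of a simulator: on input `1^n`, its state and an event, it outputs the simulated
messages and its new state (and the time used in total is counted up from `t`). -/
def activate (S : Cmd) (n : ℕ) (state : Val) (t : ℕ) {m : ℕ} (e : Event m) :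
    Comp ((Val × Val) × ℕ) :=
  (S.exec (inputs (Val.unary n) state e.encode, t)).bind fun o => .pure ((o.1 0, o.1 1), o.2)

/-- The time that a simulator uses in a sequence of activations. -/
def totalTime (S : Cmd) (n : ℕ) : List (Event n) → Val → ℕ → Comp ℕ
  | [], _, t => .pure t
  | e :: es, state, t => (activate S n state t e).bind fun o => totalTime S n es o.1.2 o.2

/-- The simulator, with access to the random oracle, runs in time polynomial in the security
parameter and the total length of its inputs. -/
def PolySimulator (S : Cmd) : Prop :=
  ∃ p : Polynomial ℕ, ∀ (n : ℕ) (es : List (Event n)),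
    (totalTime S n es Val.nil 0).All (fun _ r => ∃ b : Block n, r = Val.ofBlock b)
      fun t => t ≤ p.eval (n + (es.map fun e => e.encode.size).sum)

/-- Access to the random oracle. -/
def roStep {n : ℕ} (H : Table n) (q : Val) : PMF (Val × Table n) :=
  (H.query q.toBits).map fun o => (Val.ofBlock o.1, o.2)

/-- State of an ideal execution. -/
structure IdealState (n : ℕ) where
  ro : Table n
  func : FuncState n
  received : Party → List (Block n)
  sim : Val

/-- The simulator `S` processes an event: the simulated messages and the new state. -/
def simulate {n : ℕ} (S : Cmd) (s : IdealState n) (e : Event n) : PMF (Val × IdealState n) :=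
  ((activate S n s.sim 0 e).run roStep s.ro).map fun o =>
    (o.1.1.1, { s with ro := o.2, sim := o.1.1.2 })

/-- The ideal execution, with corrupted party `σ`: the parties use the functionality, with
`sid = 0` and `sid' = 1`, and the view of `σ` is made up by the simulator. -/
def idealStep {n : ℕ} (S : Cmd) (σ : Party) (s : IdealState n) (q : Val) :
    PMF (Val × IdealState n) :=
  match Query.decode n q with
  | .hash x => (s.ro.query x).map fun o => (Val.ofBlock o.1, { s with ro := o.2 })
  | .eval p xs => (s.func.eval 0 xs).bind fun o =>
      (simulate S { s with func := o.2, received := addReceived s.received p.other o.1 }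
        (if σ = p then .sent xs else .received o.1)).map fun v => (reply o.1 v.1, v.2)
  | .update p zs =>
      if ∀ z ∈ zs, z ∈ s.received p then
        (FuncState.update 0 1 zs s.func).bind fun o =>
          (simulate S { s with func := o.2 }
            (if σ = p then .updated zs o.1 else .assisted zs.length)).map fun v =>
              (reply o.1 v.1, v.2)
      else PMF.pure (.nil, s)

/-- The output of environment `D` in an ideal execution; it starts with the initialization of both
sessions by the parties, with uniformly random keys. -/
def idealRun (S : Cmd) (σ : Party) (a : ℕ → List Bool) (D : Cmd) (n : ℕ) : PMF Bool :=
  (sampleKeys n).bind fun keys =>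
    let F := ((FuncState.empty n).init 0 (keys .A).cur (keys .B).cur).init 1
      (keys .A).upd (keys .B).upd
    (simulate S ⟨[], F, fun _ => [], Val.nil⟩ (.init (keys σ))).bind fun v =>
      ((D.exec (envStart n (a n) v.1)).run (idealStep S σ) v.2).map fun o => accepts o.1

/-- The protocol securely realizes the functionality durPRF in the hybrid model with the garbled
circuit functionality and the random oracle, against a semi-honest adversary: whichever party is
corrupted, there is a probabilistic polynomial-time simulator such that no probabilistic
polynomial-time environment (with advice `a`) tells the protocol from the ideal execution with more
than negligible advantage. -/
def SecurelyRealizes (E : ∀ n : ℕ, Block n → Block n → Block n) (a : ℕ → List Bool) : Prop :=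
  ∀ σ : Party, ∃ S : Cmd, PolySimulator S ∧ ∀ D : Cmd, PolyEnvironment a D →
    Negligible fun n => |(realRun E σ a D n true).toReal - (idealRun S σ a D n true).toReal|

end DurPRF

end

/-! Correctness holds because both circuits apply the keyed function under the exclusive or of two
shares, whoever is generator or evaluator, and because a lazily sampled oracle never changes an
entry.

For security, the shares of one party are independent of the combined keys `k`, `k'`
(`sampleKeys_bind`). So the protocol is a game with three functions: hash `H`, evaluation `E_k ∘ H`,
update `E_k'` (`realRun_eq`). The simulator reveals the keys it is told, asks the random oracle for
the hash values of a corrupted sender, and otherwise copies outputs of the functionality. A sequence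
of games connects the two executions.

Two PRF steps: `E_k` is replaced by a random function while the distinguisher samples `k'` itself;
then `E_k'` is replaced while the distinguisher samples the first function lazily (`replaceFirst`,
`replaceSecond`, `exists_distinguisher`). The first ideal experiment is the second real one, so the
advantages add. The result is `lazyGame`, with random functions `H`, `R₁`, `R₂`, all sampled lazily;
lazy and eager sampling agree by `fill_query`.

One statistical step: in `lazyGame` the values are `R₁ (H x)` and `R₂ z`, in the functionality they
are `T₀ x` and `T₁ x` with `T₀ x = z`. As long as `H` and `T₀` are injective on the sampled points,
one can keep `R₁ ∘ H = T₀` and `R₂ ∘ T₀ = T₁` (`Factors`, `Matching`), and the two games give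
identical replies. Injectivity fails only if a fresh block hits one of the earlier values. An
environment of running time `B` samples at most `B` blocks of each kind, which gives the error `2 *
B ^ 2 / 2 ^ n` (`close_step`, `close_out`). Updates cause no error, because a party may only submit
values that it has received, and these lie in the range of `T₀`.

One exact step: in the ideal execution nobody hashes the inputs of an honest sender. Unseen hash
values may be sampled at any later time, so this hashing can be added without effect on the outputs
(`pendingIdealGame_hash`, `idealGame_out`).

The reductions are genuine programs in the cost model. `Feasible` collects the functions that have
polynomial-time subroutines and is closed under composition, branching and loops over lists with
additive growth. `Cmd.sim_embed` runs an environment with its oracle computed by such a subroutine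
and bounds the total time by a polynomial. -/

noncomputable section

namespace DurPRF

open scoped ENNReal

/-! ## Computations -/

namespace Comp

variable {α β γ S : Type}

@[simp] theorem pure_bind (a : α) (f : α → Comp β) : (Comp.pure a).bind f = f a := rfl

@[simp] theorem coin_bind (k : Bool → Comp α) (f : α → Comp β) :
    (Comp.coin k).bind f = .coin fun b => (k b).bind f := rfl

@[simp] theorem call_bind (q : Val) (k : Val → Comp α) (f : α → Comp β) :
    (Comp.call q k).bind f = .call q fun r => (k r).bind f := rfl

@[simp] theorem bind_pure (x : Comp α) : x.bind .pure = x := by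
  induction x with
  | pure a => rfl
  | coin k ih => simp [ih]
  | call q k ih => simp [ih]

theorem bind_assoc (x : Comp α) (f : α → Comp β) (g : β → Comp γ) :
    (x.bind f).bind g = x.bind fun a => (f a).bind g := by
  induction x with
  | pure a => rfl
  | coin k ih => simp [ih]
  | call q k ih => simp [ih]

theorem all_bind {ok : Val → Val → Prop} {P : β → Prop} (x : Comp α) (f : α → Comp β) :
    (x.bind f).All ok P ↔ x.All ok fun a => (f a).All ok P := by
  induction x with
  | pure a => rfl
  | coin k ih => simp [All, ih]
  | call q k ih => simp [All, ih]

theorem All.mono {ok : Val → Val → Prop} {P Q : α → Prop} {x : Comp α} (h : x.All ok P)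
    (hPQ : ∀ a, P a → Q a) : x.All ok Q := by
  induction x with
  | pure a => exact hPQ a h
  | coin k ih => exact fun b => ih b (h b)
  | call q k ih => exact fun r hr => ih r (h r hr)

theorem all_of_forall {ok : Val → Val → Prop} {P : α → Prop} (x : Comp α) (h : ∀ a, P a) :
    x.All ok P := by
  induction x with
  | pure a => exact h a
  | coin k ih => exact fun b => ih b
  | call q k ih => exact fun r _ => ih r

theorem All.and {ok : Val → Val → Prop} {P Q : α → Prop} {x : Comp α} (h : x.All ok P)
    (h' : x.All ok Q) : x.All ok fun a => P a ∧ Q a := by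
  induction x with
  | pure a => exact ⟨h, h'⟩
  | coin k ih => exact fun b => ih b (h b) (h' b)
  | call q k ih => exact fun r hr => ih r (h r hr) (h' r hr)

/-- A query without admissible reply would make `All` vacuous; `hok` supplies a run that reaches a
result. -/
theorem All.exists {ok : Val → Val → Prop} (hok : ∀ q, ∃ r, ok q r) {P : α → Prop} {x : Comp α}
    (h : x.All ok P) : ∃ a, P a := by
  induction x with
  | pure a => exact ⟨a, h⟩
  | coin k ih => exact ih true (h true)
  | call q k ih => obtain ⟨r, hr⟩ := hok q; exact ih r (h r hr)

theorem run_bind (O : S → Val → PMF (Val × S)) (x : Comp α) (f : α → Comp β) (s : S) :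
    (x.bind f).run O s = (x.run O s).bind fun o => (f o.1).run O o.2 := by
  induction x generalizing s with
  | pure a => simp [run]
  | coin k ih => simp [run, ih, PMF.bind_bind]
  | call q k ih => simp [run, ih, PMF.bind_bind]

/-- An oracle without state that gives all admissible replies decides `All`. -/
theorem all_of_support {ok : Val → Val → Prop} {P : α → Prop} {O : Unit → Val → PMF (Val × Unit)}
    (hO : ∀ q r, ok q r → (r, ()) ∈ (O () q).support) {x : Comp α}
    (h : ∀ o ∈ (x.run O ()).support, P o.1) : x.All ok P := by
  induction x with
  | pure a => exact h (a, ()) (by simp [run])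
  | coin k ih =>
    refine fun b => ih b fun o ho => h o ?_
    simp only [run, PMF.mem_support_bind_iff]
    exact ⟨b, by simp, ho⟩
  | call q k ih =>
    refine fun r hr => ih r fun o ho => h o ?_
    simp only [run, PMF.mem_support_bind_iff]
    exact ⟨(r, ()), hO q r hr, ho⟩

/-- The computation `x` behaves like `y` with results related by `R`, except that it may toss
additional coins without effect. Only admissible replies of the oracle are considered. -/
inductive Sim (ok : Val → Val → Prop) (R : α → β → Prop) : Comp α → Comp β → Prop
  | pure {a b} (h : R a b) : Sim ok R (.pure a) (.pure b)
  | coin {k k'} (h : ∀ b, Sim ok R (k b) (k' b)) : Sim ok R (.coin k) (.coin k')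
  | call {q k k'} (h : ∀ r, ok q r → Sim ok R (k r) (k' r)) : Sim ok R (.call q k) (.call q k')
  | skip {k y} (h : ∀ b, Sim ok R (k b) y) : Sim ok R (.coin k) y

theorem Sim.bind {α' β' : Type} {ok : Val → Val → Prop} {R : α → β → Prop} {R' : α' → β' → Prop}
    {x : Comp α} {y : Comp β} {f : α → Comp α'} {g : β → Comp β'} (h : Sim ok R x y)
    (hfg : ∀ a b, R a b → Sim ok R' (f a) (g b)) : Sim ok R' (x.bind f) (y.bind g) := by
  induction h with
  | pure h => exact hfg _ _ h
  | coin _ ih => exact .coin ih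
  | call _ ih => exact .call ih
  | skip _ ih => exact .skip ih

theorem Sim.mono {ok : Val → Val → Prop} {R R' : α → β → Prop}
    {x : Comp α} {y : Comp β} (h : Sim ok R x y)
    (hR : ∀ a b, R a b → R' a b) : Sim ok R' x y := by
  simpa using h.bind (R' := R') (f := .pure) (g := .pure) fun a b hab => .pure (hR a b hab)

/-- Invariants and size bounds proved for the specification `y` thereby become available for the
program `x`, which receives the same replies. -/
theorem Sim.and_all {ok : Val → Val → Prop} {R : α → β → Prop} {P : β → Prop}
    {x : Comp α} {y : Comp β} (h : Sim ok R x y) (hy : y.All ok P) :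
    Sim ok (fun a b => R a b ∧ P b) x y := by
  induction h with
  | pure h => exact .pure ⟨h, hy⟩
  | coin _ ih => exact .coin fun b => ih b (hy b)
  | call _ ih => exact .call fun r hr => ih r hr (hy r hr)
  | skip _ ih => exact .skip fun b => ih b hy

theorem Sim.all {ok : Val → Val → Prop} {R : α → β → Prop} {P : α → Prop}
    {x : Comp α} {y : Comp β} (h : Sim ok R x y) (hR : ∀ a b, R a b → P a) : x.All ok P := by
  induction h with
  | pure h => exact hR _ _ h
  | coin _ ih => exact ih
  | call _ ih => exact ih
  | skip _ ih => exact ih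

/-- Both sides make the same calls and thus drive the oracle alike. An unmatched coin is averaged
out, because both of its branches have the same distribution. Inadmissible replies have probability
zero by `hO`. -/
theorem Sim.run_map {ok : Val → Val → Prop} {R : α → β → Prop}
    {x : Comp α} {y : Comp β} (h : Sim ok R x y) {O : S → Val → PMF (Val × S)}
    (hO : ∀ s q, ∀ o ∈ (O s q).support, ok q o.1) (φ : α → γ) (ψ : β → γ)
    (hR : ∀ a b, R a b → φ a = ψ b) (s : S) :
    (x.run O s).map (Prod.map φ id) = (y.run O s).map (Prod.map ψ id) := by
  induction h generalizing s with
  | pure h => simp [run, PMF.pure_map, hR _ _ h]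
  | coin _ ih =>
    simp only [run, PMF.map_bind]
    exact congrArg _ (funext fun b => ih b s)
  | @call q k k' _ ih =>
    simp only [run, PMF.map_bind]
    ext o
    simp only [PMF.bind_apply]
    refine tsum_congr fun r => ?_
    by_cases hr : r ∈ (O s q).support
    · rw [ih r.1 (hO s q r hr) r.2]
    · rw [(PMF.apply_eq_zero_iff _ _).2 hr]; simp
  | skip _ ih =>
    simp only [run, PMF.map_bind]
    rw [funext fun b => ih b s, PMF.bind_const]

/-- A computation with the replies to its calls computed by `f` from a state. -/
def handle (f : Val → Comp Val) : Comp α → Val → Comp (α × Val)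
  | .pure a, st => .pure (a, st)
  | .coin k, st => .coin fun b => (k b).handle f st
  | .call q k, st => (f (.cons st q)).bind fun o => (k o.hd).handle f o.tl

theorem handle_bind (f : Val → Comp Val) (x : Comp α) (g : α → Comp β) (st : Val) :
    (x.bind g).handle f st = (x.handle f st).bind fun o => (g o.1).handle f o.2 := by
  induction x generalizing st with
  | pure a => rfl
  | coin k ih => simp [handle, ih]
  | call q k ih => simp [handle, ih, bind_assoc]

/-- While the state satisfies `I`, the replies computed by `f` are admissible for `x`. So a
worst-case guarantee under `ok'` survives when the oracle is replaced by a subroutine that itself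
relies only on `ok`. -/
theorem All.handle {ok ok' : Val → Val → Prop} {f : Val → Comp Val} {I : Val → Prop}
    {P : α → Prop}
    (hf : ∀ st q, I st → (f (.cons st q)).All ok fun o => I o.tl ∧ ok' q o.hd)
    {x : Comp α} (h : x.All ok' P) {st : Val} (hst : I st) :
    (x.handle f st).All ok fun o => P o.1 := by
  induction x generalizing st with
  | pure a => exact h
  | coin k ih => exact fun b => ih b (h b) hst
  | call q k ih =>
    simp only [Comp.handle, all_bind]
    exact (hf st q hst).mono fun o ho => ih _ (h _ ho.2) ho.1

/-- This turns a run against a stateful game `G` into a run of a program whose own oracle is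
stateless, as needed to make a PRF distinguisher from an environment. -/
theorem run_handle {f : Val → Comp Val} {O : Unit → Val → PMF (Val × Unit)}
    {G : S → Val → PMF (Val × S)} (enc : S → Val)
    (hf : ∀ s q, (f (.cons (enc s) q)).run O () =
      (G s q).map fun o => (.cons o.1 (enc o.2), ()))
    (x : Comp α) (s : S) :
    (x.handle f (enc s)).run O () = (x.run G s).map fun o => ((o.1, enc o.2), ()) := by
  induction x generalizing s with
  | pure a => simp [handle, run, PMF.pure_map]
  | coin k ih => simp [handle, run, ih, PMF.map_bind]
  | call q k ih =>
    simp only [handle, run, run_bind, hf, PMF.map_bind, PMF.bind_map]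
    refine congrArg _ (funext fun o => ?_)
    exact ih o.1 o.2

end Comp

/-! ## Values -/

namespace Val

@[simp] theorem hd_cons (a b : Val) : (cons a b).hd = a := rfl
@[simp] theorem tl_cons (a b : Val) : (cons a b).tl = b := rfl
@[simp] theorem hd_nil : nil.hd = nil := rfl
@[simp] theorem tl_nil : nil.tl = nil := rfl
@[simp] theorem size_nil : nil.size = 1 := rfl
@[simp] theorem size_cons (a b : Val) : (cons a b).size = a.size + b.size + 1 := rfl
@[simp] theorem toList_nil : nil.toList = [] := rfl
@[simp] theorem toList_cons (a b : Val) : (cons a b).toList = a :: b.toList := rfl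
@[simp] theorem ofList_nil : ofList [] = nil := rfl
@[simp] theorem ofList_cons (a : Val) (l : List Val) : ofList (a :: l) = cons a (ofList l) := rfl

theorem size_pos (v : Val) : 1 ≤ v.size := by cases v <;> simp

theorem size_hd_le (v : Val) : v.hd.size ≤ v.size := by
  cases v with
  | nil => simp
  | cons a b => simp; omega

theorem size_tl_le (v : Val) : v.tl.size ≤ v.size := by
  cases v with
  | nil => simp
  | cons a b => simp; omega

@[simp] theorem toList_ofList (l : List Val) : (ofList l).toList = l := by
  induction l <;> simp_all

@[simp] theorem ofList_toList (v : Val) : ofList v.toList = v := by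
  induction v <;> simp_all

theorem size_ofList (l : List Val) : (ofList l).size = (l.map fun v => v.size + 1).sum + 1 := by
  induction l with
  | nil => rfl
  | cons a l ih => simp [ih]; omega

theorem length_toList_lt (v : Val) : v.toList.length < v.size := by
  induction v with
  | nil => simp
  | cons a b _ ih => simp; omega

theorem size_lt_of_mem_toList {v x : Val} (h : x ∈ v.toList) : x.size < v.size := by
  induction v with
  | nil => simp at h
  | cons a b _ ih =>
    simp only [toList_cons, List.mem_cons] at h
    rcases h with rfl | h
    · simp
    · have := ih h; simp; omega

theorem size_ofBool_le (b : Bool) : (ofBool b).size ≤ 3 := by cases b <;> simp [ofBool]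

@[simp] theorem toBool_ofBool (b : Bool) : (ofBool b).toBool = b := by cases b <;> rfl

@[simp] theorem toBits_ofBits (l : List Bool) : (ofBits l).toBits = l := by
  simp [toBits, ofBits, Function.comp_def]

@[simp] theorem toBlock_ofBlock {n : ℕ} (b : Block n) : (ofBlock b).toBlock n = b := by
  ext i
  simp [toBlock, ofBlock]

theorem size_ofBits_le (l : List Bool) : (ofBits l).size ≤ 4 * l.length + 1 := by
  induction l with
  | nil => simp [ofBits]
  | cons a l ih => have := size_ofBool_le a; simp [ofBits] at ih ⊢; omega

theorem size_ofBlock_le {n : ℕ} (b : Block n) : (ofBlock b).size ≤ 4 * n + 1 := by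
  simpa [ofBlock] using size_ofBits_le (List.ofFn b)

theorem size_unary (n : ℕ) : (unary n).size = 2 * n + 1 := by
  simp [unary, size_ofList, mul_comm]

@[simp] theorem length_toList_unary (n : ℕ) : (unary n).toList.length = n := by simp [unary]

theorem size_ofBlocks_le {n : ℕ} (l : List (Block n)) :
    (ofBlocks l).size ≤ l.length * (4 * n + 2) + 1 := by
  induction l with
  | nil => simp [ofBlocks]
  | cons a l ih =>
    have := size_ofBlock_le a
    simp only [ofBlocks, List.map_cons, ofList_cons, size_cons, List.length_cons, add_mul] at ih ⊢
    omega


theorem ofBool_ne_nil {b : Bool} : ofBool b = nil ↔ b = false := by cases b <;> simp [ofBool]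

end Val

/-! ## Expressions and registers -/

namespace Expr

/-- Renaming of registers. -/
def rename (ρ : ℕ → ℕ) : Expr → Expr
  | reg r => reg (ρ r)
  | nil => nil
  | cons e f => cons (e.rename ρ) (f.rename ρ)
  | hd e => hd (e.rename ρ)
  | tl e => tl (e.rename ρ)
  | eq e f => eq (e.rename ρ) (f.rename ρ)

theorem eval_rename (ρ : ℕ → ℕ) (s : Store) (e : Expr) :
    (e.rename ρ).eval s = e.eval fun r => s (ρ r) := by
  induction e <;> simp_all [rename, eval]

theorem cost_rename (ρ : ℕ → ℕ) (s : Store) (e : Expr) :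
    (e.rename ρ).cost s = e.cost fun r => s (ρ r) := by
  induction e <;> simp_all [rename, cost]

theorem cost_pos (s : Store) (e : Expr) : 1 ≤ e.cost s := by
  cases e <;> simp [cost, Val.size_pos]

/-- Queries are values of expressions, so by this estimate the running time also bounds their sizes.
-/
theorem size_eval_le_cost (s : Store) (e : Expr) : (e.eval s).size ≤ e.cost s := by
  induction e with
  | reg r => simp [eval, cost]
  | nil => simp [eval, cost]
  | cons e f he hf => simp [eval, cost]; omega
  | hd e ih => have := (e.eval s).size_hd_le; simp [eval, cost]; omega
  | tl e ih => have := (e.eval s).size_tl_le; simp [eval, cost]; omega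
  | eq e f he hf =>
    have := Val.size_ofBool_le (decide (e.eval s = f.eval s))
    have := e.cost_pos s
    have := f.cost_pos s
    simp [eval, cost]; omega

/-- The number of constructors, a bound for the cost per unit of input size. -/
def weight : Expr → ℕ
  | reg _ => 1
  | nil => 1
  | cons e f => e.weight + f.weight + 1
  | hd e => e.weight + 1
  | tl e => e.weight + 1
  | eq e f => e.weight + f.weight + 1

theorem cost_const_le (e : Expr) (v : Val) : e.cost (fun _ => v) ≤ e.weight * v.size := by
  have := v.size_pos
  induction e <;> simp [cost, weight] <;> nlinarith

/-- All registers are below this bound. -/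
def bound : Expr → ℕ
  | reg r => r + 1
  | nil => 0
  | cons e f => max e.bound f.bound
  | hd e => e.bound
  | tl e => e.bound
  | eq e f => max e.bound f.bound

theorem eval_congr {s s' : Store} {e : Expr} {M : ℕ} (hM : e.bound ≤ M)
    (h : ∀ r < M, s r = s' r) : e.eval s = e.eval s' := by
  induction e <;> simp_all [bound, eval]

theorem cost_congr {s s' : Store} {e : Expr} {M : ℕ} (hM : e.bound ≤ M)
    (h : ∀ r < M, s r = s' r) : e.cost s = e.cost s' := by
  induction e <;> simp_all [bound, cost]

end Expr

/-- Natural coefficients make time bounds monotone, so they may be evaluated at any upper estimate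
of the input size. -/
theorem polynomial_eval_mono (p : Polynomial ℕ) : Monotone fun x => p.eval x := by
  intro x y h
  simp only [Polynomial.eval_eq_sum_range]
  gcongr

/-! ## Subroutines that run in polynomial time -/

/-- The replies of an oracle that is a function with values in `{0,1}^n`. -/
def BlockReply (n : ℕ) (_ r : Val) : Prop := ∃ b : Block n, r = Val.ofBlock b

theorem BlockReply.size_le {n : ℕ} {q r : Val} (h : BlockReply n q r) : r.size ≤ 4 * n + 1 := by
  obtain ⟨b, rfl⟩ := h
  exact Val.size_ofBlock_le b

/-- The program `c b` replaces the contents of register `b` by the result of `f` without change to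
registers below `b`, with running time and output size bounded by `p`. -/
def Implements (c : ℕ → Cmd) (p : Polynomial ℕ) (f : Val → Comp Val) : Prop :=
  ∀ (b n : ℕ) (s : Store) (t : ℕ), Comp.Sim (BlockReply n)
    (fun o v => o.1 b = v ∧ (∀ r < b, o.1 r = s r) ∧ o.2 ≤ t + p.eval (n + (s b).size) ∧
      v.size ≤ p.eval (n + (s b).size))
    ((c b).exec (s, t)) (f (s b))

/-- The function is computed by a polynomial-time program that can be used as a subroutine. -/
def Feasible (f : Val → Comp Val) : Prop := ∃ c p, Implements c p f

namespace Feasible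

theorem congr {f g : Val → Comp Val} (hf : Feasible f) (h : ∀ v, g v = f v) : Feasible g := by
  rwa [funext h]

theorem expr (e : Expr) : Feasible fun v => .pure (e.eval fun _ => v) := by
  refine ⟨fun b => .assign b (e.rename fun _ => b), Polynomial.C (e.weight + 1) * Polynomial.X,
    fun b n s t => .pure ?_⟩
  have h1 := e.cost_const_le (s b)
  have h2 := e.size_eval_le_cost fun _ => s b
  have h3 := (s b).size_pos
  simp only [Expr.eval_rename, Expr.cost_rename, Function.update_self, Polynomial.eval_mul,
    Polynomial.eval_C, Polynomial.eval_X, true_and]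
  refine ⟨fun r hr => Function.update_of_ne (by omega) _ _, ?_, ?_⟩ <;> nlinarith

theorem comp {f g : Val → Comp Val} (hf : Feasible f) (hg : Feasible g) :
    Feasible fun v => (f v).bind g := by
  obtain ⟨c, p, hc⟩ := hf
  obtain ⟨d, q, hd⟩ := hg
  -- The intermediate result has size at most `p`, so the second routine is charged `q` at `X + p`.
  refine ⟨fun b => .seq (c b) (d b), p + q.comp (Polynomial.X + p), fun b n s t => ?_⟩
  refine (hc b n s t).bind ?_
  rintro ⟨s', t'⟩ v ⟨rfl, hs, ht, hv⟩
  dsimp only at hs ht hv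
  refine (hd b n s' t').mono ?_
  rintro ⟨s'', t''⟩ w ⟨rfl, hs', ht', hw⟩
  dsimp only at hs' ht' hw
  have := polynomial_eval_mono q (show n + (s' b).size ≤
    n + (s b).size + p.eval (n + (s b).size) by omega)
  simp only [Polynomial.eval_add, Polynomial.eval_comp, Polynomial.eval_X, true_and] at *
  exact ⟨fun r hr => (hs' r hr).trans (hs r hr), by omega, by omega⟩

/-- The input is kept. -/
theorem push {f : Val → Comp Val} (hf : Feasible f) :
    Feasible fun v => (f v).bind fun w => .pure (.cons w v) := by
  obtain ⟨c, p, hc⟩ := hf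
  -- The subroutine consumes a copy in register `b + 1`; the original in `b` survives because
  -- registers below its own are left alone.
  refine ⟨fun b => .seq (.assign (b + 1) (.reg b)) (.seq (c (b + 1))
    (.assign b (.cons (.reg (b + 1)) (.reg b)))), 2 * p + 2 * Polynomial.X + 3,
    fun b n s t => ?_⟩
  simp only [Cmd.exec, Comp.pure_bind, Expr.eval, Expr.cost]
  have h := hc (b + 1) n (Function.update s (b + 1) (s b)) (t + (s b).size + 1)
  rw [Function.update_self] at h
  refine h.bind ?_
  rintro ⟨s', t'⟩ w ⟨rfl, hs, ht, hv⟩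
  dsimp only at hs ht hv
  have hb : s' b = s b := by rw [hs b (by omega), Function.update_of_ne (by omega)]
  refine .pure ?_
  simp only [Polynomial.eval_add, Polynomial.eval_mul, Polynomial.eval_ofNat, Polynomial.eval_X,
    Function.update_self, hb, true_and, Val.size_cons] at *
  refine ⟨fun r hr => ?_, by omega, by omega⟩
  rw [Function.update_of_ne (by omega), hs r (by omega), Function.update_of_ne (by omega)]

/-- Sequencing with the intermediate result on top of the input. -/
theorem let_ (e : Expr) {f g : Val → Comp Val} (hf : Feasible f) (hg : Feasible g) :
    Feasible fun v => (f (e.eval fun _ => v)).bind fun w => g (.cons w v) :=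
  ((((expr e).comp hf).push).comp hg).congr fun v => by simp [Comp.bind_assoc]

theorem ite (e : Expr) {f g : Val → Comp Val} (hf : Feasible f) (hg : Feasible g) :
    Feasible fun v => if e.eval (fun _ => v) = .nil then g v else f v := by
  obtain ⟨c, p, hc⟩ := hf
  obtain ⟨d, q, hd⟩ := hg
  refine ⟨fun b => .seq (.assign (b + 1) (e.rename fun _ => b)) (.ite (b + 1) (c b) (d b)),
    p + q + Polynomial.C e.weight * Polynomial.X + 2, fun b n s t => ?_⟩
  have h1 := e.cost_const_le (s b)
  have h2 : e.weight * (s b).size ≤ e.weight * (n + (s b).size) := by gcongr; omega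
  simp only [Cmd.exec, Comp.pure_bind, Expr.eval_rename, Expr.cost_rename, Function.update_self]
  have hb : Function.update s (b + 1) (e.eval fun _ => s b) b = s b :=
    Function.update_of_ne (by omega) _ _
  split_ifs with h
  · have := hd b n (Function.update s (b + 1) (e.eval fun _ => s b))
      (t + (e.cost fun _ => s b) + 1 + 1)
    rw [hb] at this
    refine this.mono ?_
    rintro ⟨s', t'⟩ w ⟨rfl, hs, ht, hv⟩
    simp only [Polynomial.eval_add, Polynomial.eval_mul, Polynomial.eval_ofNat, Polynomial.eval_X,
      Polynomial.eval_C, true_and] at *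
    refine ⟨fun r hr => ?_, by omega, by omega⟩
    rw [hs r hr, Function.update_of_ne (by omega)]
  · have := hc b n (Function.update s (b + 1) (e.eval fun _ => s b))
      (t + (e.cost fun _ => s b) + 1 + 1)
    rw [hb] at this
    refine this.mono ?_
    rintro ⟨s', t'⟩ w ⟨rfl, hs, ht, hv⟩
    simp only [Polynomial.eval_add, Polynomial.eval_mul, Polynomial.eval_ofNat, Polynomial.eval_X,
      Polynomial.eval_C, true_and] at *
    refine ⟨fun r hr => ?_, by omega, by omega⟩
    rw [hs r hr, Function.update_of_ne (by omega)]

theorem coin : Feasible fun _ => .coin fun b => .pure (.ofBool b) := by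
  refine ⟨fun b => .coin b, Polynomial.X + 3, fun b n s t => .coin fun a => .pure ?_⟩
  have := Val.size_ofBool_le a
  simp only [Polynomial.eval_add, Polynomial.eval_ofNat, Polynomial.eval_X,
    Function.update_self, true_and]
  exact ⟨fun r hr => Function.update_of_ne (by omega) _ _, by omega, by omega⟩

theorem call : Feasible fun v => .call v .pure := by
  refine ⟨fun b => .call b (.reg b), 5 * Polynomial.X + 2,
    fun b n s t => .call fun r hr => .pure ?_⟩
  have := hr.size_le
  simp only [Polynomial.eval_add, Polynomial.eval_mul, Polynomial.eval_ofNat, Polynomial.eval_X,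
    Function.update_self, true_and, Expr.cost]
  exact ⟨fun r hr => Function.update_of_ne (by omega) _ _, by omega, by omega⟩

end Feasible

/-! ### Loops over lists -/

/-- Iteration over a list, with access to a fixed value and an accumulator. -/
def foldC (h : Val → Comp Val) (env : Val) : List Val → Val → Comp Val
  | [], acc => .pure acc
  | x :: l, acc => (h (.cons x (.cons env acc))).bind (foldC h env l)

namespace Feasible

/-- The loop body. -/
def foldBody (c : ℕ → Cmd) (b : ℕ) : Cmd :=
  .seq (.assign (b + 3) (.cons (.hd (.reg (b + 1))) (.cons (.hd (.tl (.reg b))) (.reg (b + 2)))))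
    (.seq (c (b + 3)) (.seq (.assign (b + 2) (.reg (b + 3)))
      (.assign (b + 1) (.tl (.reg (b + 1))))))

/-- Register `b` holds the input, `b + 1` the unread entries, `b + 2` the accumulator, and the
routine for `h` works from `b + 3` on. `V` bounds input and unread list, and `A` bounds the
accumulator together with all growth still to come, so every pass can be charged the same amount. -/
theorem sim_foldBody {h : Val → Comp Val} {c : ℕ → Cmd} {p : Polynomial ℕ}
    (hc : Implements c p h) (b n V A g : ℕ) (env : Val) (l : List Val) (s : Store) (t : ℕ)
    (hl : (s (b + 1)).toList = l) (hV : (s b).size ≤ V) (hV' : (s (b + 1)).size ≤ V)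
    (henv : (s b).tl.hd = env)
    (hg : ∀ x ∈ l, ∀ acc, (h (.cons x (.cons env acc))).All (BlockReply n)
      fun w => w.size ≤ acc.size + g)
    (hA : (s (b + 2)).size + l.length * g ≤ A) :
    Comp.Sim (BlockReply n) (fun o v => o.1 (b + 2) = v ∧ (∀ r ≤ b, o.1 r = s r) ∧
        o.2 ≤ t + l.length * (4 * V + 3 * A + 12 + p.eval (n + 2 * V + A + 2)) ∧ v.size ≤ A)
      (iter (fun q => (foldBody c b).exec (q.1, q.2 + 1)) l.length (s, t))
      (foldC h env l (s (b + 2))) := by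
  induction l generalizing s t with
  | nil =>
    refine .pure ⟨rfl, fun _ _ => rfl, ?_, ?_⟩ <;> simp at * <;> omega
  | cons x l ih =>
    obtain ⟨w, hw, rfl⟩ : ∃ w, s (b + 1) = .cons x w ∧ w.toList = l := by
      cases hs : s (b + 1) with
      | nil => simp [hs] at hl
      | cons a w => simp [hs] at hl; exact ⟨w, by rw [hl.1], hl.2⟩
    have hVenv : env.size ≤ V := by
      rw [← henv]; exact (((s b).tl.size_hd_le).trans (s b).size_tl_le).trans hV
    have hx : x.size + w.size + 1 ≤ V := by simpa [hw] using hV'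
    simp only [List.length_cons, iter, foldC, foldBody, Cmd.exec, Comp.pure_bind, Expr.eval,
      Expr.cost, Comp.bind_assoc, hw, henv, Val.hd_cons]
    simp only [List.length_cons, add_mul, one_mul] at hA
    have hcall := hc (b + 3) n
      (Function.update s (b + 3) (.cons x (.cons env (s (b + 2)))))
      (t + 1 + ((Val.cons x w).size + 1 + ((s b).size + 1 + 1 + (s (b + 2)).size + 1) + 1) + 1)
    rw [Function.update_self] at hcall
    refine (hcall.and_all (hg x (by simp) _)).bind ?_
    rintro ⟨s', t'⟩ acc ⟨⟨rfl, hs, ht, -⟩, hacc⟩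
    dsimp only at hs ht hacc
    have hold : ∀ r < b + 3, s' r = s r := fun r hr => by
      rw [hs r hr, Function.update_of_ne (by omega)]
    have h1 : s' (b + 1) = .cons x w := by rw [hold _ (by omega), hw]
    have h0 : s' b = s b := hold _ (by omega)
    set s2 := Function.update (Function.update s' (b + 2) (s' (b + 3))) (b + 1)
      (Function.update s' (b + 2) (s' (b + 3)) (b + 1)).tl with hs2
    have e1 : s2 (b + 1) = w := by simp [hs2, h1]
    have e2 : s2 (b + 2) = s' (b + 3) := by simp [hs2]
    have er : ∀ r ≤ b, s2 r = s r := fun r hr => by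
      rw [hs2, Function.update_of_ne (by omega), Function.update_of_ne (by omega),
        hold _ (by omega)]
    have key := ih s2 (t' + (s' (b + 3)).size + 1 +
        ((Function.update s' (b + 2) (s' (b + 3)) (b + 1)).size + 1) + 1)
      (by rw [e1]) (by rw [er b le_rfl]; exact hV) (by rw [e1]; omega)
      (by rw [er b le_rfl]; exact henv) (fun y hy => hg y (by simp [hy]))
      (by rw [e2]; omega)
    rw [e2] at key
    refine key.mono ?_
    rintro ⟨s3, t3⟩ v ⟨rfl, hs3, ht3, hv⟩
    refine ⟨rfl, fun r hr => (hs3 r hr).trans (er r hr), ?_, hv⟩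
    have hp := polynomial_eval_mono p (show n + (Val.cons x (.cons env (s (b + 2)))).size ≤
      n + 2 * V + A + 2 by simp; omega)
    simp only [Function.update_of_ne (show b + 1 ≠ b + 2 by omega), h1, Val.size_cons] at *
    rw [add_mul, one_mul]
    omega

/-- The increment in `hq` must not depend on `acc`: additive growth keeps the accumulator polynomial
along the list, whereas a constant factor per entry would make it exponential. -/
theorem fold {h : Val → Comp Val} (hh : Feasible h) (q : Polynomial ℕ)
    (hq : ∀ n x env acc, (h (.cons x (.cons env acc))).All (BlockReply n)
      fun w => w.size ≤ acc.size + q.eval (n + x.size + env.size)) :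
    Feasible fun v => foldC h v.tl.hd v.hd.toList v.tl.tl := by
  obtain ⟨c, p, hc⟩ := hh
  -- The initial accumulator plus one increment per entry; the argument `2 * X` covers `n`, an entry
  -- and the fixed value together.
  let A : Polynomial ℕ := Polynomial.X + Polynomial.X * q.comp (2 * Polynomial.X)
  refine ⟨fun b => .seq (.assign (b + 1) (.hd (.reg b))) (.seq (.assign (b + 2) (.tl (.tl (.reg b))))
    (.seq (.loop (b + 1) (foldBody c b)) (.assign b (.reg (b + 2))))),
    Polynomial.X * (4 * Polynomial.X + 3 * A + 12 + p.comp (3 * Polynomial.X + A + 2)) +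
      2 * Polynomial.X + A + 8, fun b n s t => ?_⟩
  simp only [Cmd.exec, Comp.pure_bind, Expr.eval, Expr.cost]
  set s1 := Function.update (Function.update s (b + 1) (s b).hd) (b + 2)
    (Function.update s (b + 1) (s b).hd b).tl.tl with hs1
  have e0 : s1 b = s b := by simp [hs1]
  have e1 : s1 (b + 1) = (s b).hd := by simp [hs1]
  have e2 : s1 (b + 2) = (s b).tl.tl := by simp [hs1]
  have er : ∀ r ≤ b, s1 r = s r := fun r hr => by
    rw [hs1, Function.update_of_ne (by omega), Function.update_of_ne (by omega)]
  set V := (s b).size with hV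
  have hhd : (s b).hd.size ≤ V := (s b).size_hd_le
  have htl : (s b).tl.size ≤ V := (s b).size_tl_le
  have hlen : (s b).hd.toList.length ≤ V := (s b).hd.length_toList_lt.le.trans hhd
  have htt := (s b).tl.size_tl_le
  have hth := (s b).tl.size_hd_le
  have hAe : A.eval (n + V) = n + V + (n + V) * q.eval (2 * (n + V)) := by simp [A]
  rw [e1]
  have key := sim_foldBody hc b n V (A.eval (n + V)) (q.eval (2 * (n + V))) (s b).tl.hd
    (s b).hd.toList s1
    (t + ((s b).size + 1) + 1 + ((Function.update s (b + 1) (s b).hd b).size + 1 + 1) + 1 + 1)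
    (by rw [e1]) (by rw [e0]) (by rw [e1]; exact hhd) (by rw [e0])
    (fun x hx acc => (hq n x _ acc).mono fun w hw => hw.trans (by
      have := Val.size_lt_of_mem_toList hx
      have := polynomial_eval_mono q (show n + x.size + (s b).tl.hd.size ≤ 2 * (n + V) by omega)
      dsimp only at this
      omega))
    (by
      rw [e2, hAe]
      have : (s b).hd.toList.length * q.eval (2 * (n + V)) ≤ (n + V) * q.eval (2 * (n + V)) := by
        gcongr; omega
      omega)
  rw [e2] at key
  -- The added `.pure` is matched with the final assignment, which moves the accumulator to register
  -- `b`.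
  have : foldC h (s b).tl.hd (s b).hd.toList (s b).tl.tl =
    (foldC h (s b).tl.hd (s b).hd.toList (s b).tl.tl).bind .pure := by simp
  rw [this]
  refine key.bind ?_
  rintro ⟨s3, t3⟩ v ⟨rfl, hs3, ht3, hv⟩
  dsimp only at hs3 ht3 hv
  refine .pure ⟨by simp, fun r hr => ?_, ?_, ?_⟩
  · dsimp only
    rw [Function.update_of_ne (by omega), hs3 r hr.le, er r hr.le]
  · rw [Function.update_of_ne (by omega)] at ht3
    simp only [Polynomial.eval_add, Polynomial.eval_mul, Polynomial.eval_ofNat,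
      Polynomial.eval_X, Polynomial.eval_comp]
    have hp := polynomial_eval_mono p (show n + 2 * V + A.eval (n + V) + 2 ≤
      3 * (n + V) + A.eval (n + V) + 2 by omega)
    dsimp only at hp
    have : (s b).hd.toList.length * (4 * V + 3 * A.eval (n + V) + 12 +
        p.eval (n + 2 * V + A.eval (n + V) + 2)) ≤
        (n + V) * (4 * (n + V) + 3 * A.eval (n + V) + 12 +
        p.eval (3 * (n + V) + A.eval (n + V) + 2)) := by
      gcongr <;> omega
    omega
  · simp only [Polynomial.eval_add, Polynomial.eval_mul, Polynomial.eval_ofNat,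
      Polynomial.eval_X, Polynomial.eval_comp]
    omega

end Feasible

/-! ### Output sizes, and maps over lists obtained from folds -/

theorem Comp.Sim.all_right {α β : Type} {ok : Val → Val → Prop} {R : α → β → Prop} {P : β → Prop}
    {x : Comp α} {y : Comp β} (h : Sim ok R x y) (hR : ∀ a b, R a b → P b) : y.All ok P := by
  induction h with
  | pure h => exact hR _ _ h
  | coin _ ih => exact ih
  | call _ ih => exact ih
  | skip _ ih => exact ih true

theorem Implements.all_size_le {c : ℕ → Cmd} {p : Polynomial ℕ} {f : Val → Comp Val}
    (hc : Implements c p f) (n : ℕ) (v : Val) :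
    (f v).All (BlockReply n) fun w => w.size ≤ p.eval (n + v.size) :=
  (hc 0 n (fun _ => v) 0).all_right fun _ _ h => h.2.2.2

theorem Feasible.exists_size_bound {f : Val → Comp Val} (hf : Feasible f) :
    ∃ p : Polynomial ℕ, ∀ n v, (f v).All (BlockReply n) fun w => w.size ≤ p.eval (n + v.size) := by
  obtain ⟨c, p, hc⟩ := hf
  exact ⟨p, hc.all_size_le⟩

theorem foldC_pure {h : Val → Comp Val} {g : Val → Val → Val} {env : Val}
    (hg : ∀ x acc, h (.cons x (.cons env acc)) = .pure (g acc x)) (l : List Val) (acc : Val) :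
    foldC h env l acc = .pure (l.foldl g acc) := by
  induction l generalizing acc with
  | nil => rfl
  | cons x l ih => simp [foldC, hg, ih]

/-- A loop body for which the accumulator grows by a polynomial amount in the size of the other
inputs. -/
def Growth (h : Val → Comp Val) : Prop :=
  ∃ q : Polynomial ℕ, ∀ n x env acc, (h (.cons x (.cons env acc))).All (BlockReply n)
    fun w => w.size ≤ acc.size + q.eval (n + x.size + env.size)

theorem growth_of_le {h : Val → Comp Val} (k : ℕ)
    (hk : ∀ n x env acc, (h (.cons x (.cons env acc))).All (BlockReply n)
      fun w => w.size ≤ acc.size + (n + x.size + env.size) + k) : Growth h :=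
  ⟨Polynomial.X + Polynomial.C k, fun n x env acc => (hk n x env acc).mono fun w hw => by
    simp only [Polynomial.eval_add, Polynomial.eval_X, Polynomial.eval_C]; omega⟩

/-- A fold that conses entries onto its accumulator reverses them on the way; two such reversals
give concatenation in the right order. -/
theorem Feasible.revAppend : Feasible fun v => .pure (.ofList (v.hd.toList.reverse ++ v.tl.toList)) := by
  have hb : Feasible fun v => .pure (.cons v.hd v.tl.tl) :=
    Feasible.expr (.cons (.hd (.reg 0)) (.tl (.tl (.reg 0))))
  obtain ⟨q, hq⟩ : Growth fun v => .pure (.cons v.hd v.tl.tl) :=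
    growth_of_le 1 fun n x env acc => by simp [Comp.All]; omega
  refine ((Feasible.expr (.cons (.hd (.reg 0)) (.cons .nil (.tl (.reg 0))))).comp
    (hb.fold q hq)).congr fun v => ?_
  simp only [Expr.eval, Comp.pure_bind, Val.hd_cons, Val.tl_cons]
  rw [foldC_pure (g := fun acc x => .cons x acc) (fun _ _ => rfl)]
  congr 1
  generalize v.hd.toList = l
  generalize v.tl = w
  induction l generalizing w with
  | nil => simp
  | cons x l ih => simp [← ih]

namespace Val

/-- Concatenation of lists. -/
def append (v w : Val) : Val := ofList (v.toList ++ w.toList)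

theorem size_append (v w : Val) : (v.append w).size + 1 = v.size + w.size := by
  unfold append
  induction v with
  | nil => simp; omega
  | cons a b _ ih => simp; omega

end Val

theorem Feasible.append : Feasible fun v => .pure (v.hd.append v.tl) := by
  refine (let_ (.cons (.hd (.reg 0)) .nil) revAppend
    ((Feasible.expr (.cons (.hd (.reg 0)) (.tl (.tl (.reg 0))))).comp revAppend)).congr fun v => ?_
  simp [Expr.eval, Val.append]

/-- Application of `h` to the entries of a list, one after the other; `h` has access to a fixed
value and gives an output and a new state. -/
def mapC (h : Val → Comp Val) (env : Val) : List Val → Val → Comp Val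
  | [], st => .pure (.cons .nil st)
  | x :: l, st => (h (.cons x (.cons env st))).bind fun o =>
      (mapC h env l o.tl).bind fun o' => .pure (.cons (.cons o.hd o'.hd) o'.tl)

/-- The loop body that collects the outputs of `h` in reversed order. -/
def collect (h : Val → Comp Val) (v : Val) : Comp Val :=
  (h (.cons v.hd (.cons v.tl.hd v.tl.tl.tl))).bind fun w =>
    .pure (.cons (.cons w.hd v.tl.tl.hd) w.tl)

/-- The accumulator pairs the outputs so far, latest first, with the state of `h`; one final
reversal restores the order. -/
theorem foldC_collect (h : Val → Comp Val) (env : Val) (l : List Val) (r st : Val) :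
    (foldC (collect h) env l (.cons r st)).bind (fun v =>
      .pure (Val.cons (.ofList v.hd.toList.reverse) v.tl)) =
    (mapC h env l st).bind fun o =>
      .pure (Val.cons (.ofList (r.toList.reverse ++ o.hd.toList)) o.tl) := by
  induction l generalizing r st with
  | nil => simp [foldC, mapC]
  | cons x l ih =>
    simp only [foldC, mapC, collect, Comp.bind_assoc, Comp.pure_bind, Val.hd_cons, Val.tl_cons, ih]
    simp

theorem Growth.collect {h : Val → Comp Val} (hh : Growth h) : Growth (collect h) := by
  obtain ⟨q, hq⟩ := hh
  refine ⟨q + 4, fun n x env acc => ?_⟩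
  simp only [DurPRF.collect, Comp.all_bind]
  refine (hq n x env acc.tl).mono fun w hw => ?_
  -- The `1` is needed for `nil`, whose head and tail are again `nil`.
  have h1 : acc.tl.size + acc.hd.size ≤ acc.size + 1 := by cases acc <;> simp; omega
  have h2 : w.tl.size + w.hd.size ≤ w.size + 1 := by cases w <;> simp; omega
  simp [Comp.All] at hw ⊢
  omega

theorem Feasible.mapC {h : Val → Comp Val} (hh : Feasible h) (hg : Growth h) :
    Feasible fun v => mapC h v.tl.hd v.hd.toList v.tl.tl := by
  have hb : Feasible (collect h) :=
    (let_ (.cons (.hd (.reg 0)) (.cons (.hd (.tl (.reg 0))) (.tl (.tl (.tl (.reg 0)))))) hh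
      (Feasible.expr (.cons (.cons (.hd (.hd (.reg 0))) (.hd (.tl (.tl (.tl (.reg 0))))))
        (.tl (.hd (.reg 0)))))).congr fun v => by simp [DurPRF.collect, Expr.eval]
  obtain ⟨q, hq⟩ := hg.collect
  refine (((Feasible.expr (.cons (.hd (.reg 0)) (.cons (.hd (.tl (.reg 0)))
    (.cons .nil (.tl (.tl (.reg 0))))))).comp (hb.fold q hq)).comp
    (let_ (.cons (.hd (.reg 0)) .nil) revAppend (Feasible.expr (.cons (.hd (.reg 0))
      (.tl (.tl (.reg 0))))))).congr fun v => ?_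
  have := foldC_collect h v.tl.hd v.hd.toList .nil v.tl.tl
  simp only [Val.toList_nil, List.reverse_nil, List.nil_append, Val.ofList_toList] at this
  simp only [Expr.eval, Comp.pure_bind, Val.hd_cons, Val.tl_cons, Val.toList_nil, List.append_nil,
    this]
  clear this
  generalize v.tl.tl = st
  cases v.hd.toList <;> simp [DurPRF.mapC, Comp.bind_assoc]

/-- A loop body without state. -/
def stateless (f : Val → Comp Val) (v : Val) : Comp Val :=
  (f (.cons v.hd v.tl.hd)).bind fun w => .pure (.cons w v.tl.tl)

theorem Feasible.stateless {f : Val → Comp Val} (hf : Feasible f) : Feasible (stateless f) :=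
  (let_ (.cons (.hd (.reg 0)) (.hd (.tl (.reg 0)))) hf
    (Feasible.expr (.cons (.hd (.reg 0)) (.tl (.tl (.tl (.reg 0))))))).congr fun v => by
      simp [DurPRF.stateless, Expr.eval]

/-- The state is only passed through, with one output put in front whose size does not depend on it;
hence the growth is additive. -/
theorem growth_stateless {f : Val → Comp Val} (hf : Feasible f) : Growth (stateless f) := by
  obtain ⟨p, hp⟩ := hf.exists_size_bound
  refine ⟨p.comp (Polynomial.X + 1) + 1, fun n x env acc => ?_⟩
  simp only [stateless, Comp.all_bind]
  refine (hp n _).mono fun w hw => ?_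
  simp [Comp.All, ← add_assoc] at hw ⊢
  omega

theorem mapC_stateless_pure {f : Val → Comp Val} {g : Val → Val} {env : Val}
    (hg : ∀ x, f (.cons x env) = .pure (g x)) (l : List Val) (st : Val) :
    mapC (stateless f) env l st = .pure (.cons (.ofList (l.map g)) st) := by
  induction l with
  | nil => rfl
  | cons x l ih => simp [mapC, stateless, hg, ih]

theorem Feasible.map_pure {g : Val → Val} (hg : Feasible fun v => .pure (g v)) :
    Feasible fun v => .pure (.ofList (v.hd.toList.map fun x => g (.cons x v.tl))) := by
  refine (((Feasible.expr (.cons (.hd (.reg 0)) (.cons (.tl (.reg 0)) .nil))).comp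
    (hg.stateless.mapC (growth_stateless hg))).comp
    (Feasible.expr (.hd (.reg 0)))).congr fun v => ?_
  simp only [Expr.eval, Comp.pure_bind, Val.hd_cons, Val.tl_cons]
  rw [mapC_stateless_pure (g := fun x => g (.cons x v.tl)) (fun _ => rfl)]
  simp

/-! ## Conversions -/

theorem Feasible.unary : Feasible fun v => .pure (.unary v.toList.length) := by
  refine ((Feasible.expr (.cons (.reg 0) .nil)).comp
    (map_pure (Feasible.expr .nil))).congr fun v => ?_
  simp [Expr.eval, Val.unary, List.map_const']

theorem Feasible.ofBool_toBool : Feasible fun v => .pure (.ofBool v.toBool) :=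
  (ite (.reg 0) (Feasible.expr (.cons .nil .nil)) (Feasible.expr .nil)).congr fun v => by
    cases v <;> simp [Expr.eval, Val.toBool, Val.ofBool]

theorem Feasible.ofBits_toBits : Feasible fun v => .pure (.ofBits v.toBits) := by
  refine ((Feasible.expr (.cons (.reg 0) .nil)).comp
    (map_pure (g := fun v => .ofBool v.hd.toBool)
      ((Feasible.expr (.hd (.reg 0))).comp ofBool_toBool))).congr fun v => ?_
  simp [Expr.eval, Val.ofBits, Val.toBits]
  rfl

/-- The first `k` entries of a list as bits, padded with zeros. -/
def Val.takeBits : ℕ → Val → List Bool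
  | 0, _ => []
  | k + 1, v => v.hd.toBool :: Val.takeBits k v.tl

theorem Val.takeBits_eq (k : ℕ) (v : Val) :
    Val.takeBits k v = List.ofFn fun i : Fin k => v.toBits.getD i.val false := by
  induction k generalizing v with
  | zero => simp [takeBits]
  | succ k ih =>
    rw [takeBits, ih, List.ofFn_succ]
    cases v with
    | nil => simp [toBits, toBool]
    | cons a b => simp [toBits]

theorem Val.ofBits_takeBits (k : ℕ) (v : Val) : ofBits (takeBits k v) = ofBlock (v.toBlock k) := by
  rw [takeBits_eq]; rfl

/-- The list `v.hd` serves as a counter: each pass splits one bit off the remaining value, and head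
and tail of `nil` supply the zeros of the padding. -/
theorem Feasible.ofBlock_toBlock :
    Feasible fun v => .pure (.ofBlock (v.tl.toBlock v.hd.toList.length)) := by
  have hb : Feasible fun v => .pure (.cons (.ofBool v.tl.tl.hd.toBool) v.tl.tl.tl) :=
    let_ (.hd (.tl (.tl (.reg 0)))) ofBool_toBool
      (Feasible.expr (.cons (.hd (.reg 0)) (.tl (.tl (.tl (.tl (.reg 0)))))))
  have hg : Growth fun v => .pure (.cons (.ofBool v.tl.tl.hd.toBool) v.tl.tl.tl) :=
    growth_of_le 4 fun n x env acc => by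
      have := Val.size_ofBool_le acc.hd.toBool
      have := acc.size_tl_le
      simp [Comp.All]; omega
  refine ((Feasible.expr (.cons (.hd (.reg 0)) (.cons .nil (.tl (.reg 0))))).comp
    ((hb.mapC hg).comp (Feasible.expr (.hd (.reg 0))))).congr fun v => ?_
  rw [← Val.ofBits_takeBits]
  simp only [Expr.eval, Comp.pure_bind, Val.hd_cons, Val.tl_cons]
  generalize v.hd.toList = l
  suffices ∀ w, ∃ w', DurPRF.mapC (fun v => .pure (.cons (.ofBool v.tl.tl.hd.toBool) v.tl.tl.tl)) .nil l w
      = .pure (.cons (.ofBits (w.takeBits l.length)) w') by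
    obtain ⟨w', hw'⟩ := this v.tl
    simp [hw']
  induction l with
  | nil => exact fun w => ⟨w, rfl⟩
  | cons x l ih =>
    intro w
    obtain ⟨w', hw'⟩ := ih w.tl
    exact ⟨w', by simp [DurPRF.mapC, hw', Val.takeBits, Val.ofBits]⟩

/-! ## Searching -/

/-- The value at `k` in an association list, as an optional value. -/
def Val.find (k T : Val) : Val :=
  T.toList.foldl (fun acc e => if acc = nil then if k = e.hd then cons nil e.tl else nil else acc)
    nil

theorem Feasible.find : Feasible fun v => .pure (v.hd.find v.tl) := by
  let g : Val → Val := fun v => if v.tl.tl = .nil then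
    if v.tl.hd = v.hd.hd then .cons .nil v.hd.tl else .nil else v.tl.tl
  have hb : Feasible fun v => .pure (g v) := by
    refine (ite (.tl (.tl (.reg 0))) (Feasible.expr (.tl (.tl (.reg 0))))
      (ite (.eq (.hd (.tl (.reg 0))) (.hd (.hd (.reg 0))))
        (Feasible.expr (.cons .nil (.tl (.hd (.reg 0))))) (Feasible.expr .nil))).congr fun v => ?_
    simp only [Expr.eval, g]
    by_cases h1 : v.tl.tl = .nil <;> by_cases h2 : v.tl.hd = v.hd.hd <;> simp [h1, h2, Val.ofBool]
  obtain ⟨q, hq⟩ : Growth fun v => .pure (g v) := growth_of_le 4 fun n x env acc => by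
    have := x.size_tl_le
    change (if acc = .nil then if env = x.hd then Val.cons .nil x.tl else .nil else acc).size ≤ _
    have := acc.size_pos
    split_ifs <;> simp <;> omega
  refine ((Feasible.expr (.cons (.tl (.reg 0)) (.cons (.hd (.reg 0)) .nil))).comp
    (hb.fold q hq)).congr fun v => ?_
  simp only [Expr.eval, Comp.pure_bind, Val.hd_cons, Val.tl_cons]
  rw [foldC_pure (g := fun acc e => if acc = .nil then if v.hd = e.hd then .cons .nil e.tl else .nil
    else acc) (fun _ _ => rfl)]
  rfl

/-- Nonempty if some entry of the first list is missing in the second one. -/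
def Val.missing (l m : Val) : Val :=
  l.toList.foldl (fun acc z => if z ∈ m.toList then acc else cons nil nil) nil

theorem Val.missing_eq_nil {l m : Val} : l.missing m = nil ↔ ∀ z ∈ l.toList, z ∈ m.toList := by
  suffices ∀ (k : List Val) (a : Val), k.foldl (fun acc z => if z ∈ m.toList then acc else cons nil nil) a
      = nil ↔ a = nil ∧ ∀ z ∈ k, z ∈ m.toList by simp [missing, this]
  intro k
  induction k with
  | nil => simp
  | cons z k ih =>
    intro a
    by_cases h : z ∈ m.toList <;> simp [ih, h]

theorem Feasible.mem : Feasible fun v => .pure (.ofBool (decide (v.hd ∈ v.tl.toList))) := by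
  let g : Val → Val := fun v => if v.tl.hd = v.hd then .cons .nil .nil else v.tl.tl
  have hb : Feasible fun v => .pure (g v) := by
    refine (ite (.eq (.hd (.tl (.reg 0))) (.hd (.reg 0)))
        (Feasible.expr (.cons .nil .nil)) (Feasible.expr (.tl (.tl (.reg 0))))).congr fun v => ?_
    simp only [Expr.eval, g]
    by_cases h2 : v.tl.hd = v.hd <;> simp [h2, Val.ofBool]
  obtain ⟨q, hq⟩ : Growth fun v => .pure (g v) := growth_of_le 4 fun n x env acc => by
    change (if env = x then Val.cons .nil .nil else acc).size ≤ _
    split_ifs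
    · simp
    · omega
  refine ((Feasible.expr (.cons (.tl (.reg 0)) (.cons (.hd (.reg 0)) .nil))).comp
    (hb.fold q hq)).congr fun v => ?_
  simp only [Expr.eval, Comp.pure_bind, Val.hd_cons, Val.tl_cons]
  rw [foldC_pure (g := fun acc e => if v.hd = e then .cons .nil .nil else acc) (fun _ _ => rfl)]
  congr 1
  generalize v.tl.toList = l
  suffices ∀ a : Bool, Val.ofBool (a || decide (v.hd ∈ l)) =
      l.foldl (fun acc e => if v.hd = e then .cons .nil .nil else acc) (.ofBool a) from this false
  induction l with
  | nil => simp
  | cons e l ih =>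
    intro a
    rw [List.foldl_cons]
    split_ifs with h
    · exact Eq.trans (by simp [h]) (ih true)
    · rw [← ih]; simp [h]

theorem Feasible.missing : Feasible fun v => .pure (v.hd.missing v.tl) := by
  let g : Val → Val := fun v => if v.hd ∈ v.tl.hd.toList then v.tl.tl else .cons .nil .nil
  have hb : Feasible fun v => .pure (g v) := by
    refine (let_ (.cons (.hd (.reg 0)) (.hd (.tl (.reg 0)))) mem (ite (.hd (.reg 0))
      (Feasible.expr (.tl (.tl (.tl (.reg 0))))) (Feasible.expr (.cons .nil .nil)))).congr
      fun v => ?_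
    simp only [Expr.eval, g, Comp.pure_bind, Val.hd_cons, Val.tl_cons, Val.ofBool_ne_nil]
    by_cases h2 : v.hd ∈ v.tl.hd.toList <;> simp [h2]
  obtain ⟨q, hq⟩ : Growth fun v => .pure (g v) := growth_of_le 4 fun n x env acc => by
    change (if x ∈ env.toList then acc else Val.cons .nil .nil).size ≤ _
    split_ifs
    · omega
    · simp
  refine ((Feasible.expr (.cons (.hd (.reg 0)) (.cons (.tl (.reg 0)) .nil))).comp
    (hb.fold q hq)).congr fun v => ?_
  simp only [Expr.eval, Comp.pure_bind, Val.hd_cons, Val.tl_cons]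
  rw [foldC_pure (g := fun acc z => if z ∈ v.tl.toList then acc else .cons .nil .nil)
    (fun _ _ => rfl)]
  rfl

/-! ## Sampling -/

/-- A loop body that tosses a coin. -/
def tossBody : Val → Comp Val := stateless fun _ => .coin fun b => .pure (.ofBool b)

/-- As many random bits as the list has entries. -/
def sampleC (u : Val) : Comp Val := (mapC tossBody .nil u.toList .nil).bind fun o => .pure o.hd

theorem Feasible.sampleC : Feasible sampleC :=
  ((Feasible.expr (.cons (.reg 0) (.cons .nil .nil))).comp
    ((coin.stateless.mapC (growth_stateless coin)).comp (Feasible.expr (.hd (.reg 0))))).congr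
    fun _ => rfl

/-- The loop body that looks up a value in a lazily sampled random function; the length of the list
`v.tl.hd.hd` is the length of the outputs. -/
def queryBody (v : Val) : Comp Val :=
  if v.hd.find v.tl.tl = .nil then
    (sampleC v.tl.hd.hd).bind fun b =>
      .pure (.cons b (v.tl.tl.append (.cons (.cons v.hd b) .nil)))
  else .pure (.cons (.ofBlock ((v.hd.find v.tl.tl).tl.toBlock v.tl.hd.hd.toList.length)) v.tl.tl)

theorem Feasible.queryBody : Feasible queryBody := by
  refine (let_ (.cons (.hd (.reg 0)) (.tl (.tl (.reg 0)))) find (ite (.hd (.reg 0))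
    (let_ (.cons (.hd (.hd (.tl (.tl (.reg 0))))) (.tl (.hd (.reg 0)))) ofBlock_toBlock
      (Feasible.expr (.cons (.hd (.reg 0)) (.tl (.tl (.tl (.tl (.reg 0))))))))
    (let_ (.hd (.hd (.tl (.tl (.reg 0))))) sampleC
      (let_ (.cons (.tl (.tl (.tl (.tl (.reg 0)))))
          (.cons (.cons (.hd (.tl (.tl (.reg 0)))) (.hd (.reg 0))) .nil)) append
        (Feasible.expr (.cons (.hd (.tl (.reg 0))) (.hd (.reg 0)))))))).congr fun v => ?_
  change _ = if v.hd.find v.tl.tl = .nil then _ else _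
  unfold DurPRF.queryBody
  split_ifs <;> simp [Expr.eval]

/-- A query adds at most one entry to the table, consisting of a copy of the argument and a fresh
block. -/
theorem growth_queryBody : Growth queryBody := by
  obtain ⟨p, hp⟩ := Feasible.sampleC.exists_size_bound
  refine ⟨2 * p + 5 * Polynomial.X + 10, fun n x env acc => ?_⟩
  simp only [Polynomial.eval_add, Polynomial.eval_mul, Polynomial.eval_ofNat, Polynomial.eval_X]
  have h1 := env.size_hd_le
  change Comp.All _ _ (if x.find acc = .nil then (sampleC env.hd).bind fun b =>
    .pure (Val.cons b (acc.append (.cons (.cons x b) .nil))) else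
    .pure (Val.cons (.ofBlock ((x.find acc).tl.toBlock env.hd.toList.length)) acc))
  split_ifs with h
  · rw [Comp.all_bind]
    refine (hp n env.hd).mono fun w hw => ?_
    have := Val.size_append acc (.cons (.cons x w) .nil)
    have := polynomial_eval_mono p (show n + env.hd.size ≤ n + x.size + env.size by omega)
    simp [Comp.All] at *
    omega
  · have h2 := env.hd.length_toList_lt
    have := Val.size_ofBlock_le ((x.find acc).tl.toBlock env.hd.toList.length)
    simp [Comp.All]
    omega

/-! ## Running a program with its oracle computed by a subroutine -/

namespace Cmd

/-- All registers are below this bound. -/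
def bound : Cmd → ℕ
  | assign r e => max (r + 1) e.bound
  | coin r => r + 1
  | call r e => max (r + 1) e.bound
  | seq c d => max c.bound d.bound
  | ite r c d => max (r + 1) (max c.bound d.bound)
  | loop r c => max (r + 1) c.bound

/-- The registers are moved up by `b`, and the oracle calls are replaced by the program `h w`, which
works on a pair of a state and a query in register `w`. -/
def embed (h : ℕ → Cmd) (b w : ℕ) : Cmd → Cmd
  | assign r e => assign (b + r) (e.rename (b + ·))
  | coin r => coin (b + r)
  | call r e => seq (assign w (.cons (.reg w) (e.rename (b + ·)))) (seq (h w)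
      (seq (assign (b + r) (.hd (.reg w))) (assign w (.tl (.reg w)))))
  | seq c d => seq (c.embed h b w) (d.embed h b w)
  | ite r c d => ite (b + r) (c.embed h b w) (d.embed h b w)
  | loop r c => loop (b + r) (c.embed h b w)

end Cmd

/-- The time per time unit of an embedded program. -/
def embedOverhead (p : Polynomial ℕ) (n S G t : ℕ) : ℕ :=
  S + G * t + t + 6 + 3 * p.eval (n + S + G * t + t + 1)

theorem embedOverhead_mono (p : Polynomial ℕ) (n S G : ℕ) : Monotone (embedOverhead p n S G) := by
  intro t t' h
  have h1 : G * t ≤ G * t' := by gcongr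
  have := polynomial_eval_mono p (show n + S + G * t + t + 1 ≤ n + S + G * t' + t' + 1 by omega)
  simp only [embedOverhead] at *
  omega

/-- Registers, state and time of an embedded program, relative to the original program. -/
structure EmbedRel (p : Polynomial ℕ) (I : Val → Prop) (s₀ : Store) (b w n S G T : ℕ)
    (x : Store × ℕ) (y : (Store × ℕ) × Val) : Prop where
  regs : ∀ r, b + r < w → x.1 (b + r) = y.1.1 r
  frame : ∀ r < b, x.1 r = s₀ r
  state : x.1 w = y.2
  inv : I y.2
  size : y.2.size ≤ S + G * y.1.2
  time : x.2 ≤ T + y.1.2 * embedOverhead p n S G y.1.2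

section

variable {p : Polynomial ℕ} {I : Val → Prop} {s₀ : Store} {b w n S G T : ℕ}

/-- An ordinary instruction takes equal time in both programs, and each unit of original time is
credited with an overhead of at least one. -/
theorem EmbedRel.step {x : Store × ℕ} {y : (Store × ℕ) × Val} (h : EmbedRel p I s₀ b w n S G T x y)
    (r : ℕ) (hr : b + r < w) (v : Val) (d : ℕ) :
    EmbedRel p I s₀ b w n S G T (Function.update x.1 (b + r) v, x.2 + d)
      ((Function.update y.1.1 r v, y.1.2 + d), y.2) where
  regs r' hr' := by
    by_cases hrr : r' = r
    · subst hrr; simp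
    · dsimp only
      rw [Function.update_of_ne (by omega), Function.update_of_ne hrr, h.regs r' hr']
  frame r' hr' := by
    dsimp only
    rw [Function.update_of_ne (by omega), h.frame r' hr']
  state := by
    dsimp only
    rw [Function.update_of_ne (by omega), h.state]
  inv := h.inv
  size := h.size.trans (by gcongr; simp)
  time := by
    have h1 := h.time
    have h2 := embedOverhead_mono p n S G (show y.1.2 ≤ y.1.2 + d by omega)
    have h3 : 1 ≤ embedOverhead p n S G (y.1.2 + d) := by unfold embedOverhead; omega
    dsimp only
    nlinarith

theorem EmbedRel.tick {x : Store × ℕ} {y : (Store × ℕ) × Val} (h : EmbedRel p I s₀ b w n S G T x y) :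
    EmbedRel p I s₀ b w n S G T (x.1, x.2 + 1) ((y.1.1, y.1.2 + 1), y.2) where
  regs := h.regs
  frame := h.frame
  state := h.state
  inv := h.inv
  size := h.size.trans (by gcongr; simp)
  time := by
    have h1 := h.time
    have h2 := embedOverhead_mono p n S G (show y.1.2 ≤ y.1.2 + 1 by omega)
    have h3 : 1 ≤ embedOverhead p n S G (y.1.2 + 1) := by unfold embedOverhead; omega
    dsimp only
    nlinarith

theorem sim_iter {f : Val → Comp Val} {g g' : Store × ℕ → Comp (Store × ℕ)}
    (hg : ∀ x y, EmbedRel p I s₀ b w n S G T x y →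
      Comp.Sim (BlockReply n) (EmbedRel p I s₀ b w n S G T) (g x) ((g' y.1).handle f y.2))
    (k : ℕ) (x : Store × ℕ) (y : (Store × ℕ) × Val) (h : EmbedRel p I s₀ b w n S G T x y) :
    Comp.Sim (BlockReply n) (EmbedRel p I s₀ b w n S G T) (iter g k x)
      ((iter g' k y.1).handle f y.2) := by
  induction k generalizing x y with
  | zero => exact .pure h
  | succ k ih =>
    simp only [iter, Comp.handle_bind]
    exact (hg x y h).bind fun a b' hab => ih a b' hab

/-- The registers of `c` lie between `b` and `w`, and the handler works at `w` and above, so they do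
not interfere. Only calls cost more than in the original. The state grows by at most `G` per unit of
query size and queries are paid for, so after time `t` it has size at most `S + G * t`, which makes
each call polynomial. -/
theorem Cmd.sim_embed {f : Val → Comp Val} {h : ℕ → Cmd} (hf : Implements h p f)
    {ok : Val → Val → Prop}
    (hI : ∀ st q, I st → (f (.cons st q)).All (BlockReply n) fun o =>
      I o.tl ∧ ok q o.hd ∧ o.tl.size ≤ st.size + G * q.size)
    (c : Cmd) (hc : b + c.bound ≤ w) (x : Store × ℕ) (y : (Store × ℕ) × Val)
    (hxy : EmbedRel p I s₀ b w n S G T x y) :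
    Comp.Sim (BlockReply n) (EmbedRel p I s₀ b w n S G T) ((c.embed h b w).exec x)
      ((c.exec y.1).handle f y.2) := by
  have heval : ∀ {x : Store × ℕ} {y : (Store × ℕ) × Val}, EmbedRel p I s₀ b w n S G T x y →
      ∀ {e : Expr}, b + e.bound ≤ w → (e.rename (b + ·)).eval x.1 = e.eval y.1.1 ∧
        (e.rename (b + ·)).cost x.1 = e.cost y.1.1 := fun {x y} hxy {e} he => by
    rw [Expr.eval_rename, Expr.cost_rename]
    exact ⟨Expr.eval_congr (M := e.bound) le_rfl fun r hr => hxy.regs r (by omega),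
      Expr.cost_congr (M := e.bound) le_rfl fun r hr => hxy.regs r (by omega)⟩
  induction c generalizing x y with
  | assign r e =>
    simp only [bound] at hc
    obtain ⟨h1, h2⟩ := heval hxy (e := e) (by omega)
    simp only [embed, exec, Comp.handle, h1, h2]
    exact .pure (hxy.step r (by omega) _ (e.cost y.1.1 + 1))
  | coin r =>
    simp only [bound] at hc
    simp only [embed, exec, Comp.handle]
    exact .coin fun a => .pure (hxy.step r (by omega) _ 1)
  | call r e =>
    simp only [bound] at hc
    obtain ⟨h1, h2⟩ := heval hxy (e := e) (by omega)
    simp only [embed, exec, Comp.handle, Comp.pure_bind, Expr.eval, Expr.cost, h1, h2, hxy.state]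
    have hcall := hf w n (Function.update x.1 w (.cons y.2 (e.eval y.1.1)))
      (x.2 + (y.2.size + e.cost y.1.1 + 1) + 1)
    rw [Function.update_self] at hcall
    refine (hcall.and_all (hI y.2 (e.eval y.1.1) hxy.inv)).bind ?_
    rintro ⟨s', t'⟩ o ⟨⟨rfl, hs, ht, ho⟩, hinv, -, hsize⟩
    dsimp only at hs ht ho hinv hsize
    have hcost := e.size_eval_le_cost y.1.1
    have hhd := (s' w).size_hd_le
    have htl := (s' w).size_tl_le
    have hst := hxy.size
    refine .pure ⟨fun r' hr' => ?_, fun r' hr' => ?_, ?_, hinv, ?_, ?_⟩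
    · dsimp only
      rw [Function.update_of_ne (by omega)]
      by_cases hrr : r' = r
      · subst hrr; simp
      · rw [Function.update_of_ne (by omega), Function.update_of_ne hrr, hs _ hr',
          Function.update_of_ne (by omega), hxy.regs _ hr']
    · dsimp only
      rw [Function.update_of_ne (by omega), Function.update_of_ne (by omega), hs _ (by omega),
        Function.update_of_ne (by omega), hxy.frame _ hr']
    · dsimp only
      rw [Function.update_self, Function.update_of_ne (by omega)]
    · refine hsize.trans ?_
      have : G * (e.eval y.1.1).size ≤ G * e.cost y.1.1 := by gcongr
      simp only [mul_add]
      omega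
    · dsimp only
      rw [Function.update_of_ne (show w ≠ b + r by omega)]
      set t := y.1.2 with ht'
      set u := t + e.cost y.1.1 + (s' w).hd.size + 1 with hu
      have hGt : G * t ≤ G * u := by gcongr; omega
      have hp := polynomial_eval_mono p (show n + (Val.cons y.2 (e.eval y.1.1)).size ≤
        n + S + G * u + u + 1 by simp only [Val.size_cons]; omega)
      have hQ := embedOverhead_mono p n S G (show t ≤ u by omega)
      have hxt : x.2 ≤ T + t * embedOverhead p n S G t := hxy.time
      have h5 : t * embedOverhead p n S G t ≤ t * embedOverhead p n S G u := by gcongr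
      -- The original program spends at least one unit on the call, and that unit pays for one full
      -- overhead.
      have h6 : (t + 1) * embedOverhead p n S G u ≤ u * embedOverhead p n S G u := by
        gcongr; omega
      -- State and query are read once; `3 * p` covers the run of the handler and two readings of
      -- its answer, and `6` is the bookkeeping of three assignments.
      have h7 : embedOverhead p n S G u =
        S + G * u + u + 6 + 3 * p.eval (n + S + G * u + u + 1) := rfl
      dsimp only at hp
      rw [add_mul, one_mul] at h6
      omega
  | seq c d ihc ihd =>
    simp only [bound] at hc
    simp only [embed, exec, Comp.handle_bind]
    exact (ihc (by omega) x y hxy).bind fun a b' hab => ihd (by omega) a b' hab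
  | ite r c d ihc ihd =>
    simp only [bound] at hc
    simp only [embed, exec]
    rw [hxy.regs r (by omega)]
    split_ifs
    · exact ihd (by omega) _ _ hxy.tick
    · exact ihc (by omega) _ _ hxy.tick
  | loop r c ih =>
    simp only [bound] at hc
    simp only [embed, exec]
    rw [hxy.regs r (by omega)]
    exact sim_iter (g := fun q => (c.embed h b w).exec (q.1, q.2 + 1))
      (fun x' y' h' => ih (by omega) (x'.1, x'.2 + 1) ((y'.1.1, y'.1.2 + 1), y'.2) h'.tick) _ _ _ hxy.tick

end

/-- A sequence of assignments that empties the registers `b, …, b + k - 1`. -/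
def clear (b : ℕ) : ℕ → Cmd
  | 0 => .assign b (.reg b)
  | k + 1 => .seq (clear b k) (.assign (b + k) .nil)

/-- The summand `(s b).size + 1` is the cost of the idle assignment at the bottom of `clear`, which
stands in for an empty program. -/
theorem exec_clear (b k : ℕ) (s : Store) (t : ℕ) :
    ∃ t' s', (clear b k).exec (s, t) = .pure (s', t') ∧ t' = t + (s b).size + 1 + 2 * k ∧
      (∀ r < k, s' (b + r) = .nil) ∧ ∀ r, (r < b ∨ b + k ≤ r) → s' r = s r := by
  induction k with
  | zero =>
    exact ⟨_, _, rfl, rfl, by simp, fun r _ => by simp [Expr.eval]⟩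
  | succ k ih =>
    obtain ⟨t', s', h1, h2, h3, h4⟩ := ih
    refine ⟨t + (s b).size + 1 + 2 * (k + 1), Function.update s' (b + k) .nil, ?_, rfl,
      fun r hr => ?_, fun r hr => ?_⟩
    · simp only [clear, Cmd.exec, h1, Comp.pure_bind, Expr.eval, Expr.cost, h2]
      congr 2
    · by_cases hk : r = k
      · subst hk; simp
      · rw [Function.update_of_ne (by omega), h3 r (by omega)]
    · rw [Function.update_of_ne (by omega), h4 r (by omega)]

/-! ## Efficiently computable functions as subroutines -/

namespace Comp

/-- There are no oracle calls. -/
def NoCalls {α : Type} : Comp α → Prop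
  | .pure _ => True
  | .coin k => ∀ b, (k b).NoCalls
  | .call _ _ => False

theorem noCalls_handle {α : Type} (x : Comp α) (st : Val) :
    (x.handle (fun _ => .pure .nil) st).NoCalls := by
  induction x generalizing st with
  | pure a => trivial
  | coin k ih => exact fun b => ih b st
  | call q k ih => exact ih _ _

/-- A computation that only tosses coins and always ends in an acceptable result counts as
deterministic, since all its coins can be skipped. -/
theorem Sim.to_pure {α β γ : Type} {ok : Val → Val → Prop} {R : α → β → Prop}
    {R' : α → γ → Prop} {x : Comp α} {y : Comp β} (h : Sim ok R x y) (hy : y.NoCalls) (c : γ)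
    (hR : ∀ a b, R a b → R' a c) : Sim ok R' x (.pure c) := by
  induction h with
  | pure h => exact .pure (hR _ _ h)
  | coin _ ih => exact .skip fun b => ih b (hy b)
  | call _ _ => exact hy.elim
  | skip _ ih => exact .skip fun b => ih b hy

theorem Sim.bind_of_pure {α α' β γ : Type} {ok : Val → Val → Prop} {R : α → γ → Prop}
    {R' : α' → β → Prop} {x : Comp α} {f : α → Comp α'} {c : γ} {y : Comp β}
    (h : Sim ok R x (.pure c)) (hf : ∀ a, R a c → Sim ok R' (f a) y) : Sim ok R' (x.bind f) y := by
  have h' : Sim ok (fun a b => R a b ∧ b = c) x (.pure c) := h.and_all rfl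
  exact h'.bind (g := fun _ => y) fun a b ⟨hab, hb⟩ => hf a (hb ▸ hab)

end Comp

/-- The key and the block in an input are brought to the right length. -/
def normalizeInput (v : Val) : Val :=
  .cons (.unary v.hd.toList.length) (.cons (.ofBlock (v.tl.hd.toBlock v.hd.toList.length))
    (.ofBlock (v.tl.tl.toBlock v.hd.toList.length)))

theorem Feasible.normalizeInput : Feasible fun v => .pure (normalizeInput v) :=
  (let_ (.hd (.reg 0)) unary (let_ (.cons (.hd (.tl (.reg 0))) (.hd (.tl (.tl (.reg 0))))) ofBlock_toBlock
    (let_ (.cons (.hd (.tl (.tl (.reg 0)))) (.tl (.tl (.tl (.tl (.reg 0)))))) ofBlock_toBlock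
      (Feasible.expr (.cons (.hd (.tl (.tl (.reg 0))))
        (.cons (.hd (.tl (.reg 0))) (.hd (.reg 0)))))))).congr fun v => by
    simp [Expr.eval, DurPRF.normalizeInput]

/-- The call of a program with three inputs from a triple in register `b`. -/
def subroutine (c : Cmd) (h : ℕ → Cmd) (M b : ℕ) : Cmd :=
  .seq (.assign (b + M + 1) (.reg b)) <| .seq (clear b M) <|
  .seq (.assign b (.hd (.reg (b + M + 1)))) <| .seq (.assign (b + 1) (.hd (.tl (.reg (b + M + 1))))) <|
  .seq (.assign (b + 2) (.tl (.tl (.reg (b + M + 1))))) <| .seq (.assign (b + M) .nil) <|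
  c.embed h b (b + M)

/-- A program expects `nil` in all registers but its three inputs, so its window is cleared first.
Register `b + M + 1` saves the triple meanwhile, and `b + M` holds the trivial state of the call
handler. -/
theorem exec_subroutine_start {c : Cmd} {h : ℕ → Cmd} {M : ℕ} (hM : 3 ≤ M) (b : ℕ) (s : Store)
    (t : ℕ) (u v w : Val) (hs : s b = .cons u (.cons v w)) :
    ∃ s' t', (subroutine c h M b).exec (s, t) = (c.embed h b (b + M)).exec (s', t') ∧
      t' ≤ t + 5 * (s b).size + 2 * M + 20 ∧ (∀ r < M, s' (b + r) = inputs u v w r) ∧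
      (∀ r < b, s' r = s r) ∧ s' (b + M) = .nil := by
  obtain ⟨t1, s1, h1, ht1, h2, h3⟩ := exec_clear b M (Function.update s (b + M + 1) (s b))
    (t + (s b).size + 1)
  have h4 : s1 (b + M + 1) = .cons u (.cons v w) := by rw [h3 _ (by omega)]; simp [hs]
  simp only [subroutine, Cmd.exec, Comp.pure_bind, Expr.eval, Expr.cost, h1]
  refine ⟨_, _, rfl, ?_, fun r hr => ?_, fun r hr => ?_, ?_⟩
  · rw [ht1]
    simp only [Function.update_of_ne (show b + M + 1 ≠ b by omega),
      Function.update_of_ne (show b + M + 1 ≠ b + 1 by omega),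
      Function.update_of_ne (show b ≠ b + M + 1 by omega), h4, hs, Val.size_cons]
    omega
  · rw [Function.update_of_ne (by omega)]
    have e1 : b + M + 1 ≠ b := by omega
    have e2 : b + M + 1 ≠ b + 1 := by omega
    match r with
    | 0 => simp [inputs, h4, Function.update_apply]
    | 1 => simp [inputs, h4, Function.update_of_ne e1]
    | 2 => simp only [inputs, h4, Function.update_of_ne e1, Function.update_of_ne e2,
        Function.update_self, Val.tl_cons]
    | r + 3 =>
      rw [Function.update_of_ne (by omega), Function.update_of_ne (by omega),
        Function.update_of_ne (by omega), h2 _ hr]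
      rfl
  · rw [Function.update_of_ne (by omega), Function.update_of_ne (by omega),
      Function.update_of_ne (by omega), Function.update_of_ne (by omega), h3 _ (by omega),
      Function.update_of_ne (by omega)]
  · simp

/-- The program for `E` is correct whatever its coins show and its calls return, so calls may be
answered by `nil` and coins skipped. Its guarantee covers well-formed inputs only, whence the
preceding normalization. -/
theorem Feasible.of_efficientlyComputable {E : ∀ n : ℕ, Block n → Block n → Block n}
    (hE : EfficientlyComputable E) :
    Feasible fun v => .pure (.ofBlock (E v.hd.toList.length
      (v.tl.hd.toBlock v.hd.toList.length) (v.tl.tl.toBlock v.hd.toList.length))) := by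
  obtain ⟨c, p, hc⟩ := hE
  obtain ⟨cn, pn, hcn⟩ := Feasible.normalizeInput
  obtain ⟨h, ph, hh⟩ := Feasible.expr .nil
  set M := max 3 c.bound with hM
  refine ⟨fun b => .seq (cn b) (subroutine c h M b),
    6 * pn + Polynomial.C (2 * M + 20) + p * (p + 7 +
      3 * ph.comp (Polynomial.X + p + 2)) + 4 * Polynomial.X + 1, fun b n s t => ?_⟩
  set v := s b with hv
  set k := v.hd.toList.length with hk
  have hkv : k ≤ n + v.size := by
    have := v.hd.length_toList_lt
    have := v.size_hd_le
    omega
  change Comp.Sim _ _ (((cn b).exec (s, t)).bind _) _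
  refine (hcn b n s t).bind_of_pure ?_
  rintro ⟨s1, t1⟩ ⟨hnv, hs1, ht1, hsize⟩
  dsimp only at hs1 ht1 hsize hnv ⊢
  obtain ⟨s2, t2, he, ht2, hin, hfr, hst⟩ := exec_subroutine_start (c := c) (h := h) (M := M)
    (le_max_left _ _) b s1 t1 _ _ _ hnv
  rw [he]
  set st := inputs (.unary k) (.ofBlock (v.tl.hd.toBlock k)) (.ofBlock (v.tl.tl.toBlock k))
  -- The handler always returns `nil`, so its state has size `1` and does not grow.
  have hemb := Cmd.sim_embed (I := fun v => v = .nil) (G := 0) (S := 1) (T := t2) (s₀ := s) (n := n)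
    (w := b + M) hh (ok := fun _ _ => True)
    (fun _ _ _ => by simp [Comp.All, Expr.eval, Val.size_pos]) c (by omega) (s2, t2) ((st, 0), .nil)
    ⟨fun r hr => hin r (by omega), fun r hr => (hfr r hr).trans (hs1 r hr), hst, rfl, by simp,
      by simp⟩
  have hall := (hc k (v.tl.hd.toBlock k) (v.tl.tl.toBlock k)).handle (ok := BlockReply n)
    (f := fun _ => .pure .nil) (I := fun _ => True) (st := .nil)
    (fun _ _ _ => by simp [Comp.All]) trivial
  refine (hemb.and_all hall).to_pure (Comp.noCalls_handle _ _) _ ?_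
  rintro ⟨s3, t3⟩ ⟨⟨s4, t4⟩, w⟩ ⟨hrel, hres, htime⟩
  have hreg := hrel.regs 0 (by omega)
  have ht3 := hrel.time
  dsimp only at hres htime hreg ht3
  rw [hres] at hreg
  have hblock := Val.size_ofBlock_le (E k (v.tl.hd.toBlock k) (v.tl.tl.toBlock k))
  have h1 := polynomial_eval_mono p hkv
  have ht1' : t1 ≤ t + pn.eval (n + v.size) := ht1
  dsimp only at h1
  have h2 : t4 * embedOverhead ph n 1 0 t4 ≤ p.eval (n + v.size) * (p.eval (n + v.size) + 7 +
      3 * ph.eval (n + v.size + p.eval (n + v.size) + 2)) := by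
    refine Nat.mul_le_mul (by omega) ?_
    have := polynomial_eval_mono ph (show n + 1 + 0 * t4 + t4 + 1 ≤
      n + v.size + p.eval (n + v.size) + 2 by omega)
    dsimp only at this
    unfold embedOverhead
    omega
  have h3 : (s1 b).size ≤ pn.eval (n + v.size) := by rw [hnv]; exact hsize
  simp only [Polynomial.eval_add, Polynomial.eval_mul, Polynomial.eval_ofNat, Polynomial.eval_X,
    Polynomial.eval_C, Polynomial.eval_comp, Polynomial.eval_one]
  exact ⟨by simpa using hreg, hrel.frame, by omega, hblock.trans (by omega)⟩

/-! ## Relations between stateful random processes -/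

theorem map_id' {α : Type} (p : PMF α) : p.map (fun a => a) = p := PMF.map_id p

theorem map_const' {α β : Type} (p : PMF α) (b : β) : p.map (fun _ => b) = .pure b :=
  PMF.map_const p b

section Kernel

variable {α β γ Z Z' Z'' W : Type}

/-- From a random state `κ z'`, the process `F` gives the same output as `F'` from `z'`, and given
the output the state is again distributed according to `κ`. -/
def KernelHom (κ : Z' → PMF Z) (F : Z → PMF (β × Z)) (F' : Z' → PMF (β × Z')) : Prop :=
  ∀ z', (κ z').bind F = (F' z').bind fun o => (κ o.2).map (Prod.mk o.1)

/-- For a deterministic kernel the notion becomes that of a map of states that commutes with the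
processes. -/
theorem kernelHom_pure_iff {π : Z' → Z} {F : Z → PMF (β × Z)} {F' : Z' → PMF (β × Z')} :
    KernelHom (fun z => .pure (π z)) F F' ↔
      ∀ z', F (π z') = (F' z').map fun o => (o.1, π o.2) := by
  simp [KernelHom, PMF.map, Function.comp_def]

theorem KernelHom.map {κ : Z' → PMF Z} {F : Z → PMF (β × Z)} {F' : Z' → PMF (β × Z')}
    (h : KernelHom κ F F') (φ : β → γ) :
    KernelHom κ (fun z => (F z).map fun o => (φ o.1, o.2))
      fun z => (F' z).map fun o => (φ o.1, o.2) := by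
  intro z'
  rw [← PMF.map_bind, h z', PMF.map_bind, PMF.bind_map]
  simp [PMF.map_comp, Function.comp_def]

theorem KernelHom.bind {κ : Z' → PMF Z} {F : Z → PMF (β × Z)} {F' : Z' → PMF (β × Z')}
    {G : β → Z → PMF (γ × Z)} {G' : β → Z' → PMF (γ × Z')}
    (h : KernelHom κ F F') (hG : ∀ b, KernelHom κ (G b) (G' b)) :
    KernelHom κ (fun z => (F z).bind fun o => G o.1 o.2)
      fun z => (F' z).bind fun o => G' o.1 o.2 := by
  intro z'
  rw [← PMF.bind_bind, h z', PMF.bind_bind, PMF.bind_bind]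
  refine congrArg _ (funext fun o => ?_)
  rw [PMF.bind_map]
  exact hG o.1 o.2

theorem KernelHom.pure (κ : Z' → PMF Z) (b : β) :
    KernelHom κ (fun z => .pure (b, z)) fun z => .pure (b, z) := by
  intro z'
  simp [PMF.map, Function.comp_def]

/-- A run is built from oracle steps and from coins that are independent of the oracle's state, and
the relation is stable under both. -/
theorem KernelHom.run {O : Z → Val → PMF (Val × Z)} {O' : Z' → Val → PMF (Val × Z')}
    {κ : Z' → PMF Z} (h : ∀ q, KernelHom κ (O · q) (O' · q)) (x : Comp α) :
    KernelHom κ (x.run O) (x.run O') := by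
  induction x with
  | pure a => exact .pure κ a
  | coin k ih =>
    intro z'
    simp only [Comp.run]
    rw [PMF.bind_comm, PMF.bind_bind]
    exact congrArg _ (funext fun b => ih b z')
  | call q k ih => exact (h q).bind ih

/-- An environment sees outputs only, so the conditional law of the state is forgotten at the end.
-/
theorem KernelHom.map_fst_eq {κ : Z' → PMF Z} {F : Z → PMF (β × Z)} {F' : Z' → PMF (β × Z')}
    (h : KernelHom κ F F') (z' : Z') :
    (κ z').bind (fun z => (F z).map Prod.fst) = (F' z').map Prod.fst := by
  rw [← PMF.map_bind, h z', PMF.map_bind]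
  simp only [PMF.map_comp, Function.comp_def, map_const']
  rfl

/-- Application of a stateful random function to the entries of a list. -/
def mapAcc (F : α → Z → PMF (β × Z)) : List α → Z → PMF (List β × Z)
  | [], z => .pure ([], z)
  | a :: l, z => (F a z).bind fun o => (mapAcc F l o.2).map fun o' => (o.1 :: o'.1, o'.2)

theorem KernelHom.mapAcc {κ : Z' → PMF Z} {F : α → Z → PMF (β × Z)} {F' : α → Z' → PMF (β × Z')}
    (h : ∀ a, KernelHom κ (F a) (F' a)) (l : List α) :
    KernelHom κ (mapAcc F l) (mapAcc F' l) := by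
  induction l with
  | nil => exact .pure κ []
  | cons a l ih => exact (h a).bind fun b => ih.map (b :: ·)

theorem mapAcc_append (F : α → Z → PMF (β × Z)) (l l' : List α) (z : Z) :
    mapAcc F (l ++ l') z = (mapAcc F l z).bind fun o =>
      (mapAcc F l' o.2).map fun o' => (o.1 ++ o'.1, o'.2) := by
  induction l generalizing z with
  | nil => simp [mapAcc, map_id']
  | cons a l ih => simp [mapAcc, ih, PMF.bind_bind, PMF.bind_map, PMF.map_bind, PMF.map_comp,
      Function.comp_def]

theorem mapAcc_pure (f : α → β) (l : List α) (z : Z) :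
    mapAcc (fun a z => .pure (f a, z)) l z = .pure (l.map f, z) := by
  induction l with
  | nil => rfl
  | cons a l ih => simp [mapAcc, ih, PMF.pure_map]

theorem length_of_mem_support_mapAcc {F : α → Z → PMF (β × Z)} {l : List α} {z : Z}
    {o : List β × Z} (h : o ∈ (mapAcc F l z).support) : o.1.length = l.length := by
  induction l generalizing z o with
  | nil => simp [mapAcc] at h; simp [h]
  | cons a l ih =>
    simp only [mapAcc, PMF.mem_support_bind_iff, PMF.mem_support_map_iff] at h
    obtain ⟨o₁, -, o₂, h₂, rfl⟩ := h
    simp [ih h₂]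

/-- A process that leaves a further component of the state alone. -/
def liftFst (F : Z → PMF (β × Z)) (s : Z × W) : PMF (β × (Z × W)) :=
  (F s.1).map fun o => (o.1, (o.2, s.2))

end Kernel

theorem queryAll_eq_mapAcc {n : ℕ} (xs : List (List Bool)) (T : Table n) :
    Table.queryAll xs T = mapAcc (fun x T => Table.query T x) xs T := by
  induction xs generalizing T with
  | nil => rfl
  | cons x xs ih => simp [Table.queryAll, mapAcc, ih, PMF.map, Function.comp_def]

/-! ## Games -/

section Game

variable {n : ℕ} {Z Z' : Type}

/-- A system with which an environment interacts, given by its reaction to the three kinds of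
requests. -/
structure Game (n : ℕ) (Z : Type) where
  hash : List Bool → Z → PMF (Block n × Z)
  eval : Party → List (List Bool) → Z → PMF ((List (Block n) × List (Block n)) × Z)
  update : List (Block n) → Z → PMF (List (Block n) × Z)

/-- The reaction of a game to a request of the environment. -/
def Game.step (σ : Party) (G : Game n Z) (s : Z × (Party → List (Block n))) (q : Val) :
    PMF (Val × (Z × (Party → List (Block n)))) :=
  match Query.decode n q with
  | .hash x => (G.hash x s.1).map fun o => (Val.ofBlock o.1, (o.2, s.2))
  | .eval p xs => (G.eval p xs s.1).map fun o =>
      (reply o.1.2 (Val.ofBlocks (if σ = p then o.1.1 else o.1.2)),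
        (o.2, addReceived s.2 p.other o.1.2))
  | .update p zs =>
      if ∀ z ∈ zs, z ∈ s.2 p then (G.update zs s.1).map fun o =>
        (reply o.1 (Val.ofBlocks (if σ = p then o.1 else [])), (o.2, s.2))
      else PMF.pure (.nil, s)

/-- The relation of `KernelHom` for all requests. -/
structure Game.Hom (κ : Z' → PMF Z) (G : Game n Z) (G' : Game n Z') : Prop where
  hash : ∀ x, KernelHom κ (G.hash x) (G'.hash x)
  eval : ∀ p xs, KernelHom κ (G.eval p xs) (G'.eval p xs)
  update : ∀ zs, KernelHom κ (G.update zs) (G'.update zs)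

/-- The lists of received values are determined by the outputs, hence common to both sides; the
kernel acts on the state of the game alone. -/
theorem Game.Hom.step {κ : Z' → PMF Z} {G : Game n Z} {G' : Game n Z'} (h : Game.Hom κ G G')
    (σ : Party) (q : Val) :
    KernelHom (fun s : Z' × (Party → List (Block n)) => (κ s.1).map fun z => (z, s.2))
      (G.step σ · q) (G'.step σ · q) := by
  rintro ⟨z', r⟩
  rw [PMF.bind_map]
  simp only [Game.step, Function.comp_def]
  match Query.decode n q with
  | .hash x =>
    have := congrArg (PMF.map fun o => (Val.ofBlock o.1, (o.2, r))) (h.hash x z')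
    simpa [PMF.map_bind, PMF.bind_map, PMF.map_comp, Function.comp_def] using this
  | .eval p xs =>
    have := congrArg (PMF.map fun o =>
      (reply o.1.2 (Val.ofBlocks (if σ = p then o.1.1 else o.1.2)),
        (o.2, addReceived r p.other o.1.2))) (h.eval p xs z')
    simpa [PMF.map_bind, PMF.bind_map, PMF.map_comp, Function.comp_def] using this
  | .update p zs =>
    by_cases hz : ∀ z ∈ zs, z ∈ r p
    · have := congrArg (PMF.map fun o =>
        (reply o.1 (Val.ofBlocks (if σ = p then o.1 else [])), (o.2, r))) (h.update zs z')
      simpa only [if_pos hz, PMF.map_bind, PMF.bind_map, PMF.map_comp, Function.comp_def] using this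
    · simp only [if_neg hz, PMF.pure_bind, PMF.map_comp, Function.comp_def]
      rfl

/-- The output of an environment. -/
def Game.out {α : Type} (σ : Party) (G : Game n Z) (x : Comp α) (z : Z) : PMF α :=
  (x.run (G.step σ) (z, fun _ => [])).map Prod.fst

theorem Game.Hom.out {α : Type} {κ : Z' → PMF Z} {G : Game n Z} {G' : Game n Z'}
    (h : Game.Hom κ G G') (σ : Party) (x : Comp α) (z' : Z') :
    (κ z').bind (fun z => G.out σ x z) = G'.out σ x z' := by
  have := (KernelHom.run (h.step σ) x).map_fst_eq (z', fun _ => [])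
  rw [PMF.bind_map] at this
  exact this

/-- The evaluation in two steps: hash values first. -/
def evalVia (Q : List Bool → Z → PMF (Block n × Z)) (F : Block n → Z → PMF (Block n × Z))
    (xs : List (List Bool)) (z : Z) : PMF ((List (Block n) × List (Block n)) × Z) :=
  (mapAcc Q xs z).bind fun o => (mapAcc F o.1 o.2).map fun o' => ((o.1, o'.1), o'.2)

/-- The game in which values are computed from a hash function and two keyed functions. -/
def hashGame (Q : List Bool → Z → PMF (Block n × Z)) (F F' : Block n → Z → PMF (Block n × Z)) :
    Game n Z where
  hash := Q
  eval _ := evalVia Q F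
  update := mapAcc F'

theorem hashGame_hom {κ : Z' → PMF Z} {Q F F'} {Q₁ F₁ F₁'} (hQ : ∀ x, KernelHom κ (Q x) (Q₁ x))
    (hF : ∀ y, KernelHom κ (F y) (F₁ y)) (hF' : ∀ y, KernelHom κ (F' y) (F₁' y)) :
    Game.Hom (n := n) κ (hashGame Q F F') (hashGame Q₁ F₁ F₁') where
  hash := hQ
  eval _ xs := (KernelHom.mapAcc hQ xs).bind fun hs =>
    (KernelHom.mapAcc hF hs).map fun ys => (hs, ys)
  update := KernelHom.mapAcc hF'

end Game

/-! ## Lazy sampling -/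

section Lazy

variable {β Z W : Type} {n : ℕ}

theorem lookup_snoc {T : Table n} {x : List Bool} (hx : T.lookup x = none) (b : Block n) :
    (fun y => (T ++ [(x, b)]).lookup y) =
      Function.update (fun y => T.lookup y) x (some b) := by
  funext y
  rw [List.lookup_append]
  by_cases h : y = x
  · subst h; simp [hx]
  · rw [Function.update_of_ne h]
    have : (y == x) = false := by simpa using h
    simp [List.lookup_cons, this]

/-- A uniformly random function with some values fixed. -/
def fill (T : Table n) : PMF (Block n → Block n) :=
  (PMF.uniformOfFintype (Block n → Block n)).map fun f y => (T.lookup (List.ofFn y)).getD (f y)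

theorem map_uniformOfFintype_equiv {α β : Type} [Fintype α] [Nonempty α] [Fintype β] [Nonempty β]
    (e : α ≃ β) : (PMF.uniformOfFintype α).map e = PMF.uniformOfFintype β := by
  ext b
  rw [PMF.map_apply, tsum_eq_single (e.symm b)]
  · simp [Fintype.card_congr e]
  · intro a ha
    rw [if_neg]
    rintro rfl
    simp at ha

theorem uniformOfFintype_prod {α β : Type} [Fintype α] [Nonempty α] [Fintype β] [Nonempty β] :
    PMF.uniformOfFintype (α × β) =
      (PMF.uniformOfFintype α).bind fun a => (PMF.uniformOfFintype β).map (Prod.mk a) := by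
  ext ⟨a, b⟩
  rw [PMF.bind_apply, tsum_eq_single a]
  · rw [PMF.map_apply, tsum_eq_single b]
    · simp only [PMF.uniformOfFintype_apply, if_true, Fintype.card_prod, Nat.cast_mul]
      rw [ENNReal.mul_inv] <;> simp
    · intro b' hb; rw [if_neg]; simpa using hb.symm
  · intro a' ha
    rw [(PMF.apply_eq_zero_iff (PMF.map (Prod.mk a') _) _).2, mul_zero]
    simp only [PMF.mem_support_map_iff, Prod.mk.injEq]
    rintro ⟨_, _, h, _⟩
    exact ha h

/-- A value of a random function is uniform and independent of the other values. -/
theorem uniform_fun_update {α β : Type} [Fintype α] [DecidableEq α] [Fintype β] [Nonempty β] (a : α) :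
    (PMF.uniformOfFintype β).bind (fun b =>
      (PMF.uniformOfFintype (α → β)).map fun f => (b, Function.update f a b)) =
    (PMF.uniformOfFintype (α → β)).map fun f => (f a, f) := by
  rw [← map_uniformOfFintype_equiv (Equiv.funSplitAt a β).symm, uniformOfFintype_prod]
  simp only [PMF.map_bind, PMF.map_comp, Function.comp_def]
  have h1 : ∀ (b c : β) (g : { j // j ≠ a } → β),
      Function.update ((Equiv.funSplitAt a β).symm (b, g)) a c =
        (Equiv.funSplitAt a β).symm (c, g) := by
    intro b c g
    funext i
    by_cases hi : i = a
    · subst hi; simp [Equiv.funSplitAt, Equiv.piSplitAt]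
    · simp [Equiv.funSplitAt, Equiv.piSplitAt, hi]
  have h2 : ∀ (b : β) (g : { j // j ≠ a } → β), (Equiv.funSplitAt a β).symm (b, g) a = b := by
    intro b g
    simp [Equiv.funSplitAt, Equiv.piSplitAt]
  simp only [h1, h2, PMF.bind_const]

/-- Deferred decisions: at an unsampled point the value of a random completion is uniform and
independent of all others (`uniform_fun_update`), so it may be revealed first and the rest completed
afterwards. -/
theorem fill_query (T : Table n) (y : Block n) :
    (fill T).map (fun f => (f y, f)) =
      (T.query (List.ofFn y)).bind fun o => (fill o.2).map fun f => (o.1, f) := by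
  unfold Table.query
  rcases hT : T.lookup (List.ofFn y) with _ | b
  · simp only [fill, PMF.map_comp, PMF.bind_bind, PMF.pure_bind, Function.comp_def, hT]
    have h := congrArg (PMF.map fun o : Block n × (Block n → Block n) =>
      (o.1, fun z => if z = y then o.1 else (T.lookup (List.ofFn z)).getD (o.2 z)))
      (uniform_fun_update (α := Block n) (β := Block n) y)
    simp only [PMF.map_bind, PMF.map_comp, Function.comp_def] at h
    have e1 : ∀ f : Block n → Block n,
        (fun z => if z = y then f y else (T.lookup (List.ofFn z)).getD (f z)) =
          fun z => (T.lookup (List.ofFn z)).getD (f z) := by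
      intro f
      funext z
      by_cases hz : z = y
      · subst hz; simp [hT]
      · simp [hz]
    simp only [e1, Option.getD_none] at h ⊢
    rw [← h]
    refine congrArg _ (funext fun b => congrArg (PMF.map · _) (funext fun f => ?_))
    have e2 : ∀ z : Block n, (T ++ [(List.ofFn y, b)]).lookup (List.ofFn z) =
        Function.update (fun y => T.lookup y) (List.ofFn y) (some b) (List.ofFn z) :=
      fun z => congrFun (lookup_snoc hT b) _
    simp only [e2]
    refine congrArg _ (funext fun z => ?_)
    by_cases hz : z = y
    · subst hz; simp
    · rw [Function.update_of_ne (fun h => hz (List.ofFn_injective h))]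
      simp [hz, Function.update_of_ne hz]
  · simp only [fill, PMF.map_comp, PMF.pure_bind, Function.comp_def, hT, Option.getD_some]

/-- Evaluation of a function that is part of the state. -/
def eagerFn (y : Block n) (s : Z × (Block n → Block n)) :
    PMF (Block n × (Z × (Block n → Block n))) := .pure (s.2 y, s)

/-- Evaluation of a lazily sampled function, whose arguments are blocks. -/
def lazyFn (y : Block n) (s : Z × Table n) : PMF (Block n × (Z × Table n)) :=
  (s.2.query (List.ofFn y)).map fun o => (o.1, (s.1, o.2))

/-- Completion of a lazily sampled function. -/
def fillSnd (s : Z × Table n) : PMF (Z × (Block n → Block n)) := (fill s.2).map (Prod.mk s.1)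

theorem kernelHom_lazyFn (y : Block n) :
    KernelHom (fillSnd (Z := Z)) (eagerFn y) (lazyFn y) := by
  rintro ⟨z, T⟩
  have := congrArg (PMF.map fun o => (o.1, (z, o.2))) (fill_query T y)
  simpa [fillSnd, lazyFn, eagerFn, PMF.map_bind, PMF.bind_map, PMF.map_comp, Function.comp_def,
    PMF.map] using this

/-- The completion of the table and the action of `F` on the other component are independent, so
they commute. -/
theorem kernelHom_liftFst (F : Z → PMF (β × Z)) :
    KernelHom (fillSnd (n := n)) (liftFst F) (liftFst F) := by
  rintro ⟨z, T⟩
  simp only [fillSnd, liftFst, PMF.bind_map, PMF.map_comp, Function.comp_def]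
  simp only [PMF.map, Function.comp_def]
  rw [PMF.bind_comm]

/-- A function in the state never changes and may be treated as a parameter. -/
theorem kernelHom_fix_eagerFn (f : Block n → Block n) (y : Block n) :
    KernelHom (fun z : Z => .pure (z, f)) (eagerFn y) fun z => .pure (f y, z) := by
  rw [kernelHom_pure_iff]
  intro z
  simp [eagerFn, PMF.pure_map]

theorem kernelHom_fix_liftFst (f : Block n → Block n) (F : Z → PMF (β × Z)) :
    KernelHom (fun z : Z => .pure (z, f)) (liftFst F) F := by
  rw [kernelHom_pure_iff]
  intro z
  simp [liftFst]

@[simp] theorem fill_nil : fill (n := n) [] = PMF.uniformOfFintype _ := by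
  simp [fill, map_id']

end Lazy

/-! ## Approximate couplings -/

/-- The expected value. -/
def expect {α : Type} (p : PMF α) (f : α → ℝ≥0∞) : ℝ≥0∞ := ∑' a, p a * f a

theorem expect_pure {α : Type} (a : α) (f : α → ℝ≥0∞) : expect (.pure a) f = f a := by
  rw [expect, tsum_eq_single a]
  · simp
  · intro b hb; simp [hb]

theorem expect_bind {α β : Type} (p : PMF α) (k : α → PMF β) (f : β → ℝ≥0∞) :
    expect (p.bind k) f = expect p fun a => expect (k a) f := by
  simp only [expect, PMF.bind_apply, ← ENNReal.tsum_mul_right, ← ENNReal.tsum_mul_left, mul_assoc]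
  exact ENNReal.tsum_comm

theorem expect_mono {α : Type} (p : PMF α) {f g : α → ℝ≥0∞} (h : ∀ a, f a ≤ g a) :
    expect p f ≤ expect p g :=
  ENNReal.tsum_le_tsum fun a => mul_le_mul_right (h a) _

theorem expect_const {α : Type} (p : PMF α) (c : ℝ≥0∞) : expect p (fun _ => c) = c := by
  simp [expect, ENNReal.tsum_mul_right]

theorem expect_add {α : Type} (p : PMF α) (f g : α → ℝ≥0∞) :
    expect p (fun a => f a + g a) = expect p f + expect p g := by
  simp [expect, mul_add, ENNReal.tsum_add]

/-- The two distributions can be coupled such that `R` fails with probability at most `ε`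
(expressed by the inequality for expected values that this gives). -/
def Close {α β : Type} (R : α → β → Prop) (ε : ℝ≥0∞) (p : PMF α) (q : PMF β) : Prop :=
  ∀ (f : α → ℝ≥0∞) (g : β → ℝ≥0∞), (∀ a, f a ≤ 1) → (∀ a b, R a b → f a ≤ g b) →
    expect p f ≤ expect q g + ε

namespace Close

variable {α β α' β' : Type} {R : α → β → Prop} {R' : α' → β' → Prop} {ε δ : ℝ≥0∞}

theorem pure {a : α} {b : β} (h : R a b) : Close R 0 (.pure a) (.pure b) := by
  intro f g _ hfg
  simpa [expect_pure] using hfg a b h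

theorem mono {R₁ : α → β → Prop} {p : PMF α} {q : PMF β} (h : Close R ε p q)
    (hR : ∀ a b, R a b → R₁ a b) (hε : ε ≤ δ) : Close R₁ δ p q := fun f g hf hfg =>
  (h f g hf fun a b hab => hfg a b (hR a b hab)).trans (by gcongr)

/-- The expectations under the continuations are admissible test functions for the outer pair, once
`δ` is added on the right. Only the left one has to stay below `1`. Errors add without any coupling
being constructed. -/
theorem bind {p : PMF α} {q : PMF β} {k : α → PMF α'} {k' : β → PMF β'} (h : Close R ε p q)
    (hk : ∀ a b, R a b → Close R' δ (k a) (k' b)) : Close R' (ε + δ) (p.bind k) (q.bind k') := by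
  intro f g hf hfg
  rw [expect_bind, expect_bind]
  have h1 : ∀ a, expect (k a) f ≤ 1 := fun a =>
    (expect_mono _ hf).trans (expect_const _ 1).le
  refine (h (fun a => expect (k a) f) (fun b => expect (k' b) g + δ) h1
    fun a b hab => hk a b hab f g hf hfg).trans ?_
  rw [expect_add, expect_const, add_assoc, add_comm δ]

theorem map {p : PMF α} {q : PMF β} {φ : α → α'} {ψ : β → β'} (h : Close R ε p q)
    (hR : ∀ a b, R a b → R' (φ a) (ψ b)) : Close R' ε (p.map φ) (q.map ψ) := by
  simpa [PMF.map, Function.comp_def] using h.bind (δ := 0) (k := fun a => .pure (φ a)) (k' := fun b => .pure (ψ b))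
    fun a b hab => Close.pure (hR a b hab)

theorem refl (p : PMF α) : Close Eq 0 p p := by
  intro f g _ hfg
  simpa using expect_mono p fun a => hfg a a rfl

/-- Couple each outcome with itself and give up on `B`, where the left test function is still at
most `1`. -/
theorem uniform [Fintype α] [Nonempty α] (B : Finset α) :
    Close (fun a b => a = b ∧ a ∉ B) (B.card * (Fintype.card α : ℝ≥0∞)⁻¹)
      (PMF.uniformOfFintype α) (PMF.uniformOfFintype α) := by
  classical
  intro f g hf hfg
  have h1 : ∀ a, f a ≤ g a + if a ∈ B then 1 else 0 := by
    intro a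
    split_ifs with h
    · exact (hf a).trans le_add_self
    · simpa using hfg a a ⟨rfl, h⟩
  refine (expect_mono _ h1).trans ?_
  rw [expect_add]
  gcongr
  simp [expect, tsum_fintype]

theorem apply_le {p q : PMF Bool} (h : Close Eq ε p q) (b : Bool) : p b ≤ q b + ε := by
  have := h (fun a => if a = b then 1 else 0) (fun a => if a = b then 1 else 0)
    (fun a => by split_ifs <;> simp) (fun a c hac => by rw [hac])
  simpa [expect, tsum_fintype] using this

/-- Although `Close` is one-sided, its bounds at `true` and at `false` give both directions, because
the two probabilities sum to `1`. -/
theorem abs_sub_le {p q : PMF Bool} (h : Close Eq ε p q) (hε : ε ≠ ∞) :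
    |(p true).toReal - (q true).toReal| ≤ ε.toReal := by
  have sum_eq : ∀ r : PMF Bool, (r true).toReal + (r false).toReal = 1 := fun r => by
    have := r.tsum_coe
    rw [tsum_fintype, Fintype.sum_bool] at this
    rw [← ENNReal.toReal_add (r.apply_ne_top _) (r.apply_ne_top _), this, ENNReal.toReal_one]
  have le : ∀ b, (p b).toReal ≤ (q b).toReal + ε.toReal := fun b => by
    rw [← ENNReal.toReal_add (q.apply_ne_top _) hε]
    exact ENNReal.toReal_mono (ENNReal.add_ne_top.2 ⟨q.apply_ne_top _, hε⟩) (h.apply_le b)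
  have h1 := le true
  have h2 := le false
  have h3 := sum_eq p
  have h4 := sum_eq q
  rw [abs_le]
  constructor <;> linarith

end Close

/-! ## Bounds for the total length of queries -/

namespace Comp

/-- The total size of all queries is at most `N`. -/
def Budget {α : Type} (ok : Val → Val → Prop) : Comp α → ℕ → Prop
  | .pure _, _ => True
  | .coin k, N => ∀ b, (k b).Budget ok N
  | .call q k, N => q.size ≤ N ∧ ∀ r, ok q r → (k r).Budget ok (N - q.size)

theorem Budget.mono {α : Type} {ok : Val → Val → Prop} {x : Comp α} {N N' : ℕ}
    (h : x.Budget ok N) (hN : N ≤ N') : x.Budget ok N' := by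
  induction x generalizing N N' with
  | pure a => trivial
  | coin k ih => exact fun b => ih b (h b) hN
  | call q k ih => exact ⟨h.1.trans hN, fun r hr => ih r (h.2 r hr) (Nat.sub_le_sub_right hN _)⟩

end Comp

theorem Cmd.time_le (c : Cmd) (ok : Val → Val → Prop) (p : Store × ℕ) :
    (c.exec p).All ok fun o => p.2 ≤ o.2 := by
  induction c generalizing p with
  | assign r e => simp [exec, Comp.All]; omega
  | coin r => simp [exec, Comp.All]
  | call r e => intro v _; simp [Comp.All]; omega
  | seq c d ihc ihd =>
    simp only [exec, Comp.all_bind]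
    exact (ihc p).mono fun o ho => (ihd o).mono fun o' ho' => ho.trans ho'
  | ite r c d ihc ihd =>
    simp only [exec]
    split_ifs
    · exact (ihd _).mono fun o ho => (Nat.le_succ _).trans ho
    · exact (ihc _).mono fun o ho => (Nat.le_succ _).trans ho
  | loop r c ih =>
    simp only [exec]
    have : ∀ (k : ℕ) (q : Store × ℕ), (iter (fun q => c.exec (q.1, q.2 + 1)) k q).All ok
        fun o => q.2 ≤ o.2 := by
      intro k
      induction k with
      | zero => exact fun q => le_rfl
      | succ k ihk =>
        intro q
        simp only [iter, Comp.all_bind]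
        exact (ih _).mono fun o ho => (ihk o).mono fun o' ho' =>
          (Nat.le_succ _).trans (ho.trans ho')
    exact (this _ _).mono fun o ho => (Nat.le_succ _).trans ho

/-- A program that respects a time bound `B` does so in the rest of a run. -/
theorem Comp.budget_bind_exec {α : Type} {ok : Val → Val → Prop} (hok : ∀ q, ∃ r, ok q r) {B : ℕ}
    (c : Cmd) (p : Store × ℕ) (k : Store × ℕ → Comp α)
    (hB : (c.exec p).All ok fun o => o.2 ≤ B)
    (hk : (c.exec p).All ok fun o => (k o).Budget ok (B - o.2)) :
    ((c.exec p).bind k).Budget ok (B - p.2) := by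
  induction c generalizing p k with
  | assign r e => exact Budget.mono hk (by simp only; omega)
  | coin r => exact fun b => Budget.mono (hk b) (by simp only; omega)
  | call r e =>
    -- Some admissible reply exists, and with it the time after the call is at most `B`; so the
    -- query fits into the remaining budget.
    obtain ⟨v, hv⟩ := hok (e.eval p.1)
    have h1 := hB v hv
    have h2 := e.size_eval_le_cost p.1
    simp only [All] at h1
    refine ⟨by omega, fun v hv => Budget.mono (hk v hv) (by simp only; omega)⟩
  | seq c d ihc ihd =>
    simp only [Cmd.exec, all_bind, bind_assoc] at hB hk ⊢
    refine ihc p _ ?_ ?_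
    · exact hB.mono fun o ho => by
        obtain ⟨o', h1, h2⟩ := (ho.and (d.time_le ok o)).exists hok
        exact h2.trans h1
    · exact (hB.and hk).mono fun o ho => ihd o k ho.1 ho.2
  | ite r c d ihc ihd =>
    simp only [Cmd.exec] at hB hk ⊢
    split_ifs at hB hk ⊢
    · exact (ihd _ k hB hk).mono (by simp only; omega)
    · exact (ihc _ k hB hk).mono (by simp only; omega)
  | loop r c ih =>
    simp only [Cmd.exec] at hB hk ⊢
    -- The bound `q.2 ≤ B` is carried along because each pass needs it for the time at which the
    -- next pass starts.
    have : ∀ (j : ℕ) (q : Store × ℕ),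
        (iter (fun q => c.exec (q.1, q.2 + 1)) j q).All ok (fun o => o.2 ≤ B) →
        (iter (fun q => c.exec (q.1, q.2 + 1)) j q).All ok (fun o => (k o).Budget ok (B - o.2)) →
        ((iter (fun q => c.exec (q.1, q.2 + 1)) j q).bind k).Budget ok (B - q.2) ∧ q.2 ≤ B := by
      intro j
      induction j with
      | zero => exact fun q h h' => ⟨h', h⟩
      | succ j ihj =>
        intro q h h'
        simp only [iter, all_bind, bind_assoc] at h h' ⊢
        have h1 : (c.exec (q.1, q.2 + 1)).All ok fun o => o.2 ≤ B :=
          (h.and h').mono fun o ho => (ihj o ho.1 ho.2).2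
        refine ⟨(ih (q.1, q.2 + 1) _ h1 ?_).mono (by simp only; omega), ?_⟩
        · exact (h.and h').mono fun o ho => (ihj o ho.1 ho.2).1
        · obtain ⟨o, h2, h3⟩ := (h1.and (c.time_le ok _)).exists hok
          exact (Nat.le_succ _).trans (h3.trans h2)
    exact (this _ _ hB hk).1.mono (by simp only; omega)

/-- Every call is charged the full size of its query, so a time bound also limits the total length
of all queries, and with it the number of sampled values. -/
theorem Comp.budget_exec {ok : Val → Val → Prop} (hok : ∀ q, ∃ r, ok q r) {B : ℕ}
    {c : Cmd} {p : Store × ℕ} (hB : (c.exec p).All ok fun o => o.2 ≤ B) :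
    (c.exec p).Budget ok B := by
  have := budget_bind_exec hok c p .pure hB (all_of_forall _ fun _ => trivial)
  rw [bind_pure] at this
  exact this.mono (Nat.sub_le _ _)

/-- Two oracles that stay close to each other give close results. -/
theorem Close.run {α S S' : Type} {ok : Val → Val → Prop} {O : S → Val → PMF (Val × S)}
    {O' : S' → Val → PMF (Val × S')} {I : ℕ → S → S' → Prop} {c : ℝ≥0∞} {B : ℕ}
    (h : ∀ m s s' q, I m s s' → m + q.size ≤ B →
      Close (fun o o' => o.1 = o'.1 ∧ ok q o.1 ∧ I (m + q.size) o.2 o'.2) (q.size * c)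
        (O s q) (O' s' q))
    (x : Comp α) {N m : ℕ} (hx : x.Budget ok N) (hN : m + N ≤ B) {s : S} {s' : S'}
    (hs : I m s s') :
    Close (fun o o' => o.1 = o'.1) (N * c) (x.run O s) (x.run O' s') := by
  induction x generalizing N m s s' with
  | pure a => exact (Close.pure (R := fun o o' => o.1 = o'.1) rfl).mono (fun _ _ h => h) (by simp)
  | coin k ih =>
    have := (Close.refl (PMF.uniformOfFintype Bool)).bind (δ := N * c)
      (k := fun b => (k b).run O s) (k' := fun b => (k b).run O' s')
      (R' := fun o o' => o.1 = o'.1) fun a b hab => by subst hab; exact ih a (hx a) hN hs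
    rw [zero_add] at this
    exact this
  | call q k ih =>
    have := (h m s s' q hs (by have := hx.1; omega)).bind (δ := (N - q.size : ℕ) * c)
      (k := fun r => (k r.1).run O r.2) (k' := fun r => (k r.1).run O' r.2)
      (R' := fun o o' => o.1 = o'.1) fun a b hab => by
        rw [← hab.1]
        exact ih a.1 (hx.2 a.1 hab.2.1) (by have := hx.1; omega) hab.2.2
    refine this.mono (fun _ _ h => h) ?_
    rw [← add_mul, ← Nat.cast_add, Nat.add_sub_cancel' hx.1]

/-! ## Lazily sampled functions without an order of the entries -/

section

variable {n : ℕ}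

/-- The sampled part of a random function. -/
abbrev PartialFn (n : ℕ) : Type := List Bool → Option (Block n)

/-- The value at `x`, chosen uniformly at random if it has not been sampled. -/
def PartialFn.query (x : List Bool) (H : PartialFn n) : PMF (Block n × PartialFn n) :=
  match H x with
  | some b => .pure (b, H)
  | none => (PMF.uniformOfFintype (Block n)).map fun b => (b, Function.update H x (some b))

theorem PartialFn.query_of_some {x : List Bool} {H : PartialFn n} {b : Block n}
    (h : H x = some b) : H.query x = .pure (b, H) := by
  unfold query; rw [h]

theorem PartialFn.query_of_none {x : List Bool} {H : PartialFn n} (h : H x = none) :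
    H.query x = (PMF.uniformOfFintype (Block n)).map fun b => (b, Function.update H x (some b)) := by
  unfold query; rw [h]

/-- The partial function that is given by a table. -/
def Table.toPartialFn (T : Table n) : PartialFn n := fun x => T.lookup x

theorem Table.query_of_some {x : List Bool} {T : Table n} {b : Block n}
    (h : T.lookup x = some b) : T.query x = .pure (b, T) := by
  unfold query; rw [h]

theorem Table.query_of_none {x : List Bool} {T : Table n} (h : T.lookup x = none) :
    T.query x = (PMF.uniformOfFintype (Block n)).map fun b => (b, T ++ [(x, b)]) := by
  unfold query; rw [h]; rfl

/-- Replies depend only on the lookups in a table. Forgetting the order of entries makes executions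
comparable that sample in different orders. -/
theorem kernelHom_toPartialFn (x : List Bool) :
    KernelHom (fun T : Table n => .pure T.toPartialFn) (PartialFn.query x)
      fun T => T.query x := by
  rw [kernelHom_pure_iff]
  intro T
  rcases h : T.lookup x with _ | b
  · rw [Table.query_of_none h, PartialFn.query_of_none h, PMF.map_comp]
    refine congrArg (PMF.map · _) (funext fun b => ?_)
    simp only [Function.comp]
    exact congrArg _ (lookup_snoc h b).symm
  · rw [Table.query_of_some h, PartialFn.query_of_some h, PMF.pure_map]

/-- Values at distinct points are sampled independently, and a repeated point repeats its value. For
tables this would fail, since they record the order. -/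
theorem PartialFn.query_comm {β : Type} (x y : List Bool) (H : PartialFn n)
    (k : Block n → Block n → PartialFn n → PMF β) :
    ((H.query x).bind fun o => (o.2.query y).bind fun o' => k o.1 o'.1 o'.2) =
      (H.query y).bind fun o' => (o'.2.query x).bind fun o => k o.1 o'.1 o.2 := by
  by_cases hxy : x = y
  · subst hxy
    rcases h : H x with _ | b
    · rw [query_of_none h, PMF.bind_map, PMF.bind_map]
      refine congrArg _ (funext fun b => ?_)
      simp only [Function.comp]
      rw [query_of_some (b := b) (by simp), PMF.pure_bind, PMF.pure_bind]
    · rw [query_of_some h, PMF.pure_bind, PMF.pure_bind]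
      simp only
      rw [query_of_some h, PMF.pure_bind, PMF.pure_bind]
  · rcases hx : H x with _ | b <;> rcases hy : H y with _ | c
    · rw [query_of_none hx, query_of_none hy]
      simp only [PMF.bind_map, Function.comp_def]
      have h1 : ∀ b, (Function.update H x (some b)) y = none := fun b => by
        rw [Function.update_of_ne (Ne.symm hxy), hy]
      have h2 : ∀ b, (Function.update H y (some b)) x = none := fun b => by
        rw [Function.update_of_ne hxy, hx]
      simp only [query_of_none (h1 _), query_of_none (h2 _), PMF.bind_map, Function.comp_def]
      rw [PMF.bind_comm]
      simp only [Function.update_comm hxy]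
    · rw [query_of_none hx, query_of_some hy]
      simp only [PMF.bind_map, Function.comp_def, PMF.pure_bind]
      have h1 : ∀ b, (Function.update H x (some b)) y = some c := fun b => by
        rw [Function.update_of_ne (Ne.symm hxy), hy]
      simp only [query_of_some (h1 _), PMF.pure_bind, query_of_none hx, PMF.bind_map,
        Function.comp_def]
    · rw [query_of_some hx, query_of_none hy]
      simp only [PMF.bind_map, Function.comp_def, PMF.pure_bind]
      have h1 : ∀ b, (Function.update H y (some b)) x = some _ := fun _ => by
        rw [Function.update_of_ne hxy, hx]
      simp only [query_of_some (h1 _), PMF.pure_bind, query_of_none hy, PMF.bind_map,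
        Function.comp_def]
    · rw [query_of_some hx, query_of_some hy]
      simp only [PMF.pure_bind]
      rw [query_of_some hx, query_of_some hy]
      simp only [PMF.pure_bind]

theorem PartialFn.query_mapAcc_comm {β : Type} (x : List Bool) (P : List (List Bool))
    (H : PartialFn n) (k : Block n → List (Block n) → PartialFn n → PMF β) :
    ((mapAcc query P H).bind fun o => (o.2.query x).bind fun o' => k o'.1 o.1 o'.2) =
      (H.query x).bind fun o' => (mapAcc query P o'.2).bind fun o => k o'.1 o.1 o.2 := by
  induction P generalizing H k with
  | nil => simp [mapAcc]
  | cons y P ih =>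
    simp only [mapAcc, PMF.bind_bind, PMF.bind_map, Function.comp_def]
    rw [← query_comm y x H (fun b c H => (mapAcc query P H).bind fun a => k c (b :: a.1) a.2)]
    refine congrArg _ (funext fun o => ?_)
    exact ih o.2 fun b l H => k b (o.1 :: l) H

theorem PartialFn.mapAcc_comm {β : Type} (Q P : List (List Bool))
    (H : PartialFn n) (k : List (Block n) → List (Block n) → PartialFn n → PMF β) :
    ((mapAcc query P H).bind fun o => (mapAcc query Q o.2).bind fun o' => k o'.1 o.1 o'.2) =
      (mapAcc query Q H).bind fun o' => (mapAcc query P o'.2).bind fun o => k o'.1 o.1 o.2 := by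
  induction Q generalizing H k with
  | nil => simp [mapAcc]
  | cons y Q ih =>
    simp only [mapAcc, PMF.bind_bind, PMF.bind_map, Function.comp_def]
    rw [query_mapAcc_comm y P H fun b l H => (mapAcc query Q H).bind fun a => k (b :: a.1) l a.2]
    refine congrArg _ (funext fun o => ?_)
    exact ih o.2 fun l l' H => k (o.1 :: l) l' H

/-! ## The ideal execution as a game -/

/-- The ideal game over a random oracle `Q`. Only if the sender is corrupted, the inputs of an
evaluation are hashed. -/
def idealGame {Y : Type} (σ : Party) (Q : List Bool → Y → PMF (Block n × Y)) :
    Game n (Y × FuncState n) where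
  hash x := liftFst (Q x)
  eval p xs s := (if σ = p then mapAcc Q xs s.1 else .pure ([], s.1)).bind fun o =>
    (s.2.eval 0 xs).map fun o' => ((o.1, o'.1), (o.2, o'.2))
  update zs s := (FuncState.update 0 1 zs s.2).map fun o => (o.1, (s.1, o.2))

theorem idealGame_hom {Y Y' : Type} (σ : Party) {Q : List Bool → Y → PMF (Block n × Y)}
    {Q' : List Bool → Y' → PMF (Block n × Y')} {π : Y' → Y}
    (h : ∀ x, KernelHom (fun y => .pure (π y)) (Q x) (Q' x)) :
    Game.Hom (fun s : Y' × FuncState n => .pure (π s.1, s.2)) (idealGame σ Q) (idealGame σ Q') where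
  hash x := by
    rw [kernelHom_pure_iff]
    rintro ⟨y, F⟩
    have := (kernelHom_pure_iff.1 (h x)) y
    simp [idealGame, liftFst, this, PMF.map_comp, Function.comp_def]
  eval p xs := by
    rw [kernelHom_pure_iff]
    rintro ⟨y, F⟩
    have := (kernelHom_pure_iff.1 (KernelHom.mapAcc h xs)) y
    simp only [idealGame]
    split_ifs
    · simp [this, PMF.map_bind, PMF.bind_map, PMF.map_comp, Function.comp_def]
    · simp [PMF.map_comp, Function.comp_def]
  update zs := by
    rw [kernelHom_pure_iff]
    rintro ⟨y, F⟩
    simp [idealGame, PMF.map_comp, Function.comp_def]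

/-- The ideal game in which the inputs of every evaluation are hashed. -/
def hashedIdealGame (n : ℕ) (σ : Party) : Game n (PartialFn n × FuncState n) where
  hash x := liftFst (PartialFn.query x)
  eval p xs s := (mapAcc PartialFn.query xs s.1).bind fun o =>
    (s.2.eval 0 xs).map fun o' => ((if σ = p then o.1 else [], o'.1), (o.2, o'.2))
  update zs s := (FuncState.update 0 1 zs s.2).map fun o => (o.1, (s.1, o.2))

/-- The ideal game with a list of inputs of which the hash values are not needed. -/
def pendingIdealGame (n : ℕ) (σ : Party) :
    Game n ((PartialFn n × FuncState n) × List (List Bool)) where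
  hash x := liftFst ((idealGame σ PartialFn.query).hash x)
  eval p xs s := ((idealGame σ PartialFn.query).eval p xs s.1).map fun o =>
    (o.1, (o.2, if σ = p then s.2 else s.2 ++ xs))
  update zs := liftFst ((idealGame σ PartialFn.query).update zs)

/-- The pending list is only written to and never influences a reply. -/
theorem pendingIdealGame_forget (σ : Party) :
    Game.Hom (fun s => .pure s.1) (idealGame σ PartialFn.query) (pendingIdealGame n σ) where
  hash x := by
    rw [kernelHom_pure_iff]; intro s
    simp [pendingIdealGame, liftFst, PMF.map_comp, Function.comp_def, map_id']
  eval p xs := by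
    rw [kernelHom_pure_iff]; intro s
    simp [pendingIdealGame, PMF.map_comp, Function.comp_def, map_id']
  update zs := by
    rw [kernelHom_pure_iff]; intro s
    simp [pendingIdealGame, liftFst, PMF.map_comp, Function.comp_def, map_id']

/-- Hash values that nobody has seen can be sampled after any further request just as well as before
it, by commutation of queries. This adds the hashing by an honest sender, which the ideal execution
lacks. -/
theorem pendingIdealGame_hash (σ : Party) :
    Game.Hom (fun s => (mapAcc PartialFn.query s.2 s.1.1).map fun o => (o.2, s.1.2))
      (hashedIdealGame n σ) (pendingIdealGame n σ) where
  hash x := by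
    rintro ⟨⟨H, F⟩, P⟩
    have := PartialFn.query_mapAcc_comm x P H fun b _ H => .pure (b, (H, F))
    simpa [hashedIdealGame, pendingIdealGame, idealGame, liftFst, PMF.bind_map, PMF.map_comp,
      Function.comp_def, PMF.map] using this
  eval p xs := by
    rintro ⟨⟨H, F⟩, P⟩
    simp only [hashedIdealGame, pendingIdealGame, idealGame]
    by_cases h : σ = p
    · have := PartialFn.mapAcc_comm xs P H fun l _ H' =>
        (F.eval 0 xs).map fun o' => ((l, o'.1), (H', o'.2))
      simp only [if_pos h, PMF.bind_map, PMF.map_bind, PMF.bind_bind, PMF.map_comp,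
        Function.comp_def] at this ⊢
      rw [this]
      refine congrArg _ (funext fun o => ?_)
      simp only [PMF.map, Function.comp_def]
      rw [PMF.bind_comm]
    · simp only [if_neg h, PMF.bind_map, PMF.map_bind, PMF.map_comp,
        Function.comp_def, PMF.pure_bind, mapAcc_append]
      simp only [PMF.map, Function.comp_def]
      rw [PMF.bind_comm]
      refine congrArg _ (funext fun o => ?_)
      exact PMF.bind_comm _ _ _
  update zs := by
    rintro ⟨⟨H, F⟩, P⟩
    simp only [hashedIdealGame, pendingIdealGame, idealGame, liftFst, PMF.bind_map, PMF.map_comp,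
      Function.comp_def]
    simp only [PMF.map, Function.comp_def]
    rw [PMF.bind_comm]

end

section

variable {n : ℕ}

/-! ## Composition of lazily sampled functions -/

open Classical in
/-- The values that have been sampled. -/
def PartialFn.values (A : PartialFn n) : Finset (Block n) :=
  Finset.univ.filter fun h => ∃ x, A x = some h

theorem PartialFn.mem_values {A : PartialFn n} {h : Block n} :
    h ∈ A.values ↔ ∃ x, A x = some h := by simp [values]

/-- The function `A` is injective with at most `a` values, and `R ∘ A = C`. -/
structure Factors (A R C : PartialFn n) (a : ℕ) : Prop where
  inj : ∀ x x' h, A x = some h → A x' = some h → x = x'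
  card : A.values.card ≤ a
  comp : ∀ x h, A x = some h → R (List.ofFn h) = C x
  dom : ∀ x, A x = none → C x = none
  range : ∀ h, h ∉ A.values → R (List.ofFn h) = none

theorem Factors.mono {A R C : PartialFn n} {a a' : ℕ} (hf : Factors A R C a) (h : a ≤ a') :
    Factors A R C a' := { hf with card := hf.card.trans h }

/-- A value outside `A.values` preserves injectivity, and by `range` the function `R` is still
unsampled there, in agreement with `C` at `x`. -/
theorem Factors.extend {A R C : PartialFn n} {a : ℕ} (hf : Factors A R C a) {x : List Bool}
    {h : Block n} (hx : A x = none) (hh : h ∉ A.values) :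
    Factors (Function.update A x (some h)) R C (a + 1) := by
  have hne : ∀ x', A x' ≠ some h := fun x' hx' => hh (PartialFn.mem_values.2 ⟨x', hx'⟩)
  refine ⟨fun x₁ x₂ h' h₁ h₂ => ?_, ?_, fun x' h' hx' => ?_, fun x' hx' => ?_, fun h' hh' => ?_⟩
  · by_cases e₁ : x₁ = x <;> by_cases e₂ : x₂ = x
    · rw [e₁, e₂]
    · subst e₁
      rw [Function.update_self] at h₁
      rw [Function.update_of_ne e₂] at h₂
      exact absurd (h₂.trans h₁.symm) (hne _)
    · subst e₂
      rw [Function.update_self] at h₂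
      rw [Function.update_of_ne e₁] at h₁
      exact absurd (h₁.trans h₂.symm) (hne _)
    · rw [Function.update_of_ne e₁] at h₁
      rw [Function.update_of_ne e₂] at h₂
      exact hf.inj _ _ _ h₁ h₂
  · have : PartialFn.values (Function.update A x (some h)) ⊆ insert h A.values := by
      intro h' hh'
      obtain ⟨x', hx'⟩ := PartialFn.mem_values.1 hh'
      by_cases e : x' = x
      · subst e; rw [Function.update_self] at hx'; simp [Option.some.inj hx']
      · rw [Function.update_of_ne e] at hx'
        exact Finset.mem_insert_of_mem (PartialFn.mem_values.2 ⟨_, hx'⟩)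
    exact (Finset.card_le_card this).trans ((Finset.card_insert_le _ _).trans (by
      have := hf.card; omega))
  · by_cases e : x' = x
    · subst e
      rw [Function.update_self] at hx'
      rw [← Option.some.inj hx', hf.range h hh, hf.dom _ hx]
    · rw [Function.update_of_ne e] at hx'
      exact hf.comp _ _ hx'
  · by_cases e : x' = x
    · subst e; simp at hx'
    · rw [Function.update_of_ne e] at hx'
      exact hf.dom _ hx'
  · refine hf.range h' fun hmem => hh' ?_
    obtain ⟨x', hx'⟩ := PartialFn.mem_values.1 hmem
    refine PartialFn.mem_values.2 ⟨x', ?_⟩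
    rw [Function.update_of_ne, hx']
    rintro rfl
    simp [hx] at hx'

/-- By injectivity `h` is the image of `x` alone, so a change of `R` at `h` is felt by `R ∘ A` only
at `x`. -/
theorem Factors.set {A R C : PartialFn n} {a : ℕ} (hf : Factors A R C a) {x : List Bool}
    {h : Block n} (hx : A x = some h) (y : Option (Block n)) :
    Factors A (Function.update R (List.ofFn h) y) (Function.update C x y) a := by
  refine ⟨hf.inj, hf.card, fun x' h' hx' => ?_, fun x' hx' => ?_, fun h' hh' => ?_⟩
  · by_cases e : x' = x
    · subst e
      rw [hx] at hx'
      simp [Option.some.inj hx']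
    · rw [Function.update_of_ne e, Function.update_of_ne, hf.comp _ _ hx']
      intro e'
      rw [List.ofFn_injective e'] at hx'
      exact e (hf.inj _ _ _ hx' hx)
  · rw [Function.update_of_ne, hf.dom _ hx']
    rintro rfl
    simp [hx] at hx'
  · rw [Function.update_of_ne, hf.range _ hh']
    intro e'
    rw [List.ofFn_injective e'] at hh'
    exact hh' (PartialFn.mem_values.2 ⟨x, hx⟩)

/-! ## The two games -/

/-- A process on the second component of the state. -/
def liftSnd {Z W β : Type} (F : W → PMF (β × W)) (s : Z × W) : PMF (β × (Z × W)) :=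
  (F s.2).map fun o => (o.1, (s.1, o.2))

/-- The game with a random oracle and two more random functions, all of them sampled lazily. -/
def lazyGame (n : ℕ) : Game n ((PartialFn n × PartialFn n) × PartialFn n) :=
  hashGame (fun x => liftFst (liftFst (PartialFn.query x)))
    (fun y => liftFst (liftSnd (PartialFn.query (List.ofFn y))))
    (fun y => liftSnd (PartialFn.query (List.ofFn y)))

/-- A single evaluation by the functionality. -/
def FuncState.evalOne (x : List Bool) (F : FuncState n) : PMF (Block n × FuncState n) :=
  ((F.table 0).query x).map fun o =>
    (o.1, { F with table := Function.update F.table 0 o.2 })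

theorem FuncState.eval_eq (xs : List (List Bool)) (F : FuncState n) :
    F.eval 0 xs = mapAcc evalOne xs F := by
  induction xs generalizing F with
  | nil => simp [eval, Table.queryAll, mapAcc, PMF.pure_map]
  | cons x xs ih =>
    simp only [mapAcc, ← ih, evalOne, PMF.bind_map]
    simp only [eval, Table.queryAll, PMF.map_bind, Function.comp_def, Function.update_self,
      Function.update_idem, PMF.map_comp, PMF.pure_map]
    refine congrArg _ (funext fun o => ?_)
    simp [PMF.map, Function.comp_def]

theorem FuncState.update_eq (zs : List (Block n)) (F : FuncState n) :
    update 0 1 zs F = mapAcc (fun z F => F.updateOne 0 1 z) zs F := by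
  induction zs generalizing F with
  | nil => rfl
  | cons z zs ih => simp [update, mapAcc, ih, PMF.map, Function.comp_def]

/-- The states of the two games correspond to each other. -/
structure Matching (a b : ℕ) (s : ((PartialFn n × PartialFn n) × PartialFn n) ×
    (PartialFn n × FuncState n)) : Prop where
  hash : s.1.1.1 = s.2.1
  fst : Factors s.1.1.1 s.1.1.2 (s.2.2.table 0).toPartialFn a
  snd : Factors (s.2.2.table 0).toPartialFn s.1.2 (s.2.2.table 1).toPartialFn b
  lookup : ∀ e ∈ s.2.2.table 0, (s.2.2.table 0).toPartialFn e.1 = some e.2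

theorem Matching.mono {a b a' b' : ℕ} {s : ((PartialFn n × PartialFn n) × PartialFn n) ×
    (PartialFn n × FuncState n)} (h : Matching a b s) (ha : a ≤ a') (hb : b ≤ b') :
    Matching a' b' s := ⟨h.hash, h.fst.mono ha, h.snd.mono hb, h.lookup⟩

/-- The probability of a single block. -/
def blockProb (n : ℕ) : ℝ≥0∞ := (Fintype.card (Block n) : ℝ≥0∞)⁻¹

theorem close_uniform_of_card_le {β γ : Type} {S : Finset (Block n)} {B : ℕ} (hS : S.card ≤ B)
    {R : β → γ → Prop} {φ : Block n → β} {ψ : Block n → γ} (h : ∀ b ∉ S, R (φ b) (ψ b)) :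
    Close R (B * blockProb n) ((PMF.uniformOfFintype (Block n)).map φ)
      ((PMF.uniformOfFintype (Block n)).map ψ) := by
  refine ((Close.uniform S).map (R' := R) fun a b hab => ?_).mono (fun _ _ h => h) ?_
  · rw [← hab.1]; exact h a hab.2
  · unfold blockProb; gcongr

variable {H R₁ R₂ H' : PartialFn n} {F : FuncState n} {a b B : ℕ}

/-- The only bad event is that a fresh hash value equals one of at most `a` earlier ones. The
further clauses are what the rest of the same request needs: old hash values persist, the
functionality is untouched, and `x` has its hash value. -/
theorem close_hash (hM : Matching a b (((H, R₁), R₂), (H', F))) (ha : a ≤ B) (x : List Bool) :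
    Close (fun o o' => o.1 = o'.1 ∧ Matching (a + 1) b (o.2, o'.2) ∧
        ((∀ y h, H' y = some h → o'.2.1 y = some h) ∧ o'.2.2 = F) ∧ o'.2.1 x = some o'.1)
      (B * blockProb n) (liftFst (liftFst (PartialFn.query x)) ((H, R₁), R₂))
      (liftFst (PartialFn.query x) (H', F)) := by
  obtain rfl : H = H' := hM.hash
  simp only [liftFst, PMF.map_comp, Function.comp_def]
  rcases hx : H x with _ | h
  · simp only [PartialFn.query_of_none hx, PMF.map_comp, Function.comp_def]
    refine close_uniform_of_card_le (hM.fst.card.trans ha) fun h hh =>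
      ⟨rfl, ⟨rfl, hM.fst.extend hx hh, hM.snd, hM.lookup⟩, ⟨fun y h' hy => ?_, rfl⟩, by simp⟩
    dsimp only
    rw [Function.update_of_ne, hy]
    rintro rfl
    simp [hx] at hy
  · simp only [PartialFn.query_of_some hx, PMF.pure_map]
    exact (Close.pure ⟨rfl, hM.mono (by simp) le_rfl, ⟨fun _ _ h => h, rfl⟩, hx⟩).mono
      (fun _ _ h => h) (by simp)

/-- By `Factors.comp`, `R₁` is sampled at the hash value exactly when the functionality has an entry
for `x`, so both sides can use the same fresh block. It has to avoid the at most `b` earlier values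
in table `0`, so that a value still determines its input in later updates. -/
theorem close_eval (hM : Matching a b (((H, R₁), R₂), (H', F))) (hb : b ≤ B) {x : List Bool}
    {h : Block n} (hx : H' x = some h) :
    Close (fun o o' => o.1 = o'.1 ∧ Matching a (b + 1) (o.2, o'.2) ∧ (o'.2.1 = H' ∧
        ∀ y z, (F.table 0).toPartialFn y = some z → (o'.2.2.table 0).toPartialFn y = some z) ∧
        (o'.2.2.table 0).toPartialFn x = some o'.1)
      (B * blockProb n) (liftFst (liftSnd (PartialFn.query (List.ofFn h))) ((H, R₁), R₂))
      (liftSnd (FuncState.evalOne x) (H', F)) := by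
  obtain rfl : H = H' := hM.hash
  have hR := hM.fst.comp x h hx
  simp only [liftFst, liftSnd, FuncState.evalOne, PMF.map_comp, Function.comp_def]
  rcases hy : (F.table 0).lookup x with _ | y
  · have hy' : (F.table 0).toPartialFn x = none := hy
    rw [hy'] at hR
    have key : ∀ z, (F.table 0 ++ [(x, z)] : Table n).toPartialFn =
        Function.update (F.table 0).toPartialFn x (some z) := fun z => lookup_snoc hy z
    simp only [Table.query_of_none hy, PartialFn.query_of_none hR, PMF.map_comp, Function.comp_def]
    refine close_uniform_of_card_le (hM.snd.card.trans hb) fun z hz =>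
      ⟨rfl, ⟨rfl, ?_, ?_, ?_⟩, ⟨rfl, fun y w hw => ?_⟩, ?_⟩
    · simp only [Function.update_self, key]
      exact hM.fst.set hx _
    · simp only [Function.update_self, key]
      rw [Function.update_of_ne (by simp)]
      exact hM.snd.extend hy' hz
    · simp only [Function.update_self, key]
      intro e he
      rcases List.mem_append.1 he with he | he
      · rw [Function.update_of_ne, hM.lookup e he]
        intro h'
        have := hM.lookup e he
        simp [h', hy'] at this
      · simp only [List.mem_singleton] at he
        simp [he]
    · simp only [Function.update_self, key]
      rw [Function.update_of_ne, hw]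
      rintro rfl
      simp [hy'] at hw
    · simp [key]
  · have hy' : (F.table 0).toPartialFn x = some y := hy
    rw [hy'] at hR
    simp only [Table.query_of_some hy, PartialFn.query_of_some hR, PMF.pure_map,
      Function.update_eq_self]
    exact (Close.pure ⟨rfl, hM.mono le_rfl (by simp), ⟨rfl, fun _ _ h => h⟩, hy⟩).mono
      (fun _ _ h => h) (by simp)

/-- Table `0` is injective, so `z` belongs to a single input `x`, and `R₂` at `z` agrees with table
`1` at `x`. A new value is shared by both sides, and no fresh value enters an injective table; hence
the error is zero. -/
theorem close_update (hM : Matching a b (((H, R₁), R₂), (H', F))) {z : Block n}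
    (hz : ∃ x, (F.table 0).toPartialFn x = some z) :
    Close (fun o o' => o.1 = o'.1 ∧ Matching a b (o.2, o'.2) ∧ o'.2.2.table 0 = F.table 0 ∧ True)
      0 (liftSnd (PartialFn.query (List.ofFn z)) ((H, R₁), R₂))
      (liftSnd (fun F => F.updateOne 0 1 z) (H', F)) := by
  obtain ⟨x, hx⟩ := hz
  have hmem : (x, z) ∈ F.table 0 := by
    obtain ⟨l₁, l₂, h, -⟩ := List.lookup_eq_some_iff.1 hx
    rw [h]; simp
  -- The entry found has value `z`; by `Matching.lookup` its key really maps to `z`, and by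
  -- injectivity this key is `x`.
  have hfind : (F.table 0).find? (fun e => decide (e.2 = z)) = some (x, z) := by
    rcases h : (F.table 0).find? (fun e => decide (e.2 = z)) with _ | e
    · have := List.find?_eq_none.1 h _ hmem
      simp at this
    · have h1 := List.find?_some h
      have h2 := hM.lookup e (List.mem_of_find?_eq_some h)
      simp only [decide_eq_true_eq] at h1
      rw [h1] at h2
      rw [h, show e = (x, z) from Prod.ext (hM.snd.inj _ _ _ h2 hx) h1]
  have hR := hM.snd.comp x z hx
  simp only [liftSnd, FuncState.updateOne, hfind, PMF.map_comp, Function.comp_def]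
  rcases hy : (F.table 1).lookup x with _ | y
  · have hy' : (F.table 1).toPartialFn x = none := hy
    rw [hy'] at hR
    have key : ∀ z, (F.table 1 ++ [(x, z)] : Table n).toPartialFn =
        Function.update (F.table 1).toPartialFn x (some z) := fun z => lookup_snoc hy z
    simp only [PartialFn.query_of_none hR, PMF.map_comp, Function.comp_def]
    refine (Close.refl _).map fun w w' hw => ?_
    subst hw
    have h0 : Function.update F.table 1 (F.table 1 ++ [(x, w)]) 0 = F.table 0 :=
      Function.update_of_ne (by simp) _ _
    refine ⟨rfl, ⟨hM.hash, ?_, ?_, ?_⟩, h0, trivial⟩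
    · simp only [h0]; exact hM.fst
    · simp only [h0, Function.update_self, key]; exact hM.snd.set hx _
    · simp only [h0]; exact hM.lookup
  · have hy' : (F.table 1).toPartialFn x = some y := hy
    rw [hy'] at hR
    simp only [PartialFn.query_of_some hR, PMF.pure_map]
    -- The functionality samples a block even if the entry is filled; it is discarded.
    rw [map_const']
    exact Close.pure ⟨rfl, hM, rfl, trivial⟩

/-- Closeness of iterated calls. The relation `E` tells how states may change, `P` and `A` are
properties of the states that persist. -/
theorem Close.mapAcc {α α' β Z Z' : Type} {ε : ℝ≥0∞} {G : α → Z → PMF (β × Z)}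
    {G' : α' → Z' → PMF (β × Z')} {I : ℕ → Z × Z' → Prop} {E : Z' → Z' → Prop}
    {A : α → α' → Z' → Prop} {P : α' → β → Z' → Prop} {N : ℕ}
    (hrefl : ∀ s, E s s) (htrans : ∀ s s₁ s₂, E s s₁ → E s₁ s₂ → E s s₂)
    (hA : ∀ a a' s s', E s s' → A a a' s → A a a' s')
    (hP : ∀ a' b s s', E s s' → P a' b s → P a' b s')
    (h : ∀ i s s' a a', I i (s, s') → i < N → A a a' s' →
      Close (fun o o' => o.1 = o'.1 ∧ I (i + 1) (o.2, o'.2) ∧ E s' o'.2 ∧ P a' o'.1 o'.2) ε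
        (G a s) (G' a' s')) {l : List α} {l' : List α'} {i : ℕ} {s : Z} {s' : Z'}
    (hl : List.Forall₂ (fun a a' => A a a' s') l l') (hs : I i (s, s')) (hi : i + l.length ≤ N) :
    Close (fun o o' => o.1 = o'.1 ∧ I (i + l.length) (o.2, o'.2) ∧ E s' o'.2 ∧
      List.Forall₂ (fun a' b => P a' b o'.2) l' o'.1) (l.length * ε)
      (mapAcc G l s) (mapAcc G' l' s') := by
  induction l generalizing l' i s s' with
  | nil =>
    cases hl
    exact (Close.pure ⟨rfl, hs, hrefl _, .nil⟩).mono (fun _ _ h => h) (by simp)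
  | cons a l ih =>
    cases hl with
    | @cons _ a' _ l' ha hl =>
    simp only [List.length_cons] at hi
    refine ((h i s s' a a' hs (by omega) ha).bind (δ := l.length * ε) fun o o' ho => ?_).mono
      (fun _ _ h => h) ?_
    · obtain ⟨ho1, ho2, ho3, ho4⟩ := ho
      refine (ih (hl.imp fun _ _ hA' => hA _ _ _ _ ho3 hA') ho2 (by omega)).map
        fun r r' hr => ?_
      obtain ⟨hr1, hr2, hr3, hr4⟩ := hr
      refine ⟨by simp [ho1, hr1], ?_, htrans _ _ _ ho3 hr3, .cons (hP _ _ _ _ hr3 ho4) hr4⟩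
      rw [show i + (a :: l).length = i + 1 + l.length by simp; omega]
      exact hr2
    · simp only [List.length_cons, Nat.cast_add, Nat.cast_one, add_mul, one_mul]
      rw [add_comm]

end

/-! ### One request of an environment in the two games -/

section

variable {n : ℕ}

/-- The states of the two games with the values that the parties have received. -/
def Related (m : ℕ) (s : ((PartialFn n × PartialFn n) × PartialFn n) × (Party → List (Block n)))
    (s' : (PartialFn n × FuncState n) × (Party → List (Block n))) : Prop :=
  Matching m m (s.1, s'.1) ∧ s.2 = s'.2 ∧
    ∀ p, ∀ y ∈ s'.2 p, ∃ x, (s'.1.2.table 0).toPartialFn x = some y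

theorem length_le_size_of_decode_eval {q : Val} {p : Party} {xs : List (List Bool)}
    (h : Query.decode n q = .eval p xs) : xs.length ≤ q.size := by
  unfold Query.decode at h
  split at h
  · cases h
  · cases h
    rw [List.length_map]
    have := q.tl.tl.length_toList_lt
    have := q.tl.size_tl_le
    have := q.size_tl_le
    omega
  · cases h

theorem length_le_size_of_decode_update {q : Val} {p : Party} {zs : List (Block n)}
    (h : Query.decode n q = .update p zs) : zs.length ≤ q.size := by
  unfold Query.decode at h
  split at h
  · cases h
  · cases h
  · cases h
    rw [List.length_map]
    have := q.tl.tl.length_toList_lt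
    have := q.tl.size_tl_le
    have := q.size_tl_le
    omega

theorem mapAcc_liftFst {α β Z W : Type} (F : α → Z → PMF (β × Z)) (l : List α) (s : Z × W) :
    mapAcc (fun a => liftFst (F a)) l s = liftFst (mapAcc F l) s := by
  induction l generalizing s with
  | nil => simp [mapAcc, liftFst, PMF.pure_map]
  | cons a l ih =>
    simp [mapAcc, ih, liftFst, PMF.map_comp, PMF.bind_map, PMF.map_bind, Function.comp_def]

theorem mapAcc_liftSnd {α β Z W : Type} (F : α → W → PMF (β × W)) (l : List α) (s : Z × W) :
    mapAcc (fun a => liftSnd (F a)) l s = liftSnd (mapAcc F l) s := by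
  induction l generalizing s with
  | nil => simp [mapAcc, liftSnd, PMF.pure_map]
  | cons a l ih =>
    simp [mapAcc, ih, liftSnd, PMF.map_comp, PMF.bind_map, PMF.map_bind, Function.comp_def]

/-- In this form an evaluation consists of the same two passes as in `lazyGame`, which can be
compared entry by entry. -/
theorem hashedIdealGame_eval (σ p : Party) (xs : List (List Bool)) (s : PartialFn n × FuncState n) :
    (hashedIdealGame n σ).eval p xs s =
      (mapAcc (fun x => liftFst (PartialFn.query x)) xs s).bind fun o =>
        (mapAcc (fun x => liftSnd (FuncState.evalOne x)) xs o.2).map fun o' =>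
          ((if σ = p then o.1 else [], o'.1), o'.2) := by
  simp [hashedIdealGame, mapAcc_liftFst, mapAcc_liftSnd, FuncState.eval_eq, liftFst, liftSnd,
    PMF.map_comp, PMF.bind_map, Function.comp_def]

/-- An evaluation has at most `q.size` inputs, and each can fail once when it is hashed and once
when it is evaluated, which gives the factor `2`. The first pass raises only the number of hash
values, the second only that of entries in table `0`, so both counters stay below `B`. In an update
the check of received values puts every `z` into the range of table `0`. -/
theorem close_step (σ : Party) {B m : ℕ}
    {s : ((PartialFn n × PartialFn n) × PartialFn n) × (Party → List (Block n))}
    {s' : (PartialFn n × FuncState n) × (Party → List (Block n))} {q : Val}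
    (hs : Related m s s') (hm : m + q.size ≤ B) :
    Close (fun o o' => o.1 = o'.1 ∧ ReplyOk n q o.1 ∧ Related (m + q.size) o.2 o'.2)
      (q.size * (2 * (B * blockProb n))) ((lazyGame n).step σ s q)
      ((hashedIdealGame n σ).step σ s' q) := by
  obtain ⟨⟨⟨H, R₁⟩, R₂⟩, r⟩ := s
  obtain ⟨⟨H', F⟩, r'⟩ := s'
  obtain ⟨hM, rfl, hrec⟩ := hs
  have hsize := q.size_pos
  dsimp only at hM hrec
  simp only [Game.step, ReplyOk]
  rcases hq : Query.decode n q with x | ⟨p, xs⟩ | ⟨p, zs⟩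
  · dsimp only
    refine ((close_hash hM (show m ≤ B by omega) x).map fun o o' ho => ?_).mono
      (fun _ _ h => h) ?_
    · obtain ⟨h1, h2, ⟨h3, h4⟩, h5⟩ := ho
      refine ⟨by rw [h1], ⟨_, rfl⟩, h2.mono (by omega) (by omega), rfl, ?_⟩
      simp only [h4]
      exact hrec
    · calc (B : ℝ≥0∞) * blockProb n = 1 * (1 * (B * blockProb n)) := by simp
        _ ≤ q.size * (2 * (B * blockProb n)) := by
          gcongr
          · exact_mod_cast hsize
          · norm_num
  · dsimp only
    have hlen := length_le_size_of_decode_eval hq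
    have h1 : Close _ _
        (mapAcc (fun x => liftFst (liftFst (PartialFn.query x))) xs ((H, R₁), R₂))
        (mapAcc (fun x => liftFst (PartialFn.query x)) xs (H', F)) := Close.mapAcc
      (I := fun i s => Matching i m s)
      (E := fun s s₁ => (∀ y h, s.1 y = some h → s₁.1 y = some h) ∧ s₁.2 = s.2)
      (A := fun x x' _ => x = x') (P := fun x h s => s.1 x = some h) (N := B)
      (fun s => ⟨fun _ _ h => h, rfl⟩)
      (fun s s₁ s₂ h h' => ⟨fun y z hy => h'.1 y z (h.1 y z hy), h'.2.trans h.2⟩)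
      (fun _ _ _ _ _ h => h) (fun x h s s₁ hE hx => hE.1 x h hx)
      (fun i s s' x x' hI hi hx => by subst hx; exact close_hash hI hi.le x)
      (l := xs) (l' := xs) (i := m) (List.forall₂_same.2 fun _ _ => rfl) hM (by omega)
    change Close _ _ (PMF.map _ ((mapAcc (fun x => liftFst (liftFst (PartialFn.query x))) xs
      ((H, R₁), R₂)).bind _)) _
    rw [hashedIdealGame_eval, PMF.map_bind, PMF.map_bind]
    refine (h1.bind (δ := xs.length * (B * blockProb n)) fun o o' ho => ?_).mono
      (fun _ _ h => h) ?_
    · obtain ⟨hs, ⟨⟨A, A₁⟩, A₂⟩⟩ := o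
      obtain ⟨hs', ⟨A', F'⟩⟩ := o'
      obtain ⟨rfl, hM', ⟨-, hF⟩, hall⟩ := ho
      dsimp only at hM' hF hall ⊢
      subst hF
      have hlen' : xs.length = hs.length := hall.length_eq
      -- The second pass runs over hash values on one side and inputs on the other. `A` says that
      -- they belong together, which persists because this pass leaves the random oracle alone.
      have h2 : Close _ _
          (mapAcc (fun y => liftFst (liftSnd (PartialFn.query (List.ofFn y)))) hs ((A, A₁), A₂))
          (mapAcc (fun x => liftSnd (FuncState.evalOne x)) xs (A', F')) := Close.mapAcc
        (I := fun i s => Matching (m + xs.length) i s)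
        (E := fun s s₁ => s₁.1 = s.1 ∧ ∀ y z, (s.2.table 0).toPartialFn y = some z →
          (s₁.2.table 0).toPartialFn y = some z)
        (A := fun h x s => s.1 x = some h)
        (P := fun x y s => (s.2.table 0).toPartialFn x = some y) (N := B)
        (fun s => ⟨rfl, fun _ _ h => h⟩)
        (fun s s₁ s₂ h h' => ⟨h'.1.trans h.1, fun y z hy => h'.2 y z (h.2 y z hy)⟩)
        (fun h x s s₁ hE hx => by rw [hE.1]; exact hx) (fun x y s s₁ hE hx => hE.2 x y hx)
        (fun i s s' h x hI hi hx => close_eval hI hi.le hx)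
        (l := hs) (l' := xs) (i := m) hall.flip (hM'.mono le_rfl (by omega)) (by omega)
      rw [← hlen'] at h2
      rw [PMF.map_comp, PMF.map_comp]
      refine h2.map fun w w' hw => ?_
      obtain ⟨ys, s₂⟩ := w
      obtain ⟨ys', ⟨A'', F''⟩⟩ := w'
      obtain ⟨rfl, hM'', ⟨-, hext⟩, hys⟩ := hw
      dsimp only at hM'' hext hys ⊢
      have hlen'' : ys.length = xs.length := hys.length_eq.symm
      refine ⟨?_, ⟨ys, _, hlen'', ?_, rfl⟩, hM''.mono (by omega) (by omega), rfl, ?_⟩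
      · by_cases hσ : σ = p <;> simp [hσ]
      · by_cases hσ : σ = p <;> simp [hσ, hlen', hlen'']
      · intro p' y hy
        change y ∈ addReceived r p.other ys p' at hy
        change ∃ x, (F''.table 0).toPartialFn x = some y
        unfold addReceived at hy
        by_cases hp : p' = p.other
        · subst hp
          rw [Function.update_self] at hy
          rcases List.mem_append.1 hy with hy | hy
          · obtain ⟨x, hx⟩ := hrec _ y hy
            exact ⟨x, hext _ _ hx⟩
          · obtain ⟨i, hi, rfl⟩ := List.mem_iff_getElem.1 hy
            exact ⟨xs[i]'(by omega), hys.get (by omega) hi⟩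
        · rw [Function.update_of_ne hp] at hy
          obtain ⟨x, hx⟩ := hrec _ y hy
          exact ⟨x, hext _ _ hx⟩
    · rw [← two_mul, mul_left_comm]
      gcongr
  · dsimp only
    have hlen := length_le_size_of_decode_update hq
    by_cases hz : ∀ z ∈ zs, z ∈ r p
    · rw [if_pos hz, if_pos hz]
      have h1 : Close _ _
          (mapAcc (fun y => liftSnd (PartialFn.query (List.ofFn y))) zs ((H, R₁), R₂))
          (mapAcc (fun z => liftSnd (fun F => F.updateOne 0 1 z)) zs (H', F)) := Close.mapAcc
        (I := fun _ s => Matching m m s) (E := fun s s₁ => s₁.2.table 0 = s.2.table 0)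
        (A := fun z z' s => z = z' ∧ ∃ x, (s.2.table 0).toPartialFn x = some z)
        (P := fun _ _ _ => True) (N := B)
        (fun s => rfl) (fun s s₁ s₂ h h' => h'.trans h)
        (fun z z' s s₁ hE hz => by rw [hE]; exact hz) (fun _ _ _ _ _ _ => trivial)
        (fun i s s' z z' hI hi hz => by
          obtain ⟨rfl, hz⟩ := hz
          exact close_update hI hz)
        (l := zs) (l' := zs) (i := m)
        (List.forall₂_same.2 fun z hz' => ⟨rfl, hrec p z (hz z hz')⟩) hM (by omega)
      have e1 : (hashedIdealGame n σ).update zs (H', F) =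
          mapAcc (fun z => liftSnd (fun F => F.updateOne 0 1 z)) zs (H', F) := by
        rw [mapAcc_liftSnd]
        simp [hashedIdealGame, FuncState.update_eq, liftSnd]
      rw [e1]
      refine (h1.map fun o o' ho => ?_).mono (fun _ _ h => h) (by simp)
      obtain ⟨h2, h3, h4, h5⟩ := ho
      have hlen' : o.1.length = zs.length := by rw [h2]; exact h5.length_eq.symm
      refine ⟨by rw [h2], .inr ⟨_, _, hlen', ?_, rfl⟩, h3.mono (by omega) (by omega), rfl, ?_⟩
      · split_ifs <;> simp [hlen']
      · intro p' y hy
        rw [h4]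
        exact hrec p' y hy
    · rw [if_neg hz, if_neg hz]
      exact (Close.pure ⟨rfl, .inl rfl, hM.mono (by omega) (by omega), rfl, hrec⟩).mono
        (fun _ _ h => h) (by simp)

theorem replyOk_nonempty (n : ℕ) (q : Val) : ∃ r, ReplyOk n q r := by
  unfold ReplyOk
  split
  · exact ⟨_, fun _ => false, rfl⟩
  · exact ⟨_, List.replicate _ fun _ => false, List.replicate _ fun _ => false,
      List.length_replicate, List.length_replicate, rfl⟩
  · exact ⟨_, .inl rfl⟩

theorem factors_empty (C : PartialFn n) (hC : ∀ x, C x = none) :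
    Factors (fun _ => none) (fun _ => none) C 0 :=
  ⟨by simp, by simp [PartialFn.values], by simp, fun x _ => hC x, by simp⟩

/-- The outputs of an environment with running time at most `B` in the two games are close. -/
theorem close_out (σ : Party) {D : Cmd} {B : ℕ} {p : Store × ℕ}
    (hD : (D.exec p).All (ReplyOk n) fun o => o.2 ≤ B) (F : FuncState n)
    (h0 : F.table 0 = []) (h1 : F.table 1 = []) :
    Close Eq (B * (2 * (B * blockProb n)))
      ((lazyGame n).out σ (D.exec p) ((fun _ => none, fun _ => none), fun _ => none))
      ((hashedIdealGame n σ).out σ (D.exec p) (fun _ => none, F)) := by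
  have hb := Comp.budget_exec (replyOk_nonempty n) hD
  refine (Close.run (I := Related) (B := B) (c := 2 * (B * blockProb n))
    (fun m s s' q hs hm => close_step σ hs hm) _ hb (zero_add B).le (s := (_, fun _ => []))
    (s' := (_, fun _ => [])) ⟨⟨rfl, ?_, ?_, ?_⟩, rfl, by simp⟩).map fun _ _ h => h
  · exact factors_empty _ fun x => by simp [h0, Table.toPartialFn]
  · simp only [h0, h1]
    exact factors_empty _ fun x => by simp [Table.toPartialFn]
  · simp [h0]

end

/-! ## Programs for the games -/

section Encodings

variable {n : ℕ}

theorem Val.ofBits_injective : Function.Injective Val.ofBits := fun l l' h => by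
  rw [← Val.toBits_ofBits l, h, Val.toBits_ofBits]

theorem Val.ofBlock_injective : Function.Injective (Val.ofBlock (n := n)) := fun b b' h => by
  rw [← Val.toBlock_ofBlock b, h, Val.toBlock_ofBlock]

def Table.encode (T : Table n) : Val :=
  .ofList (T.map fun e => .cons (.ofBits e.1) (.ofBlock e.2))

theorem Table.find_encode (T : Table n) (x : List Bool) :
    (Val.ofBits x).find T.encode =
      match T.lookup x with
      | none => .nil
      | some b => .cons .nil (.ofBlock b) := by
  -- Once a match is stored, later entries are ignored, so the fold finds the first match like
  -- `List.lookup`.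
  have h : ∀ (l : List Val) (w : Val), l.foldl (fun (acc e : Val) => if acc = .nil then
      if Val.ofBits x = e.hd then .cons .nil e.tl else .nil else acc) (Val.cons .nil w) =
      Val.cons .nil w := by
    intro l w
    induction l with
    | nil => rfl
    | cons e l ih => simp [ih]
  unfold Val.find Table.encode
  rw [Val.toList_ofList]
  induction T with
  | nil => rfl
  | cons e T ih =>
    obtain ⟨y, b⟩ := e
    by_cases hxy : x = y
    · subst hxy
      simp [h]
    · have h1 : (x == y) = false := by simpa using hxy
      have h2 : Val.ofBits x ≠ Val.ofBits y := fun h => hxy (Val.ofBits_injective h)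
      simp [h1, h2, ih, List.lookup_cons]

theorem Table.encode_snoc (T : Table n) (x : List Bool) (b : Block n) :
    T.encode.append (.cons (.cons (.ofBits x) (.ofBlock b)) .nil) =
      Table.encode (T ++ [(x, b)]) := by
  simp [Table.encode, Val.append]

theorem Val.ofBlocks_append (l l' : List (Block n)) :
    (Val.ofBlocks l).append (Val.ofBlocks l') = Val.ofBlocks (l ++ l') := by
  simp [Val.ofBlocks, Val.append]

theorem uniform_block_succ (n : ℕ) :
    PMF.uniformOfFintype (Block (n + 1)) = (PMF.uniformOfFintype Bool).bind fun a =>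
      (PMF.uniformOfFintype (Block n)).map fun b => (Fin.cons a b : Block (n + 1)) := by
  rw [← map_uniformOfFintype_equiv (Fin.consEquiv fun _ : Fin (n + 1) => Bool),
    uniformOfFintype_prod, PMF.map_bind]
  simp only [PMF.map_comp]
  rfl

theorem run_mapC_tossBody {S : Type} (O : S → Val → PMF (Val × S)) (n : ℕ) (env st : Val) (s : S) :
    (mapC tossBody env (List.replicate n .nil) st).run O s =
      (PMF.uniformOfFintype (Block n)).map fun b => (.cons (.ofBlock b) st, s) := by
  induction n with
  | zero =>
    simp [mapC, Comp.run, Val.ofBlock, Val.ofBits, map_const']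
  | succ n ih =>
    simp only [List.replicate_succ, mapC, tossBody, stateless, Comp.coin_bind, Comp.pure_bind,
      Comp.run, Val.tl_cons, Val.hd_cons, uniform_block_succ, PMF.map_bind, Comp.run_bind]
    refine congrArg _ (funext fun a => ?_)
    have ih' := ih
    unfold tossBody at ih'
    rw [ih', PMF.bind_map, PMF.map_comp]
    simp [PMF.map, Function.comp_def, Val.ofBlock, Val.ofBits, List.ofFn_succ]

theorem run_sampleC {S : Type} (O : S → Val → PMF (Val × S)) (n : ℕ) (s : S) :
    (sampleC (.unary n)).run O s =
      (PMF.uniformOfFintype (Block n)).map fun b => (.ofBlock b, s) := by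
  unfold sampleC Val.unary
  rw [Val.toList_ofList, Comp.run_bind, run_mapC_tossBody, PMF.bind_map]
  rfl

theorem run_queryBody {S : Type} (O : S → Val → PMF (Val × S)) {env : Val}
    (henv : env.hd = .unary n) (x : List Bool) (T : Table n) (s : S) :
    (queryBody (.cons (.ofBits x) (.cons env T.encode))).run O s =
      (T.query x).map fun o => (.cons (.ofBlock o.1) (Table.encode o.2), s) := by
  -- The type of a block depends on its length, so the equality of lengths is eliminated instead of
  -- rewritten.
  have hlen : ∀ m (_ : m = n) (b : Block n),
      Val.ofBlock ((Val.ofBlock b).toBlock m) = Val.ofBlock b := by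
    rintro m rfl; simp
  unfold queryBody
  simp only [Val.hd_cons, Val.tl_cons, henv, Table.find_encode]
  rcases h : T.lookup x with _ | b
  · simp only [if_true, Comp.run_bind, run_sampleC, PMF.bind_map, Table.query_of_none h,
      PMF.map_comp]
    simp [Comp.run, PMF.map, Function.comp_def, Table.encode_snoc]
  · simp [Table.query_of_some h, Comp.run, PMF.pure_map,
      hlen env.hd.toList.length (by rw [henv, Val.length_toList_unary])]

/-- The bridge from program loops to abstract processes: a loop body that is right for one encoded
entry is right for a whole list. -/
theorem run_mapC {S α β Z : Type} {O : S → Val → PMF (Val × S)} {s : S} {h : Val → Comp Val}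
    {env : Val} {enc : Z → Val} {encA : α → Val} {encB : β → Val} {F : α → Z → PMF (β × Z)}
    (hF : ∀ a z, (h (.cons (encA a) (.cons env (enc z)))).run O s =
      (F a z).map fun o => (.cons (encB o.1) (enc o.2), s)) (l : List α) (z : Z) :
    (mapC h env (l.map encA) (enc z)).run O s =
      (mapAcc F l z).map fun o => (.cons (.ofList (o.1.map encB)) (enc o.2), s) := by
  induction l generalizing z with
  | nil => simp [mapC, mapAcc, Comp.run, PMF.pure_map]
  | cons a l ih =>
    simp only [List.map_cons, mapC, Comp.run_bind, hF, PMF.bind_map, mapAcc, PMF.map_bind,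
      Function.comp_def]
    refine congrArg _ (funext fun o => ?_)
    simp only [Val.tl_cons, ih, PMF.bind_map, PMF.map_comp, Function.comp_def, Comp.run,
      Val.hd_cons]
    rfl

end Encodings

/-! ### Loop bodies -/

/-- Call of the oracle. -/
def callBody : Val → Comp Val := stateless fun v => .call v.hd .pure

theorem feasible_call_hd : Feasible fun v => .call v.hd .pure :=
  ((Feasible.expr (.hd (.reg 0))).comp Feasible.call).congr fun v => by simp [Expr.eval]

/-- Evaluation of a keyed function, with the key in the environment. -/
def keyedBody (E : ∀ n : ℕ, Block n → Block n → Block n) : Val → Comp Val :=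
  stateless fun v => .pure (.ofBlock (E v.tl.hd.toList.length
    (v.tl.tl.toBlock v.tl.hd.toList.length) (v.hd.toBlock v.tl.hd.toList.length)))

theorem feasible_keyed {E : ∀ n : ℕ, Block n → Block n → Block n}
    (hE : EfficientlyComputable E) : Feasible fun v => .pure (.ofBlock (E v.tl.hd.toList.length
      (v.tl.tl.toBlock v.tl.hd.toList.length) (v.hd.toBlock v.tl.hd.toList.length))) :=
  ((Feasible.expr (.cons (.hd (.tl (.reg 0))) (.cons (.tl (.tl (.reg 0))) (.hd (.reg 0))))).comp
    (Feasible.of_efficientlyComputable hE)).congr fun v => by simp [Expr.eval]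

/-- An oracle that answers every block independently of the others. -/
def blockOracle {n : ℕ} (ρ : Block n → PMF (Block n)) : Unit → Val → PMF (Val × Unit) :=
  fun _ q => (ρ (q.toBlock n)).map fun b => (.ofBlock b, ())

theorem functionOracle_eq {n : ℕ} (f : Block n → Block n) :
    functionOracle f = blockOracle fun y => .pure (f y) := by
  funext _ q
  simp [functionOracle, blockOracle, PMF.pure_map]

theorem blockReply_of_mem_support {n : ℕ} {ρ : Block n → PMF (Block n)} (s : Unit) (q : Val)
    (o : Val × Unit) (ho : o ∈ (blockOracle ρ s q).support) : BlockReply n q o.1 := by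
  simp only [blockOracle, PMF.mem_support_map_iff] at ho
  obtain ⟨b, -, rfl⟩ := ho
  exact ⟨b, rfl⟩

theorem run_callBody {n : ℕ} (ρ : Block n → PMF (Block n)) (env : Val) (y : Block n)
    (T : Table n) :
    (callBody (.cons (.ofBlock y) (.cons env T.encode))).run (blockOracle ρ) () =
      ((ρ y).map fun b => (b, T)).map fun o => (.cons (.ofBlock o.1) (Table.encode o.2), ()) := by
  simp [callBody, stateless, Comp.run, blockOracle, PMF.map,
    Function.comp_def]

theorem run_keyedBody {n : ℕ} {S : Type} (O : S → Val → PMF (Val × S)) (s : S)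
    (E : ∀ n : ℕ, Block n → Block n → Block n) (k y : Block n) (T : Table n) :
    (keyedBody E (.cons (.ofBlock y) (.cons (.cons (.unary n) (.ofBlock k)) T.encode))).run O s =
      (PMF.pure (E n k y, T)).map fun o => (.cons (.ofBlock o.1) (Table.encode o.2), s) := by
  have : ∀ m (hm : m = n), Val.ofBlock (E m ((Val.ofBlock k).toBlock m) ((Val.ofBlock y).toBlock m)) =
      Val.ofBlock (E n k y) := by
    rintro m rfl; simp
  simp [keyedBody, stateless, Comp.run, PMF.pure_map, this _ (Val.length_toList_unary n)]

/-! ### The steps -/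

/-- The list of values that a party has received, in the encoding of a state. -/
def receivedBy : Party → Val → Val
  | .A, r => r.hd
  | .B, r => r.tl

def setReceivedBy : Party → Val → Val → Val
  | .A, w, r => .cons w r.tl
  | .B, w, r => .cons r.hd w

/-- The answer to a query to the random oracle; the input is a pair of a state and a query. -/
def hashC (v : Val) : Comp Val :=
  (queryBody (.cons (.ofBits v.tl.tl.toBits) (.cons v.hd.hd v.hd.tl.hd))).bind fun o =>
    .pure (.cons o.hd (.cons v.hd.hd (.cons o.tl v.hd.tl.tl)))

/-- The answer to an evaluation with sender `p`. -/
def evalC (h : Val → Comp Val) (σ p : Party) (v : Val) : Comp Val :=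
  (mapC queryBody v.hd.hd (v.tl.tl.tl.toList.map fun x => .ofBits x.toBits) v.hd.tl.hd).bind fun o =>
  (mapC h v.hd.hd o.hd.toList v.hd.tl.tl.hd).bind fun o' =>
    .pure (.cons (.cons o'.hd (if σ = p then o.hd else o'.hd))
      (.cons v.hd.hd (.cons o.tl (.cons o'.tl (setReceivedBy p.other
        ((receivedBy p.other v.hd.tl.tl.tl).append o'.hd) v.hd.tl.tl.tl)))))

/-- The answer to an update with updater `p`. -/
def updateC (h : Val → Comp Val) (σ p : Party) (v : Val) : Comp Val :=
  let zs := v.tl.tl.tl.toList.map fun z => .ofBlock (z.toBlock v.hd.hd.hd.toList.length)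
  if (Val.ofList zs).missing (receivedBy p v.hd.tl.tl.tl) = .nil then
    (mapC h v.hd.hd zs v.hd.tl.tl.hd).bind fun o =>
      .pure (.cons (.cons o.hd (if σ = p then o.hd else .nil))
        (.cons v.hd.hd (.cons v.hd.tl.hd (.cons o.tl v.hd.tl.tl.tl))))
  else .pure (.cons .nil v.hd)

/-- The answer to a query of the environment. -/
def stepC (h h' : Val → Comp Val) (σ : Party) (v : Val) : Comp Val :=
  if v.tl.hd = .nil then hashC v
  else if v.tl.hd.hd = .nil then
    if v.tl.tl.hd = .nil then evalC h σ .A v else evalC h σ .B v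
  else if v.tl.tl.hd = .nil then updateC h' σ .A v else updateC h' σ .B v

theorem Feasible.hashC : Feasible hashC :=
  (let_ (.tl (.tl (.reg 0))) ofBits_toBits
    (let_ (.cons (.hd (.reg 0)) (.cons (.hd (.hd (.tl (.reg 0)))) (.hd (.tl (.hd (.tl (.reg 0)))))))
      queryBody (Feasible.expr (.cons (.hd (.hd (.reg 0))) (.cons (.hd (.hd (.tl (.tl (.reg 0)))))
        (.cons (.tl (.hd (.reg 0))) (.tl (.tl (.hd (.tl (.tl (.reg 0)))))))))))).congr fun v => by
  simp [Expr.eval, DurPRF.hashC]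

def receivedByExpr : Party → Expr → Expr
  | .A, e => .hd e
  | .B, e => .tl e

def setReceivedByExpr : Party → Expr → Expr → Expr
  | .A, w, e => .cons w (.tl e)
  | .B, w, e => .cons (.hd e) w

@[simp] theorem eval_receivedByExpr (p : Party) (e : Expr) (s : Store) :
    (receivedByExpr p e).eval s = receivedBy p (e.eval s) := by
  cases p <;> rfl

@[simp] theorem eval_setReceivedByExpr (p : Party) (w e : Expr) (s : Store) :
    (setReceivedByExpr p w e).eval s = setReceivedBy p (w.eval s) (e.eval s) := by
  cases p <;> rfl

theorem Expr.eval_ite (c : Prop) [Decidable c] (e f : Expr) (s : Store) :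
    (if c then e else f).eval s = if c then e.eval s else f.eval s := by
  split_ifs <;> rfl

theorem Feasible.evalC {h : Val → Comp Val} (hh : Feasible h) (hg : Growth h) (σ p : Party) :
    Feasible (evalC h σ p) := by
  have hbits : Feasible fun v => .pure (.ofBits v.hd.toBits) :=
    ((Feasible.expr (.hd (.reg 0))).comp ofBits_toBits).congr fun v => by simp [Expr.eval]
  have hxs : Feasible fun v => .pure (.ofList (v.toList.map fun x => .ofBits x.toBits)) :=
    ((Feasible.expr (.cons (.reg 0) .nil)).comp hbits.map_pure).congr fun v => by simp [Expr.eval]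
  refine (let_ (.tl (.tl (.tl (.reg 0)))) hxs
    (let_ (.cons (.hd (.reg 0)) (.cons (.hd (.hd (.tl (.reg 0)))) (.hd (.tl (.hd (.tl (.reg 0)))))))
      (queryBody.mapC growth_queryBody)
    (let_ (.cons (.hd (.hd (.reg 0))) (.cons (.hd (.hd (.tl (.tl (.reg 0)))))
        (.hd (.tl (.tl (.hd (.tl (.tl (.reg 0)))))))))
      (hh.mapC hg)
    (let_ (.cons (receivedByExpr p.other (.tl (.tl (.tl (.hd (.tl (.tl (.tl (.reg 0)))))))))
        (.hd (.hd (.reg 0))))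
      append
    (Feasible.expr (.cons (.cons (.hd (.hd (.tl (.reg 0))))
        (if σ = p then .hd (.hd (.tl (.tl (.reg 0)))) else .hd (.hd (.tl (.reg 0)))))
      (.cons (.hd (.hd (.tl (.tl (.tl (.tl (.reg 0))))))) (.cons (.tl (.hd (.tl (.tl (.reg 0)))))
        (.cons (.tl (.hd (.tl (.reg 0)))) (setReceivedByExpr p.other (.hd (.reg 0))
          (.tl (.tl (.tl (.hd (.tl (.tl (.tl (.tl (.reg 0)))))))))))))))))) ).congr fun v => ?_
  simp [Expr.eval, DurPRF.evalC, Expr.eval_ite]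

theorem Feasible.updateC {h : Val → Comp Val} (hh : Feasible h) (hg : Growth h) (σ p : Party) :
    Feasible (updateC h σ p) := by
  have hblock : Feasible fun v => .pure (.ofBlock (v.hd.toBlock v.tl.toList.length)) :=
    ((Feasible.expr (.cons (.tl (.reg 0)) (.hd (.reg 0)))).comp ofBlock_toBlock).congr
      fun v => by simp [Expr.eval]
  refine (let_ (.cons (.tl (.tl (.tl (.reg 0)))) (.hd (.hd (.hd (.reg 0))))) hblock.map_pure
    (let_ (.cons (.hd (.reg 0)) (receivedByExpr p (.tl (.tl (.tl (.hd (.tl (.reg 0)))))))) missing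
    (ite (.hd (.reg 0)) (Feasible.expr (.cons .nil (.hd (.tl (.tl (.reg 0))))))
    (let_ (.cons (.hd (.tl (.reg 0))) (.cons (.hd (.hd (.tl (.tl (.reg 0)))))
        (.hd (.tl (.tl (.hd (.tl (.tl (.reg 0)))))))))
      (hh.mapC hg)
    (Feasible.expr (.cons (.cons (.hd (.hd (.reg 0))) (if σ = p then .hd (.hd (.reg 0)) else .nil))
      (.cons (.hd (.hd (.tl (.tl (.tl (.reg 0)))))) (.cons (.hd (.tl (.hd (.tl (.tl (.tl (.reg 0)))))))
        (.cons (.tl (.hd (.reg 0))) (.tl (.tl (.tl (.hd (.tl (.tl (.tl (.reg 0)))))))))))))))) ).congr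
    fun v => ?_
  simp only [Expr.eval, DurPRF.updateC, Expr.eval_ite, eval_receivedByExpr, Comp.pure_bind,
    Val.hd_cons, Val.tl_cons, Val.toList_ofList]

theorem Feasible.stepC {h h' : Val → Comp Val} (hh : Feasible h) (hg : Growth h)
    (hh' : Feasible h') (hg' : Growth h') (σ : Party) : Feasible (stepC h h' σ) := by
  refine (ite (.hd (.tl (.reg 0))) (ite (.hd (.hd (.tl (.reg 0))))
    (ite (.hd (.tl (.tl (.reg 0)))) (hh'.updateC hg' σ .B) (hh'.updateC hg' σ .A))
    (ite (.hd (.tl (.tl (.reg 0)))) (hh.evalC hg σ .B) (hh.evalC hg σ .A))) hashC).congr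
      fun v => ?_
  rfl

/-! ### The steps compute the games -/

section

variable {n : ℕ}

/-- The game with a random oracle and two further functions that share a table. -/
def tableGame (F F' : Block n → Table n → PMF (Block n × Table n)) : Game n (Table n × Table n) :=
  hashGame (fun x => liftFst fun T => T.query x) (fun y => liftSnd (F y)) fun y => liftSnd (F' y)

/-- The encoding of a state, with a fixed value `env`. -/
def encodeState (env : Val) (s : (Table n × Table n) × (Party → List (Block n))) : Val :=
  .cons env (.cons s.1.1.encode (.cons s.1.2.encode
    (.cons (.ofBlocks (s.2 .A)) (.ofBlocks (s.2 .B)))))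

/-- The loop body `h` implements the function `F`. -/
def Computes (O : Unit → Val → PMF (Val × Unit)) (env : Val) (h : Val → Comp Val)
    (F : Block n → Table n → PMF (Block n × Table n)) : Prop :=
  ∀ y T, (h (.cons (.ofBlock y) (.cons env T.encode))).run O () =
    (F y T).map fun o => (.cons (.ofBlock o.1) (Table.encode o.2), ())

theorem Val.toParty_eq_A {v : Val} : v.toParty = .A ↔ v = .nil := by
  cases v <;> simp [Val.toParty]

theorem Query.decode_eq (v : Val) : Query.decode n v =
    if v.hd = .nil then .hash v.tl.toBits
    else if v.hd.hd = .nil then .eval v.tl.hd.toParty (v.tl.tl.toList.map Val.toBits)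
    else .update v.tl.hd.toParty (v.tl.tl.toList.map (Val.toBlock n)) := by
  unfold Query.decode
  split <;> simp [*]

theorem receivedBy_received (p : Party) (r : Party → List (Block n)) :
    receivedBy p (.cons (.ofBlocks (r .A)) (.ofBlocks (r .B))) = .ofBlocks (r p) := by
  cases p <;> rfl

theorem setReceivedBy_addReceived (p : Party) (r : Party → List (Block n)) (ys : List (Block n)) :
    setReceivedBy p ((Val.ofBlocks (r p)).append (.ofBlocks ys))
      (.cons (.ofBlocks (r .A)) (.ofBlocks (r .B))) =
      .cons (.ofBlocks (addReceived r p ys .A)) (.ofBlocks (addReceived r p ys .B)) := by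
  cases p <;> simp [setReceivedBy, addReceived, Val.ofBlocks_append]

variable {O : Unit → Val → PMF (Val × Unit)} {env : Val} {h h' : Val → Comp Val}
  {F F' : Block n → Table n → PMF (Block n × Table n)}

theorem run_hashC (henv : env.hd = .unary n) (q : Val)
    (s : (Table n × Table n) × (Party → List (Block n))) :
    (hashC (.cons (encodeState env s) q)).run O () =
      (((tableGame F F').hash q.tl.toBits s.1).map fun o => (Val.ofBlock o.1, (o.2, s.2))).map
        fun o => (.cons o.1 (encodeState env o.2), ()) := by
  simp only [hashC, encodeState, Val.hd_cons, Val.tl_cons, Comp.run_bind, run_queryBody _ henv,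
    tableGame, hashGame, liftFst, PMF.bind_map, PMF.map_comp, Comp.run, Function.comp_def]
  rfl

theorem run_evalC (henv : env.hd = .unary n) (hF : Computes O env h F) (σ p : Party) (q : Val)
    (s : (Table n × Table n) × (Party → List (Block n))) :
    (evalC h σ p (.cons (encodeState env s) q)).run O () =
      (((tableGame F F').eval p (q.tl.tl.toList.map Val.toBits) s.1).map fun o =>
        (reply o.1.2 (Val.ofBlocks (if σ = p then o.1.1 else o.1.2)),
          (o.2, addReceived s.2 p.other o.1.2))).map
        fun o => (.cons o.1 (encodeState env o.2), ()) := by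
  have e1 : q.tl.tl.toList.map (fun x => Val.ofBits x.toBits) =
      (q.tl.tl.toList.map Val.toBits).map Val.ofBits := by simp
  have h1 := fun (T : Table n) => run_mapC (O := O) (s := ()) (h := queryBody) (env := env)
    (enc := Table.encode (n := n)) (encA := Val.ofBits) (encB := Val.ofBlock)
    (F := fun x T => Table.query T x) (fun a z => run_queryBody O henv a z ())
    (q.tl.tl.toList.map Val.toBits) T
  have h2 := fun (l : List (Block n)) (T : Table n) => run_mapC (O := O) (s := ()) (h := h)
    (env := env) (enc := Table.encode (n := n)) (encA := Val.ofBlock) (encB := Val.ofBlock)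
    (F := F) hF l T
  simp only [evalC, encodeState, Val.hd_cons, Val.tl_cons, Comp.run_bind, e1, h1,
    tableGame, hashGame, evalVia, PMF.bind_map, PMF.map_comp, Comp.run, Function.comp_def,
    PMF.map_bind, Val.toList_ofList, h2, mapAcc_liftFst, mapAcc_liftSnd, liftFst, liftSnd,
    receivedBy_received]
  refine congrArg _ (funext fun o => ?_)
  simp only [PMF.map, Function.comp_def]
  refine congrArg _ (funext fun o' => congrArg PMF.pure (congrArg (·, ()) ?_))
  rw [← Val.ofBlocks, setReceivedBy_addReceived, ← Val.ofBlocks]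
  simp only [reply, apply_ite]

theorem run_updateC (henv : env.hd = .unary n) (hF : Computes O env h F') (σ p : Party) (q : Val)
    (s : (Table n × Table n) × (Party → List (Block n))) :
    (updateC h σ p (.cons (encodeState env s) q)).run O () =
      (if ∀ z ∈ q.tl.tl.toList.map (Val.toBlock n), z ∈ s.2 p then
        ((tableGame F F').update (q.tl.tl.toList.map (Val.toBlock n)) s.1).map fun o =>
          (reply o.1 (Val.ofBlocks (if σ = p then o.1 else [])), (o.2, s.2))
      else PMF.pure (.nil, s)).map fun o => (.cons o.1 (encodeState env o.2), ()) := by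
  have hlen : ∀ m (_ : m = n) (l : List Val), (l.map fun z => Val.ofBlock (z.toBlock m)) =
      (l.map (Val.toBlock n)).map Val.ofBlock := by
    rintro m rfl l; simp
  have h2 := fun (l : List (Block n)) (T : Table n) => run_mapC (O := O) (s := ()) (h := h)
    (env := env) (enc := Table.encode (n := n)) (encA := Val.ofBlock) (encB := Val.ofBlock)
    (F := F') hF l T
  have hmem : ∀ l r : List (Block n), (Val.ofList (l.map Val.ofBlock)).missing (.ofBlocks r) = .nil ↔
      ∀ z ∈ l, z ∈ r := by
    intro l r
    rw [Val.missing_eq_nil, Val.toList_ofList, Val.ofBlocks, Val.toList_ofList]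
    simp [Val.ofBlock_injective.eq_iff]
  simp only [updateC, encodeState, Val.hd_cons, Val.tl_cons,
    hlen env.hd.toList.length (by rw [henv, Val.length_toList_unary]), receivedBy_received]
  by_cases hz : ∀ z ∈ q.tl.tl.toList.map (Val.toBlock n), z ∈ s.2 p
  · rw [if_pos ((hmem _ _).2 hz), if_pos hz]
    simp only [Comp.run_bind, h2, PMF.bind_map, tableGame, hashGame, mapAcc_liftSnd, liftSnd,
      PMF.map_comp, Comp.run, Function.comp_def]
    simp only [PMF.map, Function.comp_def]
    refine congrArg _ (funext fun o' => congrArg PMF.pure (congrArg (·, ()) ?_))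
    simp only [Val.hd_cons, Val.tl_cons, reply, apply_ite Val.ofBlocks]
    rfl
  · rw [if_neg (fun h => hz ((hmem _ _).1 h)), if_neg hz]
    simp [Comp.run, PMF.pure_map]

/-- The program branches on the same heads and tails as `Query.decode`, so the cases correspond to
each other. -/
theorem run_stepC (henv : env.hd = .unary n) (hF : Computes O env h F) (hF' : Computes O env h' F')
    (σ : Party) (q : Val) (s : (Table n × Table n) × (Party → List (Block n))) :
    (stepC h h' σ (.cons (encodeState env s) q)).run O () =
      ((tableGame F F').step σ s q).map fun o => (.cons o.1 (encodeState env o.2), ()) := by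
  unfold Game.step
  change Comp.run O (if q.hd = .nil then hashC _
    else if q.hd.hd = .nil then if q.tl.hd = .nil then evalC h σ .A _ else evalC h σ .B _
    else if q.tl.hd = .nil then updateC h' σ .A _ else updateC h' σ .B _) () = _
  by_cases h1 : q.hd = .nil
  · rw [if_pos h1, Query.decode_eq, if_pos h1]
    exact run_hashC henv q s
  by_cases h2 : q.hd.hd = .nil
  · rw [if_neg h1, if_pos h2, Query.decode_eq, if_neg h1, if_pos h2]
    rcases hp : q.tl.hd.toParty
    · rw [if_pos (Val.toParty_eq_A.1 hp)]
      exact run_evalC henv hF σ .A q s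
    · rw [if_neg (fun h => by simp [Val.toParty_eq_A.2 h] at hp)]
      exact run_evalC henv hF σ .B q s
  · rw [if_neg h1, if_neg h2, Query.decode_eq, if_neg h1, if_neg h2]
    rcases hp : q.tl.hd.toParty
    · rw [if_pos (Val.toParty_eq_A.1 hp)]
      exact run_updateC henv hF' σ .A q s
    · rw [if_neg (fun h => by simp [Val.toParty_eq_A.2 h] at hp)]
      exact run_updateC henv hF' σ .B q s

end

/-! ### The size of a state -/

section

theorem le_of_mem_support_mapAcc {α β Z : Type} {F : α → Z → PMF (β × Z)} {μ : Z → ℕ} {g : α → ℕ}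
    (hF : ∀ a z, ∀ o ∈ (F a z).support, μ o.2 ≤ μ z + g a) {l : List α} {z : Z} {o : List β × Z}
    (ho : o ∈ (mapAcc F l z).support) : μ o.2 ≤ μ z + (l.map g).sum := by
  induction l generalizing z o with
  | nil => simp [mapAcc] at ho; simp [ho]
  | cons a l ih =>
    simp only [mapAcc, PMF.mem_support_bind_iff, PMF.mem_support_map_iff] at ho
    obtain ⟨o₁, h₁, o₂, h₂, rfl⟩ := ho
    have := hF a z o₁ h₁
    have := ih h₂
    simp
    omega

variable {n : ℕ}

theorem Table.size_encode_query {T : Table n} {x : List Bool} {o : Block n × Table n}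
    (ho : o ∈ (T.query x).support) :
    (Table.encode o.2).size ≤ T.encode.size + (4 * x.length + 4 * n + 4) := by
  rcases h : T.lookup x with _ | b
  · rw [Table.query_of_none h, PMF.mem_support_map_iff] at ho
    obtain ⟨b, -, rfl⟩ := ho
    have h1 := Val.size_append T.encode (.cons (.cons (.ofBits x) (.ofBlock b)) .nil)
    rw [Table.encode_snoc] at h1
    have h2 := Val.size_ofBits_le x
    have h3 := Val.size_ofBlock_le b
    simp at h1 ⊢
    omega
  · rw [Table.query_of_some h] at ho
    simp at ho
    subst ho
    simp

theorem Val.size_append_ofBlocks (v : Val) (l : List (Block n)) :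
    (v.append (.ofBlocks l)).size ≤ v.size + l.length * (4 * n + 2) := by
  have := Val.size_append v (.ofBlocks l)
  have := Val.size_ofBlocks_le l
  omega

theorem sum_toList_le (v : Val) (g : Val → ℕ) (c : ℕ) (hg : ∀ x, g x ≤ c * (x.size + 1)) :
    (v.toList.map g).sum ≤ c * v.size := by
  induction v with
  | nil => simp
  | cons a b _ ih =>
    have := hg a
    simp only [Val.toList_cons, List.map_cons, List.sum_cons, Val.size_cons]
    nlinarith

theorem mem_support_liftFst {Z W β : Type} {F : Z → PMF (β × Z)} {s : Z × W} {o : β × (Z × W)} :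
    o ∈ (liftFst F s).support ↔ ∃ o' ∈ (F s.1).support, (o'.1, (o'.2, s.2)) = o := by
  rw [liftFst, PMF.mem_support_map_iff]

theorem mem_support_liftSnd {Z W β : Type} {F : W → PMF (β × W)} {s : Z × W} {o : β × (Z × W)} :
    o ∈ (liftSnd F s).support ↔ ∃ o' ∈ (F s.2).support, (o'.1, (s.1, o'.2)) = o := by
  rw [liftSnd, PMF.mem_support_map_iff]

/-- At most the size of one new entry is added to a table. -/
def SmallGrowth (F : Block n → Table n → PMF (Block n × Table n)) : Prop :=
  ∀ y T, ∀ o ∈ (F y T).support, (Table.encode o.2).size ≤ T.encode.size + (8 * n + 4)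

/-- The costliest request is an evaluation: per unit of query size the hash table gains at most `4 *
n + 8`, the second table `8 * n + 4`, and the received values `4 * n + 2`. The factor `16 * n + 20`
covers the sum. -/
theorem size_encodeState_step {env : Val} {F F' : Block n → Table n → PMF (Block n × Table n)}
    (hF : SmallGrowth F) (hF' : SmallGrowth F') {σ : Party} {q : Val}
    {s : (Table n × Table n) × (Party → List (Block n))}
    {o : Val × ((Table n × Table n) × (Party → List (Block n)))}
    (ho : o ∈ ((tableGame F F').step σ s q).support) :
    ReplyOk n q o.1 ∧ (encodeState env o.2).size ≤ (encodeState env s).size + (16 * n + 20) * q.size := by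
  have hpos := q.size_pos
  have hle : q.tl.tl.size ≤ q.size := q.tl.size_tl_le.trans q.size_tl_le
  have hlen : q.tl.tl.toList.length ≤ q.size := q.tl.tl.length_toList_lt.le.trans hle
  unfold Game.step ReplyOk at *
  unfold Query.decode at *
  rcases hq : q.hd with _ | ⟨_ | ⟨a, b⟩, c⟩
  · simp only [hq] at ho ⊢
    rw [PMF.mem_support_map_iff] at ho
    obtain ⟨o, ho, rfl⟩ := ho
    refine ⟨⟨_, rfl⟩, ?_⟩
    obtain ⟨o', ho', rfl⟩ := mem_support_liftFst.1
      (show o ∈ (liftFst (fun T => Table.query T q.tl.toBits) s.1).support from ho)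
    have h1 := Table.size_encode_query ho'
    have h2 : q.tl.toBits.length ≤ q.size := by
      have := q.tl.length_toList_lt
      have := q.size_tl_le
      simp [Val.toBits]; omega
    simp only [encodeState, Val.size_cons]
    nlinarith
  · simp only [hq] at ho ⊢
    set p := q.tl.hd.toParty
    set xs := q.tl.tl.toList.map Val.toBits with hxs
    have hxl : xs.length = q.tl.tl.toList.length := by simp [xs]
    rw [PMF.mem_support_map_iff] at ho
    obtain ⟨o, ho, rfl⟩ := ho
    simp only [tableGame, hashGame, evalVia, PMF.mem_support_bind_iff, PMF.mem_support_map_iff] at ho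
    obtain ⟨o₁, h₁, o₂, h₂, rfl⟩ := ho
    have hl₁ := length_of_mem_support_mapAcc h₁
    have hl₂ := length_of_mem_support_mapAcc h₂
    simp only [mapAcc_liftFst] at h₁
    simp only [mapAcc_liftSnd] at h₂
    obtain ⟨o₁, h₁', rfl⟩ := mem_support_liftFst.1 h₁
    obtain ⟨o₂, h₂', rfl⟩ := mem_support_liftSnd.1 h₂
    dsimp only at *
    have e₁ := le_of_mem_support_mapAcc (μ := fun T : Table n => T.encode.size)
      (g := fun x : List Bool => 4 * x.length + 4 * n + 4) (fun x T o ho => Table.size_encode_query ho) h₁'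
    have e₂ := le_of_mem_support_mapAcc (μ := fun T : Table n => T.encode.size)
      (g := fun x => 8 * n + 4) hF h₂'
    have e₃ : (xs.map fun x : List Bool => 4 * x.length + 4 * n + 4).sum ≤ (4 * n + 8) * q.size := by
      rw [hxs, List.map_map]
      refine (sum_toList_le _ _ (4 * n + 8) fun x => ?_).trans (by gcongr)
      have := x.length_toList_lt
      simp only [Function.comp, Val.toBits, List.length_map]
      nlinarith
    simp only [List.map_const', List.sum_replicate, smul_eq_mul] at e₂
    refine ⟨⟨_, if σ = p then o₁.1 else o₂.1, by omega, by split_ifs <;> omega, rfl⟩, ?_⟩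
    have e₄ : (Val.ofBlocks (addReceived s.2 p.other o₂.1 .A)).size +
        (Val.ofBlocks (addReceived s.2 p.other o₂.1 .B)).size ≤
        (Val.ofBlocks (s.2 .A)).size + (Val.ofBlocks (s.2 .B)).size + o₂.1.length * (4 * n + 2) := by
      have hA := Val.size_append_ofBlocks (Val.ofBlocks (s.2 .A)) o₂.1
      have hB := Val.size_append_ofBlocks (Val.ofBlocks (s.2 .B)) o₂.1
      rw [Val.ofBlocks_append] at hA hB
      cases p <;> simp [addReceived, Party.other] <;> omega
    have e₅ : o₁.1.length * (8 * n + 4) ≤ q.size * (8 * n + 4) := by gcongr; omega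
    have e₆ : o₂.1.length * (4 * n + 2) ≤ q.size * (4 * n + 2) := by gcongr; omega
    simp only [encodeState, Val.size_cons]
    nlinarith
  · simp only [hq] at ho ⊢
    set p := q.tl.hd.toParty
    set zs := q.tl.tl.toList.map (Val.toBlock n) with hzs
    have hzl : zs.length = q.tl.tl.toList.length := by simp [zs]
    by_cases hz : ∀ z ∈ zs, z ∈ s.2 p
    · rw [if_pos hz, PMF.mem_support_map_iff] at ho
      obtain ⟨o, ho, rfl⟩ := ho
      simp only [tableGame, hashGame] at ho
      have hl := length_of_mem_support_mapAcc ho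
      simp only [mapAcc_liftSnd] at ho
      obtain ⟨o', ho', rfl⟩ := mem_support_liftSnd.1 ho
      have e₂ := le_of_mem_support_mapAcc (μ := fun T : Table n => T.encode.size)
        (g := fun x => 8 * n + 4) hF' ho'
      simp only [List.map_const', List.sum_replicate, smul_eq_mul] at e₂
      dsimp only at *
      refine ⟨.inr ⟨_, if σ = p then o'.1 else [], by omega, by split_ifs; exacts [hl.le, Nat.zero_le _], rfl⟩, ?_⟩
      have e₅ : zs.length * (8 * n + 4) ≤ q.size * (8 * n + 4) := by gcongr; omega
      simp only [encodeState, Val.size_cons]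
      nlinarith
    · rw [if_neg hz] at ho
      obtain rfl := (PMF.mem_support_pure_iff _ _).1 ho
      exact ⟨.inl rfl, by simp⟩

end

/-! ## Distinguishers from environments -/

section

variable {n : ℕ}

/-- An oracle with uniform answers has every block in its support. So the exact distribution from
`run_stepC` for this one oracle yields a statement about all admissible replies. -/
theorem all_stepC {env : Val} (henv : env.hd = .unary n) {h h' : Val → Comp Val}
    {F F' : Block n → Table n → PMF (Block n × Table n)}
    (hF : Computes (blockOracle fun _ => PMF.uniformOfFintype (Block n)) env h F)
    (hF' : Computes (blockOracle fun _ => PMF.uniformOfFintype (Block n)) env h' F')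
    (hs : SmallGrowth F) (hs' : SmallGrowth F') (σ : Party) (st q : Val)
    (hst : ∃ s : (Table n × Table n) × (Party → List (Block n)), st = encodeState env s) :
    (stepC h h' σ (.cons st q)).All (BlockReply n) fun o =>
      (∃ s : (Table n × Table n) × (Party → List (Block n)), o.tl = encodeState env s) ∧
        ReplyOk n q o.hd ∧ o.tl.size ≤ st.size + (16 * n + 20) * q.size := by
  obtain ⟨s, rfl⟩ := hst
  refine Comp.all_of_support (O := blockOracle fun _ => PMF.uniformOfFintype (Block n)) ?_ ?_
  · rintro q r ⟨b, rfl⟩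
    rw [blockOracle, PMF.mem_support_map_iff]
    exact ⟨b, by simp, rfl⟩
  · intro o ho
    rw [run_stepC henv hF hF', PMF.mem_support_map_iff] at ho
    obtain ⟨o, ho, rfl⟩ := ho
    obtain ⟨h1, h2⟩ := size_encodeState_step (env := env) hs hs' ho
    exact ⟨⟨_, rfl⟩, h1, h2⟩

/-- The view of a party with random keys, a further random key, and the initial state of a game. -/
def initC (v : Val) : Comp Val :=
  (sampleC v).bind fun cur => (sampleC v).bind fun upd => (sampleC v).bind fun key =>
    .pure (.cons (.cons cur (.cons upd .nil))
      (.cons (.cons v key) (.cons .nil (.cons .nil (.cons .nil .nil)))))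

theorem Feasible.initC : Feasible initC :=
  (let_ (.reg 0) sampleC (let_ (.tl (.reg 0)) sampleC (let_ (.tl (.tl (.reg 0))) sampleC
    (Feasible.expr (.cons (.cons (.hd (.tl (.tl (.reg 0)))) (.cons (.hd (.tl (.reg 0))) .nil))
      (.cons (.cons (.tl (.tl (.tl (.reg 0)))) (.hd (.reg 0)))
        (.cons .nil (.cons .nil (.cons .nil .nil))))))))).congr fun v => by
  simp [Expr.eval, DurPRF.initC]

/-- The value that encodes a fixed key. -/
def keyEnv (k : Block n) : Val := .cons (.unary n) (.ofBlock k)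

/-- The initial state of a game. -/
def initialState (n : ℕ) : (Table n × Table n) × (Party → List (Block n)) := (([], []), fun _ => [])

theorem run_initC {S : Type} (O : S → Val → PMF (Val × S)) (s : S) :
    (initC (.unary n)).run O s = (PMF.uniformOfFintype (Block n)).bind fun cur =>
      (PMF.uniformOfFintype (Block n)).bind fun upd =>
      (PMF.uniformOfFintype (Block n)).bind fun k =>
        .pure (.cons (initialView ⟨cur, upd⟩) (encodeState (keyEnv k) (initialState n)), s) := by
  simp only [initC, Comp.run_bind, run_sampleC, PMF.bind_map, Function.comp_def]
  rfl

theorem all_initC : (initC (.unary n)).All (BlockReply n) fun v => ∃ (K : Keys n) (k : Block n),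
    v = .cons (initialView K) (encodeState (keyEnv k) (initialState n)) := by
  refine Comp.all_of_support (O := blockOracle fun _ => PMF.uniformOfFintype (Block n)) ?_ ?_
  · rintro q r ⟨b, rfl⟩
    rw [blockOracle, PMF.mem_support_map_iff]
    exact ⟨b, by simp, rfl⟩
  · intro o ho
    simp only [run_initC, PMF.mem_support_bind_iff, PMF.mem_support_pure_iff] at ho
    obtain ⟨cur, -, upd, -, k, -, rfl⟩ := ho
    exact ⟨⟨cur, upd⟩, k, rfl⟩

/-- Two loop bodies that compute values of two functions, given an oracle for a random function
and a random key. -/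
structure Reduction where
  fst : Val → Comp Val
  snd : Val → Comp Val
  feasible_fst : Feasible fst
  growth_fst : Growth fst
  feasible_snd : Feasible snd
  growth_snd : Growth snd
  fn : ∀ {n : ℕ}, (Block n → PMF (Block n)) → Block n → Block n → Table n → PMF (Block n × Table n)
  fn' : ∀ {n : ℕ}, (Block n → PMF (Block n)) → Block n → Block n → Table n → PMF (Block n × Table n)
  computes_fst : ∀ {n : ℕ} (ρ : Block n → PMF (Block n)) (k : Block n),
    Computes (blockOracle ρ) (keyEnv k) fst (fn ρ k)
  computes_snd : ∀ {n : ℕ} (ρ : Block n → PMF (Block n)) (k : Block n),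
    Computes (blockOracle ρ) (keyEnv k) snd (fn' ρ k)
  small_fst : ∀ {n : ℕ} (ρ : Block n → PMF (Block n)) (k : Block n), SmallGrowth (fn ρ k)
  small_snd : ∀ {n : ℕ} (ρ : Block n → PMF (Block n)) (k : Block n), SmallGrowth (fn' ρ k)

/-- The behaviour of an environment in a game, started by a distinguisher. -/
def simulation (R : Reduction) (σ : Party) (D : Cmd) (n : ℕ) (advice : List Bool) :
    Comp ((Store × ℕ) × Val) :=
  (initC (.unary n)).bind fun v =>
    (D.exec (envStart n advice v.hd)).handle (stepC R.fst R.snd σ) v.tl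

/-- The view of the corrupted party starts with freshly sampled shares; that they may be independent
of all else is justified by `sampleKeys_bind`. -/
theorem run_simulation (R : Reduction) (σ : Party) (D : Cmd) (n : ℕ) (advice : List Bool)
    (ρ : Block n → PMF (Block n)) :
    ((simulation R σ D n advice).run (blockOracle ρ) ()).map (fun o => o.1.1) =
      (PMF.uniformOfFintype (Block n)).bind fun cur => (PMF.uniformOfFintype (Block n)).bind fun upd =>
      (PMF.uniformOfFintype (Block n)).bind fun k =>
        (tableGame (R.fn ρ k) (R.fn' ρ k)).out σ (D.exec (envStart n advice (initialView ⟨cur, upd⟩)))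
          ([], []) := by
  simp only [simulation, Comp.run_bind, run_initC, PMF.map_bind, PMF.bind_bind, PMF.pure_bind,
    Val.hd_cons, Val.tl_cons]
  refine congrArg _ (funext fun cur => congrArg _ (funext fun upd => congrArg _ (funext fun k => ?_)))
  rw [Comp.run_handle (encodeState (keyEnv k)) fun s q =>
    run_stepC rfl (R.computes_fst ρ k) (R.computes_snd ρ k) σ q s]
  rw [PMF.map_comp]
  rfl

theorem all_simulation (R : Reduction) (σ : Party) {D : Cmd} {n : ℕ} {advice : List Bool} {B : ℕ}
    (hD : ∀ K : Keys n, (D.exec (envStart n advice (initialView K))).All (ReplyOk n)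
      fun o => o.2 ≤ B) :
    (simulation R σ D n advice).All (BlockReply n) fun o => o.1.2 ≤ B := by
  unfold simulation
  rw [Comp.all_bind]
  refine all_initC.mono ?_
  rintro v ⟨K, k, rfl⟩
  refine (hD K).handle (I := fun st => ∃ s : (Table n × Table n) × (Party → List (Block n)),
    st = encodeState (keyEnv k) s) (fun st q hst => ?_) ⟨_, rfl⟩
  exact (all_stepC rfl (R.computes_fst _ k) (R.computes_snd _ k) (R.small_fst _ k)
    (R.small_snd _ k) σ st q hst).mono fun o ho => ⟨ho.1, ho.2.1⟩

/-- The program that runs `D` in a game implemented by `h`; the state is in register `w`. -/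
def distinguisher (i h : ℕ → Cmd) (w : ℕ) (D : Cmd) : Cmd :=
  .seq (.assign w (.reg 0)) <| .seq (i w) <| .seq (.assign 2 (.hd (.reg w))) <|
    .seq (.assign w (.tl (.reg w))) (D.embed h 0 w)

/-- The environment keeps its register numbers, and the game's state sits at `w`, beyond them and
the three inputs. `3 * p` covers the initialization and two readings of its result. `6 * n + 20`
bounds the initial state, and `16 * n + 20` is the growth rate from `size_encodeState_step`. -/
theorem sim_distinguisher (R : Reduction) (σ : Party) (D : Cmd) {i h : ℕ → Cmd}
    {p q : Polynomial ℕ} (hi : Implements i p initC) (hh : Implements h q (stepC R.fst R.snd σ))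
    (n : ℕ) (advice : List Bool) :
    Comp.Sim (BlockReply n)
      (fun x y => x.1 0 = y.1.1 0 ∧ x.2 ≤ 2 * n + 8 + 3 * p.eval (3 * n + 1) +
        y.1.2 * embedOverhead q n (6 * n + 20) (16 * n + 20) y.1.2)
      ((distinguisher i h (max 3 D.bound) D).exec (prfStart n advice))
      (simulation R σ D n advice) := by
  set w := max 3 D.bound with hw
  have hw3 : 3 ≤ w := le_max_left _ _
  set s₀ := Function.update (inputs (.unary n) (.ofBits advice) .nil) w (.unary n) with hs₀
  simp only [distinguisher, Cmd.exec, Comp.pure_bind, prfStart, Expr.eval, Expr.cost, simulation]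
  have h1 := hi w n s₀ (0 + (inputs (.unary n) (.ofBits advice) .nil 0).size + 1)
  have e1 : s₀ w = .unary n := by simp [hs₀]
  have e2 : inputs (.unary n) (.ofBits advice) .nil 0 = .unary n := rfl
  rw [e1] at h1
  rw [e2] at h1 ⊢
  refine (h1.and_all all_initC).bind ?_
  rintro ⟨s, t⟩ v ⟨⟨rfl, hs, ht, hsize⟩, K, k, hv⟩
  dsimp only at hs ht hsize hv ⊢
  rw [Val.size_unary] at ht hsize
  rw [show n + (2 * n + 1) = 3 * n + 1 by ring] at ht hsize
  have hI : ∀ st q, (∃ s : (Table n × Table n) × (Party → List (Block n)),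
      st = encodeState (keyEnv k) s) → _ := fun st q hst =>
    all_stepC rfl (R.computes_fst _ k) (R.computes_snd _ k) (R.small_fst _ k)
      (R.small_snd _ k) σ st q hst
  have hw2 : w ≠ 2 := by omega
  refine (Cmd.sim_embed (T := 2 * n + 8 + 3 * p.eval (3 * n + 1)) (S := 6 * n + 20)
    (s₀ := fun _ => .nil) hh hI D (by omega) _
    ((envStart n advice (s w).hd), (s w).tl) ⟨fun r hr => ?_, by simp, ?_, ?_, ?_, ?_⟩).mono ?_
  · rw [zero_add] at hr ⊢
    dsimp only [envStart]
    rw [Function.update_of_ne (by omega)]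
    by_cases hr2 : r = 2
    · subst hr2; simp [inputs]
    · rw [Function.update_of_ne hr2, hs r hr, hs₀, Function.update_of_ne (by omega)]
      match r with
      | 0 => rfl
      | 1 => rfl
      | 2 => exact absurd rfl hr2
      | r + 3 => rfl
  · simp [Function.update_of_ne hw2]
  · exact ⟨initialState n, by rw [hv]; rfl⟩
  · rw [hv]
    have := Val.size_ofBlock_le k
    simp [encodeState, keyEnv, Val.size_unary, initialState, Table.encode, Val.ofBlocks]
    omega
  · dsimp only
    rw [Function.update_of_ne hw2]
    omega
  · rintro ⟨s', t'⟩ ⟨⟨s'', t''⟩, st⟩ hrel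
    exact ⟨by simpa using hrel.regs 0 (by omega), hrel.time⟩

/-- An environment gives a distinguisher that runs it in a game. -/
theorem exists_distinguisher (R : Reduction) (σ : Party) {a : ℕ → List Bool} {D : Cmd}
    (hD : PolyEnvironment a D) :
    ∃ D', PRFDistinguisher a D' ∧ ∀ n (f : Block n → Block n), prfRun a D' n f =
      (PMF.uniformOfFintype (Block n)).bind fun cur => (PMF.uniformOfFintype (Block n)).bind fun upd =>
      (PMF.uniformOfFintype (Block n)).bind fun k =>
        ((tableGame (R.fn (fun y => .pure (f y)) k) (R.fn' (fun y => .pure (f y)) k)).out σ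
          (D.exec (envStart n (a n) (initialView ⟨cur, upd⟩))) ([], [])).map accepts := by
  obtain ⟨P, hP⟩ := hD
  obtain ⟨i, p, hi⟩ := Feasible.initC
  obtain ⟨h, q, hh⟩ := R.feasible_fst.stepC R.growth_fst R.feasible_snd R.growth_snd σ
  refine ⟨distinguisher i h (max 3 D.bound) D, ⟨2 * Polynomial.X + 8 +
    3 * p.comp (3 * Polynomial.X + 1) + P * ((6 * Polynomial.X + 20) +
      (16 * Polynomial.X + 20) * P + P + 6 +
      3 * q.comp (Polynomial.X + (6 * Polynomial.X + 20) + (16 * Polynomial.X + 20) * P + P + 1)),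
    fun n => ?_⟩, fun n f => ?_⟩
  · refine ((sim_distinguisher R σ D hi hh n (a n)).and_all
      (all_simulation R σ (hP n))).all ?_
    rintro ⟨s, t⟩ ⟨⟨s', t'⟩, st⟩ ⟨⟨-, h1⟩, h2⟩
    dsimp only at h1 h2 ⊢
    refine h1.trans ?_
    have h3 := embedOverhead_mono q n (6 * n + 20) (16 * n + 20) h2
    have h4 := Nat.mul_le_mul h2 h3
    simp only [Polynomial.eval_add, Polynomial.eval_mul, Polynomial.eval_ofNat, Polynomial.eval_X,
      Polynomial.eval_comp, Polynomial.eval_one]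
    unfold embedOverhead at h4 ⊢
    omega
  · have h1 := (sim_distinguisher R σ D hi hh n (a n)).run_map
      (O := functionOracle f) (by rw [functionOracle_eq]; exact blockReply_of_mem_support)
      (fun o => accepts o) (fun o => accepts o.1) (by
        rintro ⟨s, t⟩ ⟨⟨s', t'⟩, st⟩ ⟨h, -⟩
        simpa [accepts] using congrArg Val.toBool h) ()
    have h2 := congrArg (PMF.map Prod.fst) h1
    rw [PMF.map_comp, PMF.map_comp] at h2
    have h3 := congrArg (PMF.map accepts)
      (run_simulation R σ D n (a n) fun y => .pure (f y))
    rw [← functionOracle_eq, PMF.map_comp] at h3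
    simp only [PMF.map_bind] at h3
    exact h2.trans h3

end

/-! ## The two reductions -/

theorem smallGrowth_of_support {n : ℕ} {F : Block n → Table n → PMF (Block n × Table n)}
    (h : ∀ y T, ∀ o ∈ (F y T).support, o.2 = T) : SmallGrowth F := fun y T o ho => by
  rw [h y T o ho]; omega

section

variable {n : ℕ}

/-- A function without state. -/
def memoryless (ρ : Block n → PMF (Block n)) (y : Block n) (T : Table n) :
    PMF (Block n × Table n) := (ρ y).map fun b => (b, T)

theorem smallGrowth_memoryless (ρ : Block n → PMF (Block n)) : SmallGrowth (memoryless ρ) :=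
  smallGrowth_of_support fun y T o ho => by
    rw [memoryless, PMF.mem_support_map_iff] at ho
    obtain ⟨b, -, rfl⟩ := ho
    rfl

@[simp] theorem memoryless_pure (f : Block n → Block n) (y : Block n) (T : Table n) :
    memoryless (fun y => .pure (f y)) y T = .pure (f y, T) := by
  simp [memoryless, PMF.pure_map]

/-- A lazily sampled function. -/
def lazyTable (y : Block n) (T : Table n) : PMF (Block n × Table n) := T.query (List.ofFn y)

theorem smallGrowth_lazyTable : SmallGrowth (lazyTable (n := n)) := fun y T o ho => by
  have := Table.size_encode_query ho
  rw [List.length_ofFn] at this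
  omega

end

/-- The oracle replaces the first keyed function. -/
def replaceFirst {E : ∀ n : ℕ, Block n → Block n → Block n} (hE : EfficientlyComputable E) :
    Reduction where
  fst := callBody
  snd := keyedBody E
  feasible_fst := feasible_call_hd.stateless
  growth_fst := growth_stateless feasible_call_hd
  feasible_snd := (feasible_keyed hE).stateless
  growth_snd := growth_stateless (feasible_keyed hE)
  fn ρ _ := memoryless ρ
  fn' {n} _ k := memoryless fun y => .pure (E n k y)
  computes_fst ρ k y T := run_callBody ρ _ y T
  computes_snd {n} ρ k y T := by rw [memoryless_pure]; exact run_keyedBody _ () E k y T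
  small_fst ρ _ := smallGrowth_memoryless ρ
  small_snd _ _ := smallGrowth_memoryless _

/-- The first keyed function is sampled lazily, the oracle replaces the second one. -/
def replaceSecond : Reduction where
  fst := queryBody
  snd := callBody
  feasible_fst := .queryBody
  growth_fst := growth_queryBody
  feasible_snd := feasible_call_hd.stateless
  growth_snd := growth_stateless feasible_call_hd
  fn _ _ := lazyTable
  fn' ρ _ := memoryless ρ
  computes_fst _ _ _ T := run_queryBody _ rfl _ T ()
  computes_snd ρ _ y T := run_callBody ρ _ y T
  small_fst _ _ := smallGrowth_lazyTable
  small_snd ρ _ := smallGrowth_memoryless ρ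

/-! ## The sequence of games -/

section

variable {n : ℕ} {α : Type}

/-- The game with two fixed functions. -/
def fixedGame (f g : Block n → Block n) : Game n (Table n) :=
  hashGame (fun x T => T.query x) (fun y T => .pure (f y, T)) fun y T => .pure (g y, T)

/-- Memoryless functions leave the second table idle, so it can be dropped. -/
theorem fixedGame_out (f g : Block n → Block n) (σ : Party) (x : Comp α) :
    (fixedGame f g).out σ x [] = (tableGame (memoryless fun y => .pure (f y))
      (memoryless fun y => .pure (g y))).out σ x ([], []) := by
  have h : Game.Hom (fun s : Table n × Table n => .pure s.1) (fixedGame f g)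
      (tableGame (memoryless fun y => .pure (f y)) (memoryless fun y => .pure (g y))) := by
    refine hashGame_hom (fun x => ?_) (fun y => ?_) fun y => ?_ <;> rw [kernelHom_pure_iff] <;>
      intro s
    · simp [liftFst, PMF.map_comp, Function.comp_def, map_id']
    · simp [liftSnd, PMF.pure_map]
    · simp [liftSnd, PMF.pure_map]
  have := h.out σ x ([], [])
  rwa [PMF.pure_bind] at this

/-- The game `G` in between carries the whole first function in its state. For fixed `f` it is the
game on the left; under the kernel `fillSnd`, which completes an initially empty table at random, it
is the game on the right. -/
theorem uniform_fixedGame_out (g : Block n → Block n) (σ : Party) (x : Comp α) :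
    (PMF.uniformOfFintype (Block n → Block n)).bind (fun f => (fixedGame f g).out σ x []) =
      (tableGame lazyTable (memoryless fun y => .pure (g y))).out σ x ([], []) := by
  set G : Game n (Table n × (Block n → Block n)) := hashGame (fun x => liftFst fun T => T.query x)
    eagerFn fun y => liftFst fun T => .pure (g y, T) with hG
  have h1 : ∀ f, G.out σ x ([], f) = (fixedGame f g).out σ x [] := fun f => by
    have h : Game.Hom (fun z : Table n => .pure (z, f)) G (fixedGame f g) :=
      hashGame_hom (fun x => kernelHom_fix_liftFst f _) (fun y => kernelHom_fix_eagerFn f y)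
        fun y => kernelHom_fix_liftFst f _
    have := h.out σ x []
    rwa [PMF.pure_bind] at this
  have h2 : Game.Hom fillSnd G (tableGame lazyTable (memoryless fun y => .pure (g y))) := by
    refine hashGame_hom (fun x => kernelHom_liftFst _) (fun y => kernelHom_lazyFn y) fun y => ?_
    have e : (fun s : Table n × Table n => liftSnd (memoryless (fun y => .pure (g y)) y) s) =
        liftFst fun T => .pure (g y, T) := by
      funext s
      simp [liftSnd, liftFst, PMF.pure_map]
    change KernelHom _ _ (fun s : Table n × Table n => liftSnd (memoryless (fun y => .pure (g y)) y) s)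
    rw [e]
    exact kernelHom_liftFst _
  have h3 := h2.out σ x ([], [])
  simp only [fillSnd, fill_nil, PMF.bind_map, Function.comp_def, h1] at h3
  exact h3

/-- The same passage from eager to lazy sampling for the second function; then the order of entries
in all three tables is forgotten. -/
theorem uniform_lazyGame_out (σ : Party) (x : Comp α) :
    (PMF.uniformOfFintype (Block n → Block n)).bind (fun g =>
      (tableGame lazyTable (memoryless fun y => .pure (g y))).out σ x ([], [])) =
      (lazyGame n).out σ x ((fun _ => none, fun _ => none), fun _ => none) := by
  set G : Game n ((Table n × Table n) × (Block n → Block n)) :=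
    hashGame (fun x => liftFst (liftFst fun T => T.query x)) (fun y => liftFst (liftSnd (lazyTable y)))
      eagerFn with hG
  set G' : Game n ((Table n × Table n) × Table n) :=
    hashGame (fun x => liftFst (liftFst fun T => T.query x)) (fun y => liftFst (liftSnd (lazyTable y)))
      lazyFn with hG'
  have h1 : ∀ g, G.out σ x (([], []), g) =
      (tableGame lazyTable (memoryless fun y => .pure (g y))).out σ x ([], []) := fun g => by
    have h : Game.Hom (fun z : Table n × Table n => .pure (z, g)) G
        (tableGame lazyTable (memoryless fun y => .pure (g y))) := by
      refine hashGame_hom (fun x => kernelHom_fix_liftFst g _) (fun y => kernelHom_fix_liftFst g _)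
        fun y => ?_
      have e : (fun s : Table n × Table n => liftSnd (memoryless (fun y => .pure (g y)) y) s) =
          fun s => .pure (g y, s) := by
        funext s
        simp [liftSnd, PMF.pure_map]
      change KernelHom _ _ (fun s : Table n × Table n => liftSnd (memoryless (fun y => .pure (g y)) y) s)
      rw [e]
      exact kernelHom_fix_eagerFn g y
    have := h.out σ x ([], [])
    rwa [PMF.pure_bind] at this
  have h2 : Game.Hom fillSnd G G' :=
    hashGame_hom (fun x => kernelHom_liftFst _) (fun y => kernelHom_liftFst _)
      fun y => kernelHom_lazyFn y
  have h3 : Game.Hom (fun s : (Table n × Table n) × Table n =>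
      .pure ((s.1.1.toPartialFn, s.1.2.toPartialFn), s.2.toPartialFn)) (lazyGame n) G' := by
    have hq := fun x (T : Table n) => kernelHom_pure_iff.1 (kernelHom_toPartialFn (n := n) x) T
    refine hashGame_hom (fun x => ?_) (fun y => ?_) fun y => ?_ <;> rw [kernelHom_pure_iff] <;>
      rintro ⟨⟨T₁, T₂⟩, T₃⟩
    · simp [liftFst, hq, PMF.map_comp, Function.comp_def]
    · simp [liftFst, liftSnd, lazyTable, hq, PMF.map_comp, Function.comp_def]
    · simp [liftSnd, lazyFn, hq, PMF.map_comp, Function.comp_def]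
  have h4 := h2.out σ x (([], []), [])
  simp only [fillSnd, fill_nil, PMF.bind_map, Function.comp_def, h1] at h4
  have h5 := h3.out σ x (([], []), [])
  rw [PMF.pure_bind] at h5
  exact h4.trans h5.symm

end

/-! ### The execution of the protocol -/

section

variable {n : ℕ} {β : Type}

theorem Block.xor_comm (a b : Block n) : a.xor b = b.xor a := by
  funext i; simp [Block.xor, Bool.xor_comm]

def Block.xorEquiv (a : Block n) : Block n ≃ Block n where
  toFun := a.xor
  invFun := a.xor
  left_inv b := by funext i; simp [Block.xor]
  right_inv b := by funext i; simp [Block.xor]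

/-- The one-time pad: translation by `a` permutes the blocks and preserves the uniform distribution.
-/
theorem uniform_bind_xor (a : Block n) (f : Block n → PMF β) :
    ((PMF.uniformOfFintype (Block n)).bind fun b => f (a.xor b)) =
      (PMF.uniformOfFintype (Block n)).bind f := by
  conv_rhs => rw [← map_uniformOfFintype_equiv (Block.xorEquiv a), PMF.bind_map]
  rfl

/-- The keys of one party are independent of the combined keys. -/
theorem sampleKeys_bind (σ : Party) (Φ : Keys n → Block n → Block n → PMF β) :
    ((sampleKeys n).bind fun keys => Φ (keys σ) ((keys .A).cur.xor (keys .B).cur)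
      ((keys .A).upd.xor (keys .B).upd)) =
    (PMF.uniformOfFintype (Block n)).bind fun cur => (PMF.uniformOfFintype (Block n)).bind fun upd =>
      (PMF.uniformOfFintype (Block n)).bind fun k => (PMF.uniformOfFintype (Block n)).bind fun k' =>
        Φ ⟨cur, upd⟩ k k' := by
  set U := PMF.uniformOfFintype (Block n)
  simp only [sampleKeys, PMF.bind_bind, PMF.pure_bind]
  cases σ with
  | A =>
    refine congrArg _ (funext fun cur => congrArg _ (funext fun upd => ?_))
    refine (uniform_bind_xor cur fun k => U.bind fun kB' =>
      Φ ⟨cur, upd⟩ k (upd.xor kB')).trans ?_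
    exact congrArg _ (funext fun k => uniform_bind_xor upd fun k' => Φ ⟨cur, upd⟩ k k')
  | B =>
    -- The shares of `A` are sampled first; they are moved inside so that they mask shares of `B`
    -- that are already fixed.
    have e : ∀ cur : Block n, (U.bind fun upd => U.bind fun kB => U.bind fun kB' =>
        Φ ⟨kB, kB'⟩ (cur.xor kB) (upd.xor kB')) = U.bind fun kB => U.bind fun kB' =>
          U.bind fun k' => Φ ⟨kB, kB'⟩ (cur.xor kB) k' := by
      intro cur
      rw [PMF.bind_comm]
      refine congrArg _ (funext fun kB => ?_)
      rw [PMF.bind_comm]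
      refine congrArg _ (funext fun kB' => ?_)
      simp only [Block.xor_comm _ kB']
      exact uniform_bind_xor kB' fun k' => Φ ⟨kB, kB'⟩ (cur.xor kB) k'
    refine (congrArg U.bind (funext e)).trans ?_
    rw [PMF.bind_comm]
    refine congrArg _ (funext fun kB => ?_)
    rw [PMF.bind_comm]
    refine congrArg _ (funext fun kB' => ?_)
    simp only [Block.xor_comm _ kB]
    exact uniform_bind_xor kB fun k => U.bind fun k' => Φ ⟨kB, kB'⟩ k k'

theorem xor_other (keys : Party → Block n) (p : Party) :
    (keys p).xor (keys p.other) = (keys .A).xor (keys .B) := by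
  cases p
  · rfl
  · exact Block.xor_comm _ _

theorem evalVia_fixed (f : Block n → Block n) (xs : List (List Bool)) (T : Table n) :
    evalVia (fun x T => Table.query T x) (fun y T => .pure (f y, T)) xs T =
      (Table.queryAll xs T).map fun o => ((o.1, o.1.map f), o.2) := by
  rw [evalVia, queryAll_eq_mapAcc]
  simp only [mapAcc_pure, PMF.pure_map]
  rfl

/-- In every step the shares enter only through their exclusive or, which is symmetric in the roles
of the parties. -/
theorem realStep_eq (E : Block n → Block n → Block n) (σ : Party) (keys : Party → Keys n) (q : Val) :
    KernelHom (fun s : Table n × (Party → List (Block n)) => .pure ⟨s.1, s.2⟩)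
      (realStep E σ keys · q) ((fixedGame (E ((keys .A).cur.xor (keys .B).cur))
        (E ((keys .A).upd.xor (keys .B).upd))).step σ · q) := by
  rw [kernelHom_pure_iff]
  rintro ⟨T, r⟩
  simp only [realStep, Game.step]
  rcases Query.decode n q with x | ⟨p, xs⟩ | ⟨p, zs⟩
  · simp [fixedGame, hashGame, PMF.map_comp, Function.comp_def]
  · have := xor_other (fun p => (keys p).cur) p
    simp [fixedGame, hashGame, evalVia_fixed, protocolEval, garbledCircuit, PMF.map_comp,
      Function.comp_def, this]
  · have := xor_other (fun p => (keys p).upd) p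
    rw [Block.xor_comm] at this
    dsimp only
    split_ifs <;>
      simp [fixedGame, hashGame, mapAcc_pure, protocolUpdate, garbledCircuit, PMF.pure_map, this]

theorem realRun_eq (E : ∀ n : ℕ, Block n → Block n → Block n) (σ : Party) (a : ℕ → List Bool)
    (D : Cmd) (n : ℕ) : realRun E σ a D n =
      (PMF.uniformOfFintype (Block n)).bind fun cur => (PMF.uniformOfFintype (Block n)).bind fun upd =>
      (PMF.uniformOfFintype (Block n)).bind fun k => (PMF.uniformOfFintype (Block n)).bind fun k' =>
        ((fixedGame (E n k) (E n k')).out σ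
          (D.exec (envStart n (a n) (initialView ⟨cur, upd⟩))) []).map accepts := by
  rw [← sampleKeys_bind σ fun K k k' => ((fixedGame (E n k) (E n k')).out σ
    (D.exec (envStart n (a n) (initialView K))) []).map accepts]
  refine congrArg _ (funext fun keys => ?_)
  have := (KernelHom.run (realStep_eq (E n) σ keys)
    (D.exec (envStart n (a n) (initialView (keys σ))))).map_fst_eq ([], fun _ => [])
  rw [PMF.pure_bind] at this
  rw [Game.out, ← this, PMF.map_comp]
  rfl

end

/-! ## The simulator -/

/-- The simulated messages for an event. Hash values are obtained from the random oracle, all other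
messages are outputs of the functionality. -/
def simC (v : Val) : Comp Val :=
  if v.hd = .nil then .pure v.tl
  else if v.hd.tl = .nil then (mapC callBody .nil v.tl.toList .nil).bind fun o => .pure o.hd
  else if v.hd.tl.tl = .nil then .pure v.tl
  else if v.hd.tl.tl.tl = .nil then .pure v.tl.tl
  else .pure .nil

theorem Feasible.simC : Feasible simC :=
  (ite (.hd (.reg 0)) (ite (.tl (.hd (.reg 0))) (ite (.tl (.tl (.hd (.reg 0))))
    (ite (.tl (.tl (.tl (.hd (.reg 0))))) (Feasible.expr .nil) (Feasible.expr (.tl (.tl (.reg 0)))))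
    (Feasible.expr (.tl (.reg 0))))
    (((Feasible.expr (.cons (.tl (.reg 0)) (.cons .nil .nil))).comp
      (feasible_call_hd.stateless.mapC (growth_stateless feasible_call_hd))).comp
      (Feasible.expr (.hd (.reg 0)))))
    (Feasible.expr (.tl (.reg 0)))).congr fun _ => rfl

/-- The program of the simulator. -/
def simulator (c : ℕ → Cmd) : Cmd := .seq (c 2) (.seq (.assign 0 (.reg 2)) (.assign 1 .nil))

section

variable {c : ℕ → Cmd} {p : Polynomial ℕ}

/-- One `p` is the time of the routine and the other pays for copying its output to register `0`;
the new state is always `nil`. -/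
theorem sim_activate (hc : Implements c p simC) (n : ℕ) (state : Val) (t : ℕ) {m : ℕ} (e : Event m) :
    Comp.Sim (BlockReply n) (fun o v => o.1 = (v, .nil) ∧
      o.2 ≤ t + (2 * p.eval (n + e.encode.size) + 3)) (activate (simulator c) n state t e)
      (simC e.encode) := by
  unfold activate simulator
  simp only [Cmd.exec, Comp.bind_assoc]
  rw [← Comp.bind_pure (simC e.encode)]
  refine (hc 2 n (inputs (.unary n) state e.encode) t).bind ?_
  rintro ⟨s, t'⟩ v ⟨rfl, hs, ht, hsize⟩
  change t' ≤ t + p.eval (n + e.encode.size) at ht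
  change (s 2).size ≤ p.eval (n + e.encode.size) at hsize
  refine .pure ⟨by simp [Expr.eval], ?_⟩
  simp only [Expr.cost]
  omega

theorem all_totalTime (hc : Implements c p simC) (n N : ℕ) (es : List (Event n))
    (hN : ∀ e ∈ es, n + e.encode.size ≤ N) (state : Val) (t : ℕ) :
    (totalTime (simulator c) n es state t).All (BlockReply n)
      fun t' => t' ≤ t + (es.map fun e => e.encode.size).sum * (2 * p.eval N + 3) := by
  induction es generalizing state t with
  | nil => exact Nat.le_add_right _ _
  | cons e es ih =>
    unfold totalTime
    rw [Comp.all_bind]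
    refine (sim_activate hc n state t e).all fun o v ⟨_, ho⟩ => ?_
    refine (ih (fun e' he' => hN e' (List.mem_cons_of_mem _ he')) o.1.2 o.2).mono fun t' ht' => ?_
    have h1 := polynomial_eval_mono p (hN e List.mem_cons_self)
    -- An event has size at least `1`, so the total length also bounds the number of activations.
    have h2 := e.encode.size_pos
    dsimp only at h1
    simp only [List.map_cons, List.sum_cons]
    nlinarith

theorem polySimulator_simulator (hc : Implements c p simC) : PolySimulator (simulator c) := by
  refine ⟨Polynomial.X * (2 * p + 3), fun n es => ?_⟩
  set N := n + (es.map fun e => e.encode.size).sum with hN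
  refine (all_totalTime hc n N es (fun e he => ?_) .nil 0).mono fun t ht => ?_
  · have := List.single_le_sum (l := es.map fun e => e.encode.size) (by simp) _
      (List.mem_map_of_mem he)
    omega
  · simp only [Polynomial.eval_add, Polynomial.eval_mul, Polynomial.eval_ofNat, Polynomial.eval_X]
    refine ht.trans ?_
    rw [zero_add]
    gcongr
    omega

variable {n : ℕ}

theorem simulate_simulator (hc : Implements c p simC) (s : IdealState n) (e : Event n) :
    simulate (simulator c) s e = ((simC e.encode).run roStep s.ro).map fun o =>
      (o.1, { s with ro := o.2, sim := .nil }) := by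
  have h := (sim_activate hc n s.sim 0 e).run_map (O := roStep (n := n)) (fun H q o ho => by
    rw [roStep, PMF.mem_support_map_iff] at ho
    obtain ⟨o, -, rfl⟩ := ho
    exact ⟨_, rfl⟩) (fun o => o.1) (fun v => (v, Val.nil)) (fun _ _ h => h.1) s.ro
  have h' := congrArg (PMF.map fun o : (Val × Val) × Table n =>
    (o.1.1, ({ s with ro := o.2, sim := o.1.2 } : IdealState n))) h
  rw [PMF.map_comp, PMF.map_comp] at h'
  exact h'

theorem run_mapC_callBody (xs : List (List Bool)) (T : Table n) :
    (mapC callBody .nil (xs.map Val.ofBits) .nil).run roStep T =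
      (Table.queryAll xs T).map fun o => (.cons (.ofBlocks o.1) .nil, o.2) := by
  induction xs generalizing T with
  | nil => simp [mapC, Table.queryAll, Comp.run, PMF.pure_map, Val.ofBlocks]
  | cons x xs ih =>
    simp only [List.map_cons, mapC, callBody, stateless, Comp.call_bind, Comp.pure_bind, Comp.run,
      Val.hd_cons, Val.tl_cons, Comp.run_bind, Table.queryAll, PMF.map_bind, roStep,
      Val.toBits_ofBits, PMF.bind_map, Function.comp_def] at ih ⊢
    refine congrArg _ (funext fun o => ?_)
    rw [ih, PMF.bind_map]
    simp [PMF.pure_map, Function.comp_def, Val.ofBlocks]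

theorem run_simC_sent (xs : List (List Bool)) (T : Table n) :
    (simC (Event.encode (n := n) (.sent xs))).run roStep T =
      (Table.queryAll xs T).map fun o => (.ofBlocks o.1, o.2) := by
  have : simC (Event.encode (n := n) (.sent xs)) =
      (mapC callBody .nil (xs.map Val.ofBits) .nil).bind fun o => .pure o.hd := by
    simp [simC, Event.encode, Val.unary]
  rw [this, Comp.run_bind, run_mapC_callBody, PMF.bind_map]
  rfl

theorem simulate_init (hc : Implements c p simC) (s : IdealState n) (K : Keys n) :
    simulate (simulator c) s (.init K) = .pure (initialView K, { s with sim := .nil }) := by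
  rw [simulate_simulator hc]
  simp [simC, Event.encode, Val.unary, Comp.run, PMF.pure_map]

theorem simulate_sent (hc : Implements c p simC) (s : IdealState n) (xs : List (List Bool)) :
    simulate (simulator c) s (.sent xs) = (Table.queryAll xs s.ro).map fun o =>
      (.ofBlocks o.1, { s with ro := o.2, sim := .nil }) := by
  rw [simulate_simulator hc, run_simC_sent, PMF.map_comp]
  rfl

theorem simulate_received (hc : Implements c p simC) (s : IdealState n) (ys : List (Block n)) :
    simulate (simulator c) s (.received ys) = .pure (.ofBlocks ys, { s with sim := .nil }) := by
  rw [simulate_simulator hc]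
  simp [simC, Event.encode, Val.unary, Comp.run, PMF.pure_map]

theorem simulate_updated (hc : Implements c p simC) (s : IdealState n) (zs ys : List (Block n)) :
    simulate (simulator c) s (.updated zs ys) = .pure (.ofBlocks ys, { s with sim := .nil }) := by
  rw [simulate_simulator hc]
  simp [simC, Event.encode, Val.unary, Comp.run, PMF.pure_map]

theorem simulate_assisted (hc : Implements c p simC) (s : IdealState n) (m : ℕ) :
    simulate (simulator c) s (.assisted m) = .pure (.nil, { s with sim := .nil }) := by
  rw [simulate_simulator hc]
  simp [simC, Event.encode, Val.unary, Comp.run, PMF.pure_map]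

/-! ## The ideal execution with the simulator -/

/-- With a corrupted sender, the functionality answers before the simulator hashes, while the game
hashes first. The two samplings are independent and may be exchanged. -/
theorem idealStep_eq (hc : Implements c p simC) (σ : Party) (q : Val) :
    KernelHom (fun s : (Table n × FuncState n) × (Party → List (Block n)) =>
        .pure ⟨s.1.1, s.1.2, s.2, .nil⟩)
      (idealStep (simulator c) σ · q)
      ((idealGame σ fun x (T : Table n) => T.query x).step σ · q) := by
  rw [kernelHom_pure_iff]
  rintro ⟨⟨T, F⟩, r⟩
  simp only [idealStep, Game.step]
  rcases Query.decode n q with x | ⟨s, xs⟩ | ⟨s, zs⟩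
  · simp [idealGame, liftFst, PMF.map_comp, Function.comp_def]
  · dsimp only [idealGame]
    by_cases h : σ = s
    · simp only [if_pos h, simulate_sent hc, PMF.map_comp, PMF.map_bind, ← queryAll_eq_mapAcc,
        Function.comp_def]
      simp only [PMF.map, Function.comp_def]
      rw [PMF.bind_comm]
    · simp only [if_neg h, simulate_received hc, PMF.pure_map, PMF.pure_bind, PMF.map_comp,
        Function.comp_def]
      simp only [PMF.map, Function.comp_def]
  · dsimp only [idealGame]
    by_cases hz : ∀ z ∈ zs, z ∈ r s
    · rw [if_pos hz, if_pos hz]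
      by_cases h : σ = s
      · simp only [if_pos h, simulate_updated hc, PMF.pure_map, PMF.map_comp, Function.comp_def]
        simp only [PMF.map, Function.comp_def]
      · simp only [if_neg h, simulate_assisted hc, PMF.pure_map, PMF.map_comp, Function.comp_def]
        simp only [PMF.map, Function.comp_def]
        rfl
    · rw [if_neg hz, if_neg hz, PMF.pure_map]

/-- The functionality after the initialization. -/
def initialFunc (k k' : Block n) : FuncState n :=
  ⟨Function.update (Function.update (fun _ => none) 0 (some k)) 1 (some k'), fun _ => []⟩

theorem init_init (kA kB kA' kB' : Block n) :
    ((FuncState.empty n).init 0 kA kB).init 1 kA' kB' = initialFunc (kA.xor kB) (kA'.xor kB') := by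
  simp [FuncState.init, FuncState.empty, initialFunc]

/-- Both games are images of the game with pending inputs, after the order of the oracle's entries
has been forgotten. At the start the pending list is empty, so the kernel that hashes it does
nothing. -/
theorem idealGame_out {α : Type} (σ : Party) (x : Comp α) (F : FuncState n) :
    (idealGame σ fun x (T : Table n) => T.query x).out σ x ([], F) =
      (hashedIdealGame n σ).out σ x (fun _ => none, F) := by
  have h1 := (idealGame_hom σ (kernelHom_toPartialFn (n := n))).out σ x ([], F)
  have h2 := (pendingIdealGame_forget (n := n) σ).out σ x ((fun _ => none, F), [])
  have h3 := (pendingIdealGame_hash (n := n) σ).out σ x ((fun _ => none, F), [])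
  rw [PMF.pure_bind] at h1 h2
  simp only [mapAcc, PMF.pure_map, PMF.pure_bind] at h3
  rw [h3, ← h1, ← h2]
  rfl

theorem idealRun_eq (hc : Implements c p simC) (σ : Party) (a : ℕ → List Bool) (D : Cmd) (n : ℕ) :
    idealRun (simulator c) σ a D n =
      (PMF.uniformOfFintype (Block n)).bind fun cur => (PMF.uniformOfFintype (Block n)).bind fun upd =>
      (PMF.uniformOfFintype (Block n)).bind fun k => (PMF.uniformOfFintype (Block n)).bind fun k' =>
        ((hashedIdealGame n σ).out σ (D.exec (envStart n (a n) (initialView ⟨cur, upd⟩)))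
          (fun _ => none, initialFunc k k')).map accepts := by
  rw [← sampleKeys_bind σ fun K k k' => ((hashedIdealGame n σ).out σ
    (D.exec (envStart n (a n) (initialView K))) (fun _ => none, initialFunc k k')).map accepts]
  refine congrArg _ (funext fun keys => ?_)
  simp only [init_init, simulate_init hc, PMF.pure_bind]
  have := (KernelHom.run (idealStep_eq hc σ) (D.exec (envStart n (a n) (initialView (keys σ))))
    ).map_fst_eq (([], initialFunc ((keys .A).cur.xor (keys .B).cur)
      ((keys .A).upd.xor (keys .B).upd)), fun _ => [])
  rw [PMF.pure_bind] at this
  rw [← idealGame_out, Game.out, ← this, PMF.map_comp]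
  rfl

end

/-! ## Negligible functions -/

theorem Negligible.of_le {f g : ℕ → ℝ} (hg : Negligible g) (h : ∀ n, |f n| ≤ g n) : Negligible f :=
  hg.trans_abs_le fun n => (h n).trans (le_abs_self _)

theorem negligible_two_pow_inv : Negligible fun n => ((2 : ℝ) ^ n)⁻¹ := by
  intro m
  have := tendsto_pow_const_mul_const_pow_of_lt_one m (r := (2 : ℝ)⁻¹) (by norm_num) (by norm_num)
  simpa [inv_pow] using this

theorem Negligible.polynomial_mul {f : ℕ → ℝ} (hf : Negligible f) (p : Polynomial ℕ) :
    Negligible fun n => ((p.eval n : ℕ) : ℝ) * f n := by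
  have := Asymptotics.SuperpolynomialDecay.polynomial_mul hf (p.map (Nat.castRingHom ℝ))
  refine this.congr fun n => ?_
  simp [Polynomial.eval_map, Polynomial.eval₂_at_natCast]

theorem toReal_blockProb (n : ℕ) : (blockProb n).toReal = ((2 : ℝ) ^ n)⁻¹ := by
  simp [blockProb]

/-! ## Correctness of the protocol -/

section

variable {n : ℕ}

theorem Table.lookup_of_mem_support_query {x : List Bool} {T : Table n} {o : Block n × Table n}
    (ho : o ∈ (T.query x).support) :
    o.2.lookup x = some o.1 ∧ ∀ y b, T.lookup y = some b → o.2.lookup y = some b := by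
  rcases h : T.lookup x with _ | b
  · rw [Table.query_of_none h, PMF.mem_support_map_iff] at ho
    obtain ⟨b, -, rfl⟩ := ho
    have h1 := congrFun (lookup_snoc h b)
    dsimp only at h1 ⊢
    refine ⟨by rw [h1]; simp, fun y c hy => ?_⟩
    rw [h1, Function.update_of_ne, hy]
    rintro rfl
    simp [h] at hy
  · rw [Table.query_of_some h, PMF.mem_support_pure_iff] at ho
    subst ho
    exact ⟨h, fun _ _ h => h⟩

/-- Filled entries are never overwritten, so values returned on the way are still found in the final
table. -/
theorem Table.lookup_of_mem_support_queryAll {xs : List (List Bool)} {T : Table n}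
    {o : List (Block n) × Table n} (ho : o ∈ (Table.queryAll xs T).support) :
    o.1.map some = (xs.map fun x => o.2.lookup x) ∧ ∀ y b, T.lookup y = some b → o.2.lookup y = some b := by
  induction xs generalizing T o with
  | nil =>
    rw [Table.queryAll, PMF.mem_support_pure_iff] at ho
    subst ho
    exact ⟨rfl, fun _ _ h => h⟩
  | cons x xs ih =>
    simp only [Table.queryAll, PMF.mem_support_bind_iff, PMF.mem_support_pure_iff] at ho
    obtain ⟨o₁, h₁, o₂, h₂, rfl⟩ := ho
    obtain ⟨h₃, h₄⟩ := Table.lookup_of_mem_support_query h₁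
    obtain ⟨h₅, h₆⟩ := ih h₂
    exact ⟨by simp [h₅, h₆ _ _ h₃], fun y b hy => h₆ y b (h₄ y b hy)⟩

end

/-- The hash values are lookups in the final table, and each circuit combines the two shares to the
common key (`xor_other`) before applying `E`. -/
theorem computesPRF (E : ∀ n : ℕ, Block n → Block n → Block n) : ComputesPRF E := by
  intro n keys sender xs H o ho
  rw [protocolEval, PMF.mem_support_map_iff] at ho
  obtain ⟨o, ho, rfl⟩ := ho
  obtain ⟨h, -⟩ := Table.lookup_of_mem_support_queryAll ho
  have hcur := xor_other (fun p => (keys p).cur) sender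
  have hupd := xor_other (fun p => (keys p).upd) sender.other
  rw [Block.xor_comm] at hupd
  refine ⟨?_, fun xs' _ zs hzs => ?_⟩
  · have := congrArg (List.map (Option.map (E n ((keys .A).cur.xor (keys .B).cur)))) h
    unfold prfValue
    simpa [garbledCircuit, hcur, Function.comp_def] using this
  · have := congrArg (List.map (Option.map (E n ((keys .A).upd.xor (keys .B).upd)))) hzs
    simpa [protocolUpdate, garbledCircuit, hupd, Function.comp_def] using this

/-! ## Security -/

section

variable {E : ∀ n : ℕ, Block n → Block n → Block n} {a : ℕ → List Bool} {D : Cmd} {σ : Party}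

theorem Close.bind_eq {α β : Type} {ε : ℝ≥0∞} (p : PMF α) {k k' : α → PMF β}
    (h : ∀ a, Close Eq ε (k a) (k' a)) : Close Eq ε (p.bind k) (p.bind k') := by
  have := (Close.refl p).bind (k := k) (k' := k') (R' := Eq) (δ := ε) fun a b hab => hab ▸ h a
  rwa [zero_add] at this

theorem bind_rotate {α β γ δ : Type} (p : PMF α) (q : PMF β) (r : PMF γ) (f : α → β → γ → PMF δ) :
    (p.bind fun a => q.bind fun b => r.bind fun c => f a b c) =
      r.bind fun c => p.bind fun a => q.bind fun b => f a b c :=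
  (congrArg _ (funext fun _ => PMF.bind_comm _ _ _)).trans (PMF.bind_comm _ _ _)

/-- An environment with oracle access to independent random functions, sampled lazily. -/
theorem close_lazy_ideal {c : ℕ → Cmd} {p P : Polynomial ℕ} (hc : Implements c p simC)
    (hP : ∀ (n : ℕ) (K : Keys n), (D.exec (envStart n (a n) (initialView K))).All (ReplyOk n)
      fun o => o.2 ≤ P.eval n) (n : ℕ) :
    Close Eq ((P.eval n : ℕ) * (2 * ((P.eval n : ℕ) * blockProb n)))
      ((PMF.uniformOfFintype (Block n)).bind fun cur => (PMF.uniformOfFintype (Block n)).bind fun upd =>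
        ((lazyGame n).out σ (D.exec (envStart n (a n) (initialView ⟨cur, upd⟩)))
          ((fun _ => none, fun _ => none), fun _ => none)).map accepts)
      (idealRun (simulator c) σ a D n) := by
  rw [idealRun_eq hc]
  refine Close.bind_eq _ fun cur => Close.bind_eq _ fun upd => ?_
  have h1 : ∀ k k' : Block n, Close Eq _ _ _ := fun k k' =>
    (close_out σ (hP n ⟨cur, upd⟩) (initialFunc k k') rfl rfl).map (φ := accepts) (ψ := accepts)
      fun _ _ h => congrArg accepts h
  have h2 := Close.bind_eq (PMF.uniformOfFintype (Block n)) fun k =>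
    Close.bind_eq (PMF.uniformOfFintype (Block n)) fun k' => h1 k k'
  -- The game on the left does not involve the recorded keys, so their sampling collapses there.
  rwa [PMF.bind_const, PMF.bind_const] at h2

theorem securelyRealizes (hE : EfficientlyComputable E) (hPRF : IsPRF E a) :
    SecurelyRealizes E a := by
  intro σ
  obtain ⟨c, p, hc⟩ := Feasible.simC
  refine ⟨simulator c, polySimulator_simulator hc, fun D hD => ?_⟩
  obtain ⟨D₁, hD₁, h₁⟩ := exists_distinguisher (replaceFirst hE) σ hD
  obtain ⟨D₂, hD₂, h₂⟩ := exists_distinguisher replaceSecond σ hD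
  obtain ⟨P, hP⟩ := hD
  have h₁' : ∀ n (f : Block n → Block n), prfRun a D₁ n f =
      (PMF.uniformOfFintype (Block n)).bind fun cur => (PMF.uniformOfFintype (Block n)).bind fun upd =>
      (PMF.uniformOfFintype (Block n)).bind fun k => ((fixedGame f (E n k)).out σ
        (D.exec (envStart n (a n) (initialView ⟨cur, upd⟩))) []).map accepts := fun n f => by
    simp only [h₁, fixedGame_out]
    rfl
  have h₂' : ∀ n (f : Block n → Block n), prfRun a D₂ n f =
      (PMF.uniformOfFintype (Block n)).bind fun cur => (PMF.uniformOfFintype (Block n)).bind fun upd =>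
        ((tableGame lazyTable (memoryless fun y => .pure (f y))).out σ
          (D.exec (envStart n (a n) (initialView ⟨cur, upd⟩))) ([], [])).map accepts := fun n f => by
    rw [h₂]
    -- The second reduction makes no use of the key that the distinguisher samples.
    exact congrArg _ (funext fun cur => congrArg _ (funext fun upd =>
      PMF.bind_const (PMF.uniformOfFintype (Block n))
        (((tableGame lazyTable (memoryless fun y => .pure (f y))).out σ
          (D.exec (envStart n (a n) (initialView ⟨cur, upd⟩))) ([], [])).map accepts)))
  -- The oracle of `D₁` plays `E_k`, and its own random key plays `k'`.
  have e₁ : ∀ n, realRun E σ a D n = prfReal E a D₁ n := fun n => by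
    rw [realRun_eq, prfReal, bind_rotate]
    simp only [h₁']
  -- Both are the hybrid with a random first function and a keyed second one: `D₁` has the former as
  -- oracle, `D₂` samples it lazily and has the latter as oracle.
  have e₂ : ∀ n, prfIdeal a D₁ n = prfReal E a D₂ n := fun n => by
    rw [prfIdeal, prfReal]
    simp only [h₁', h₂']
    refine (bind_rotate _ _ _ _).symm.trans (Eq.trans ?_ (bind_rotate _ _ _ _))
    refine congrArg _ (funext fun cur => congrArg _ (funext fun upd => ?_))
    rw [PMF.bind_comm]
    refine congrArg _ (funext fun k => ?_)
    rw [← PMF.map_bind, uniform_fixedGame_out]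
  have e₃ : ∀ n, prfIdeal a D₂ n = (PMF.uniformOfFintype (Block n)).bind fun cur =>
      (PMF.uniformOfFintype (Block n)).bind fun upd =>
        ((lazyGame n).out σ (D.exec (envStart n (a n) (initialView ⟨cur, upd⟩)))
          ((fun _ => none, fun _ => none), fun _ => none)).map accepts := fun n => by
    rw [prfIdeal]
    simp only [h₂', ← uniform_lazyGame_out, PMF.map_bind]
    rw [← bind_rotate]
  -- The total advantage is at most two PRF advantages plus the collision term `2 * P ^ 2 / 2 ^ n`.
  have hneg := ((hPRF D₁ hD₁).add (hPRF D₂ hD₂)).add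
    (negligible_two_pow_inv.polynomial_mul (2 * P ^ 2))
  refine Negligible.of_le hneg fun n => ?_
  have hfin : ((P.eval n : ℕ) : ℝ≥0∞) * (2 * ((P.eval n : ℕ) * blockProb n)) ≠ ∞ := by
    have : blockProb n ≠ ∞ := by simp [blockProb]
    finiteness
  have h3 := (close_lazy_ideal (σ := σ) hc hP n).abs_sub_le hfin
  rw [← e₃] at h3
  simp only [ENNReal.toReal_mul, ENNReal.toReal_natCast, ENNReal.toReal_ofNat,
    toReal_blockProb] at h3
  rw [abs_abs, e₁]
  have h4 := abs_sub_le (prfReal E a D₁ n true).toReal (prfIdeal a D₁ n true).toReal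
    (idealRun (simulator c) σ a D n true).toReal
  have h5 := abs_sub_le (prfReal E a D₂ n true).toReal (prfIdeal a D₂ n true).toReal
    (idealRun (simulator c) σ a D n true).toReal
  rw [← e₂] at h5
  simp only [Pi.add_apply, ← e₂, Polynomial.eval_mul, Polynomial.eval_ofNat, Polynomial.eval_pow,
    Nat.cast_mul, Nat.cast_ofNat, Nat.cast_pow] at h5 ⊢
  nlinarith

end

end DurPRF

end

theorem theorem3 (AES : DurPRF.AESFamily) (hAES : DurPRF.EfficientlyComputable AES.enc)
    (advice : ℕ → List Bool)
    (hadvice : ∃ p : Polynomial ℕ, ∀ n, (advice n).length ≤ p.eval n)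
    (hPRF : DurPRF.IsPRF AES.enc advice) :
    DurPRF.ComputesPRF AES.enc ∧ DurPRF.SecurelyRealizes AES.enc advice :=
  ⟨DurPRF.computesPRF AES.enc, DurPRF.securelyRealizes hAES hPRF⟩
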